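/- Let $k$ be a field and $\pi$ a group; unadorned $\otimes$ is over $k$. **Crossed T-categories.** A *crossed T-category* over $\pi$ is a tensor category $\mathcal C$ that is a disjoint union of full subcategories $\mathcal C_\alpha$ $(\alpha\in\pi)$, with no morphisms between different components and with $\mathcal C_\alpha\otimes\mathcal C_\beta\subseteq\mathcal C_{\alpha\beta}$, together with a group homomorphism $\beta\mapsto{}^\beta(-)$ from $\pi$ to the group of invertible strict tensor functors $\mathcal C\to\mathcal C$ such that ${}^\beta\mathcal C_\alpha=\mathcal C_{\beta\alpha\beta^{-1}}$. For $U\in\mathcal C_\alpha$ put ${}^U(-)={}^\alpha(-)$. A *braiding* is a family of isomorphisms $c_{U,V}:U\otimes V\to{}^UV\otimes U$, natural in $U$ and $V$, with ${}^\alpha(c_{U,V})=c_{{}^\alpha U,{}^\alpha V}$ and $$c_{U,V\otimes W}=a^{-1}(\mathrm{id}\otimes c_{U,W})\,a\,(c_{U,V}\otimes\mathrm{id})\,a^{-1},\tag{1}$$ $$c_{U\otimes V,W}=a\,(c_{U,{}^VW}\otimes\mathrm{id})\,a^{-1}(\mathrm{id}\otimes c_{V,W})\,a,\tag{2}$$ where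 $a$ is the associativity constraint. The *center* $\mathcal Z(\mathcal C)$ is the following braided crossed T-category. Its objects are the pairs $(U,c_{U,-})$ with $U\in\mathcal C$ and $c_{U,-}:U\otimes-\to{}^U(-)\otimes U$ a natural isomorphism satisfying (1); its morphisms $(U,c)\to(V,c')$ are the $f:U\to V$ with $({}^UX\otimes f)c_{U,X}=c'_{V,X}(f\otimes X)$ for all $X$. The tensor product is $(U\otimes V,c\otimes c')$ with $c\otimes c'$ given by the right side of (2); the unit is the unit $I$ of $\mathcal C$ with the canonical isomorphisms $I\otimes X\cong X\otimes I$; the component of $(U,c)$ is that of $U$; ${}^\beta(U,c)=({}^\beta U,\,X\mapsto{}^\beta(c_{U,{}^{\beta^{-1}}X}))$; the braiding of $(U,c),(V,c')$ is $c_{U,V}$; constraints, and tensor products and conjugates of morphisms, are those of $\mathcal C$. **Quasi-Turaev coalgebras.** Let $H$ be a quasi-Turaev $\pi$-coalgebra over $k$, i.e. a family of $k$-algebras $H_\alpha$ $(\alpha\in\pi)$ with algebra maps $\Delta_{\alpha,\beta}:H_{\alpha\beta}\to H_\alpha\otimes H_\beta$, $\varepsilon:H_1\to k$, invertible elements $\Phi_{\alpha,\beta,\gamma}\in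 H_\alpha\otimes H_\beta\otimes H_\gamma$, invertible algebra anti-homomorphisms $S_\alpha:H_\alpha\to H_{\alpha^{-1}}$, elements $p_\alpha,q_\alpha\in H_\alpha$ and algebra isomorphisms $\varphi_\beta:H_\alpha\to H_{\beta\alpha\beta^{-1}}$, such that for all indices and all $h$ (Sweedler notation $\Delta_{\alpha,\beta}(h)=h_{(1,\alpha)}\otimes h_{(2,\beta)}$; $Y^1\otimes Y^2\otimes Y^3$ denotes a $\Phi$, and $y^1\otimes y^2\otimes y^3$, $t^1\otimes t^2\otimes t^3$ denote $\Phi^{-1}$'s; a lower index on a component gives the algebra that it lies in, and so the $\Phi$ that is meant) * $(\mathrm{id}\otimes\Delta_{\beta,\gamma})\Delta_{\alpha,\beta\gamma}(h)\,\Phi_{\alpha,\beta,\gamma}=\Phi_{\alpha,\beta,\gamma}\,(\Delta_{\alpha,\beta}\otimes\mathrm{id})\Delta_{\alpha\beta,\gamma}(h)$; $(\mathrm{id}\otimes\varepsilon)\Delta_{\alpha,1}=\mathrm{id}=(\varepsilon\otimes\mathrm{id})\Delta_{1,\alpha}$; * $(1\otimes\Phi_{\beta,\gamma,\lambda})(\mathrm{id}\otimes\Delta_{\beta,\gamma}\otimes\mathrm{id})(\Phi_{\alpha,\beta\gamma,\lambda})(\Phi_{\alpha,\beta,\gamma}\otimes1)=(\mathrm{id}\otimes\mathrm{id}\otimes\Delta_{\gamma,\lambda})(\Phi_{\alpha,\beta,\gamma\lambda})(\Delta_{\alpha,\beta}\otimes\mathrm{id}\otimes\mathrm{id})(\Phi_{\alpha\beta,\gamma,\lambda})$;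 $(\mathrm{id}\otimes\varepsilon\otimes\mathrm{id})(\Phi_{\alpha,1,\beta})=1\otimes1$; * $S_\alpha(h_{(1,\alpha)})p_{\alpha^{-1}}h_{(2,\alpha^{-1})}=\varepsilon(h)p_{\alpha^{-1}}$ and $h_{(1,\alpha)}q_\alpha S_{\alpha^{-1}}(h_{(2,\alpha^{-1})})=\varepsilon(h)q_\alpha$ for $h\in H_1$; $Y^1_\alpha q_\alpha S_{\alpha^{-1}}(Y^2_{\alpha^{-1}})p_\alpha Y^3_\alpha=1$ and $S_{\alpha^{-1}}(y^1_{\alpha^{-1}})p_\alpha y^2_\alpha q_\alpha S_{\alpha^{-1}}(y^3_{\alpha^{-1}})=1$; * $(\varphi_\beta\otimes\varphi_\beta)\Delta_{\alpha,\gamma}=\Delta_{\beta\alpha\beta^{-1},\beta\gamma\beta^{-1}}\varphi_\beta$, $\varepsilon\varphi_\beta=\varepsilon$, $\varphi_\beta\varphi_{\beta'}=\varphi_{\beta\beta'}$, and $(\varphi_\eta\otimes\varphi_\theta\otimes\varphi_\vartheta)\Phi_{\alpha,\beta,\gamma}=\Phi_{\eta\alpha\eta^{-1},\theta\beta\theta^{-1},\vartheta\gamma\vartheta^{-1}}$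 for all $\eta,\theta,\vartheta\in\pi$. $\mathrm{Rep}(H)$ is the crossed T-category that is the disjoint union of the categories of left $H_\alpha$-modules: $H_{\alpha\beta}$ acts on $V\otimes W$ through $\Delta_{\alpha,\beta}$, the unit is $k$ with action through $\varepsilon$, the associativity constraint is $(u\otimes v)\otimes w\mapsto\Phi\cdot(u\otimes(v\otimes w))$, the unit constraints are the usual ones, and ${}^\beta V=\{{}^\beta v\mid v\in V\}$ is the space $V$ with $h\cdot{}^\beta v={}^\beta(\varphi_{\beta^{-1}}(h)\cdot v)$ for $h\in H_{\beta\alpha\beta^{-1}}$. **Yetter–Drinfeld modules.** A $YD_\alpha$-module is a left $H_\alpha$-module $V$ with linear maps $\rho_{V,\lambda}:V\to V\otimes H_\lambda$, $v\mapsto v_{(0,0)}\otimes v_{(1,\lambda)}$ $(\lambda\in\pi)$, such that $(\mathrm{id}\otimes\varepsilon)\rho_{V,1}=\mathrm{id}$, $$(y^2_\alpha v_{(0,0)})_{(0,0)}\otimes(y^2_\alpha v_{(0,0)})_{(1,\lambda_1)}y^1_{\lambda_1}\otimes y^3_{\lambda_2}v_{(1,\lambda_2)}=\Phi^{-1}_{\alpha,\lambda_1,\lambda_2}\cdot\big[(y^3_\alpha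 v)_{(0,0)}\otimes(y^3_\alpha v)_{(1,\lambda_1\lambda_2)(1,\lambda_1)}y^1_{\lambda_1}\otimes(y^3_\alpha v)_{(1,\lambda_1\lambda_2)(2,\lambda_2)}y^2_{\lambda_2}\big]$$ ($y$ from $\Phi^{-1}_{\lambda_1,\alpha,\lambda_2}$ on the left, from $\Phi^{-1}_{\lambda_1,\lambda_2,\alpha}$ on the right), and for $h\in H_{\alpha\lambda}$ $$h_{(1,\alpha)}v_{(0,0)}\otimes h_{(2,\lambda)}v_{(1,\lambda)}=(h_{(2,\alpha)}v)_{(0,0)}\otimes(h_{(2,\alpha)}v)_{(1,\lambda)}\varphi_{\alpha^{-1}}(h_{(1,\alpha\lambda\alpha^{-1})}).$$ Morphisms are the $H_\alpha$-linear maps $f$ with $\rho_{V,\lambda}f=(f\otimes\mathrm{id})\rho_{U,\lambda}$ for all $\lambda$, and $YD(H)$ is the disjoint union of the categories $YD_\alpha(H)$. **Theorem.** There are functors $F_1:\mathcal Z(\mathrm{Rep}(H))\to YD(H)$ and $F_2:YD(H)\to\mathcal Z(\mathrm{Rep}(H))$, both the identity on underlying modules and on morphisms, such that * $F_1(V,c_{V,-})=(V,\rho_V)$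 with $\rho_{V,\lambda}(v)=c^{-1}_{V,H_\lambda}({}^\alpha1_\lambda\otimes v)$ for $V$ an $H_\alpha$-module; * $F_2(V,\rho_V)=(V,c_{V,-})$ with, for $V$ a $YD_\alpha$-module and $X$ an $H_\lambda$-module, $$c_{V,X}(v\otimes x)={}^\alpha\big[\varphi_{\alpha^{-1}}(J^1_{(1,\alpha\lambda\alpha^{-1})})\,y^1_\lambda\,S_{\lambda^{-1}}\big(J^2_{\lambda^{-1}}y^3_{\lambda^{-1}}(\tilde I^2_\alpha v)_{(1,\lambda^{-1})}\tilde I^1_{\lambda^{-1}}\big)\cdot x\big]\otimes J^1_{(2,\alpha)}y^2_\alpha\cdot(\tilde I^2_\alpha v)_{(0,0)},$$ where $J^1\otimes J^2=Y^1\otimes S^{-1}_{\lambda^{-1}}(p_\lambda Y^3)Y^2\in H_{\alpha\lambda}\otimes H_{\lambda^{-1}}$ with $Y$ from $\Phi_{\alpha\lambda,\lambda^{-1},\lambda}$, $\tilde I^1\otimes\tilde I^2=Y^2S^{-1}_{\lambda^{-1}}(Y^1q_\lambda)\otimes Y^3\in H_{\lambda^{-1}}\otimes H_\alpha$ with $Y$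 from $\Phi_{\lambda,\lambda^{-1},\alpha}$, and $y$ is from $\Phi^{-1}_{\lambda,\alpha,\lambda^{-1}}$. They are mutually inverse: $F_2F_1=\mathrm{id}$ and $F_1F_2=\mathrm{id}$. So $YD(H)$ and $\mathcal Z(\mathrm{Rep}(H))$ are isomorphic categories. Moreover $YD(H)$ carries a structure of braided crossed T-category for which $F_1$ and $F_2$ strictly preserve tensor product, unit, constraints, components, conjugation and braiding, and which is given as follows (constraints, and tensor products and conjugates of morphisms, being those of $\mathrm{Rep}(H)$). For a $YD_\alpha$-module $V$ and a $YD_\beta$-module $W$, $V\otimes W$ is the $YD_{\alpha\beta}$-module with $$\rho_{V\otimes W,\lambda}(v\otimes w)=t^1_\alpha Y^1_\alpha(y^2_\alpha v)_{(0,0)}\otimes t^2_\beta(Y^3_\beta y^3_\beta w)_{(0,0)}\otimes t^3_\lambda(Y^3_\beta y^3_\beta w)_{(1,\lambda)}Y^2_\lambda\varphi_{\beta^{-1}}\big((y^2_\alpha v)_{(1,\beta\lambda\beta^{-1})}\big)y^1_\lambda$$ ($t$ from $\Phi^{-1}_{\alpha,\beta,\lambda}$, $Y$ from $\Phi_{\alpha,\lambda,\beta}$,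 $y$ from $\Phi^{-1}_{\lambda,\alpha,\beta}$); the unit is $k$ with $\rho_{k,\lambda}(1)=1\otimes1_\lambda$; the conjugate ${}^\beta V$ has $\rho_{{}^\beta V,\lambda}({}^\beta v)={}^\beta(v_{(0,0)})\otimes\varphi_\beta(v_{(1,\beta^{-1}\lambda\beta)})$; and the braiding $c_{V,W}$ is given by the formula for $c_{V,X}$ above with $X=W$, $\lambda=\beta$. -/

import Mathlib

universe v u

section Algebra

open scoped TensorProduct

/-- The identification of two members of a family of algebras whose indices are equal. -/
def castAlg {k : Type u} [Field k] {π : Type v} (A : π → Type u) [∀ α, Ring (A α)]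
    [∀ α, Algebra k (A α)] {α β : π} (h : α = β) : A α ≃ₐ[k] A β :=
  h ▸ AlgEquiv.refl

/-- A quasi-semi-T-coalgebra over the group `π`. -/
structure QuasiSemiTCoalgebra (k : Type u) [Field k] (π : Type v) [Group π] where
  /-- the family of algebras -/
  A : π → Type u
  [ring : ∀ α, Ring (A α)]
  [algebra : ∀ α, Algebra k (A α)]
  /-- the comultiplication -/
  Δ : ∀ α β, A (α * β) →ₐ[k] A α ⊗[k] A β
  /-- the counit -/
  ε : A 1 →ₐ[k] k
  /-- the family of invertible elements `Φ_{α,β,γ}` -/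
  Φ : ∀ α β γ, (A α ⊗[k] (A β ⊗[k] A γ))ˣ
  quasi_coassoc : ∀ (α β γ) (h : A (α * β * γ)),
    Algebra.TensorProduct.map (AlgHom.id k (A α)) (Δ β γ)
        (Δ α (β * γ) (castAlg (k := k) A (mul_assoc α β γ) h)) * (Φ α β γ).val =
      (Φ α β γ).val * Algebra.TensorProduct.assoc k k k (A α) (A β) (A γ)
        (Algebra.TensorProduct.map (Δ α β) (AlgHom.id k (A γ)) (Δ (α * β) γ h))
  counit_right : ∀ (α) (a : A α),
    Algebra.TensorProduct.rid k k (A α) (Algebra.TensorProduct.map (AlgHom.id k (A α)) ε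
      (Δ α 1 (castAlg (k := k) A (mul_one α).symm a))) = a
  counit_left : ∀ (α) (a : A α),
    Algebra.TensorProduct.lid k (A α) (Algebra.TensorProduct.map ε (AlgHom.id k (A α))
      (Δ 1 α (castAlg (k := k) A (one_mul α).symm a))) = a
  /-- the pentagon identity for `Φ`, in `A α ⊗ (A β ⊗ (A γ ⊗ A η))` -/
  Φ_pentagon : ∀ α β γ η,
    ((1 : A α) ⊗ₜ[k] (Φ β γ η).val) *
      Algebra.TensorProduct.map (AlgHom.id k (A α))
        ((Algebra.TensorProduct.assoc k k k (A β) (A γ) (A η)).toAlgHom.comp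
          (Algebra.TensorProduct.map (Δ β γ) (AlgHom.id k (A η)))) (Φ α (β * γ) η).val *
      Algebra.TensorProduct.map (AlgHom.id k (A α))
          (Algebra.TensorProduct.assoc k k k (A β) (A γ) (A η)).toAlgHom
        (Algebra.TensorProduct.assoc k k k (A α) (A β ⊗[k] A γ) (A η)
          ((Φ α β γ).val ⊗ₜ[k] (1 : A η))) =
    Algebra.TensorProduct.map (AlgHom.id k (A α))
        (Algebra.TensorProduct.map (AlgHom.id k (A β)) (Δ γ η)) (Φ α β (γ * η)).val *
      Algebra.TensorProduct.assoc k k k (A α) (A β) (A γ ⊗[k] A η)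
        (Algebra.TensorProduct.map (Δ α β) (AlgHom.id k (A γ ⊗[k] A η)) (Φ (α * β) γ η).val)
  /-- `(id ⊗ ε ⊗ id) Φ_{α,1,β} = 1 ⊗ 1` -/
  Φ_counit : ∀ α β,
    Algebra.TensorProduct.map (AlgHom.id k (A α))
        ((Algebra.TensorProduct.lid k (A β)).toAlgHom.comp
          (Algebra.TensorProduct.map ε (AlgHom.id k (A β)))) (Φ α 1 β).val = 1

attribute [instance] QuasiSemiTCoalgebra.ring QuasiSemiTCoalgebra.algebra

/-- The linear map `x ⊗ y ↦ f x * c * g y`. -/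
def mulMid {k : Type u} [Field k] {A B C : Type u} [AddCommGroup A] [Module k A]
    [AddCommGroup B] [Module k B] [Ring C] [Algebra k C]
    (f : A →ₗ[k] C) (c : C) (g : B →ₗ[k] C) : A ⊗[k] B →ₗ[k] C :=
  LinearMap.mul' k C ∘ₗ TensorProduct.map (LinearMap.mulRight k c ∘ₗ f) g

/-- A quasi-Hopf group coalgebra: a quasi-semi-T-coalgebra with an antipode `S` consisting of
invertible algebra anti-homomorphisms `S_α : A α → A α⁻¹`, and with elements `p_α, q_α`. -/
structure QuasiHopfGroupCoalgebra (k : Type u) [Field k] (π : Type v) [Group π] extends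
    QuasiSemiTCoalgebra k π where
  /-- the antipode -/
  antipode : ∀ α, A α ≃ₐ[k] (A α⁻¹)ᵐᵒᵖ
  /-- the elements `p_α` -/
  p : ∀ α, A α
  /-- the elements `q_α` -/
  q : ∀ α, A α
  /-- `S(h₁) p h₂ = ε(h) p` -/
  antipode_p : ∀ (α) (h : A 1),
    mulMid ((MulOpposite.opLinearEquiv k).symm.toLinearMap ∘ₗ (antipode α).toLinearMap)
        (p α⁻¹) LinearMap.id (Δ α α⁻¹ (castAlg (k := k) A (mul_inv_cancel α).symm h)) =
      ε h • p α⁻¹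
  /-- `h₁ q S(h₂) = ε(h) q` -/
  antipode_q : ∀ (α) (h : A 1),
    mulMid LinearMap.id (q α)
        ((castAlg (k := k) A (inv_inv α)).toLinearMap ∘ₗ
          (MulOpposite.opLinearEquiv k).symm.toLinearMap ∘ₗ (antipode α⁻¹).toLinearMap)
        (Δ α α⁻¹ (castAlg (k := k) A (mul_inv_cancel α).symm h)) = ε h • q α
  /-- `Y¹ q S(Y²) p Y³ = 1`, where `Φ_{α,α⁻¹,α} = Y¹ ⊗ Y² ⊗ Y³` -/
  antipode_Φ : ∀ α,
    mulMid LinearMap.id (q α)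
        (mulMid ((castAlg (k := k) A (inv_inv α)).toLinearMap ∘ₗ
          (MulOpposite.opLinearEquiv k).symm.toLinearMap ∘ₗ (antipode α⁻¹).toLinearMap)
          (p α) LinearMap.id) (Φ α α⁻¹ α).val = 1
  /-- `S(y¹) p y² q S(y³) = 1`, where `Φ⁻¹_{α⁻¹,α,α⁻¹} = y¹ ⊗ y² ⊗ y³` -/
  antipode_Φ_inv : ∀ α,
    mulMid ((castAlg (k := k) A (inv_inv α)).toLinearMap ∘ₗ
          (MulOpposite.opLinearEquiv k).symm.toLinearMap ∘ₗ (antipode α⁻¹).toLinearMap) (p α)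
        (mulMid LinearMap.id (q α) ((castAlg (k := k) A (inv_inv α)).toLinearMap ∘ₗ
          (MulOpposite.opLinearEquiv k).symm.toLinearMap ∘ₗ (antipode α⁻¹).toLinearMap))
      (Φ α⁻¹ α α⁻¹).inv = 1

/-- A quasi-Turaev `π`-coalgebra: a quasi-Hopf group coalgebra with a crossing `φ`. -/
structure QuasiTuraevCoalgebra (k : Type u) [Field k] (π : Type v) [Group π] extends
    QuasiHopfGroupCoalgebra k π where
  /-- the crossing -/
  φ : ∀ β α, A α ≃ₐ[k] A (β * α * β⁻¹)
  φ_comul : ∀ (β α γ) (a : A (α * γ)),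
    Algebra.TensorProduct.map (φ β α).toAlgHom (φ β γ).toAlgHom (Δ α γ a) =
      Δ (β * α * β⁻¹) (β * γ * β⁻¹)
        (castAlg (k := k) A (show β * (α * γ) * β⁻¹ = β * α * β⁻¹ * (β * γ * β⁻¹) by group)
          (φ β (α * γ) a))
  φ_counit : ∀ (β) (a : A 1),
    ε (castAlg (k := k) A (show β * 1 * β⁻¹ = 1 by group) (φ β 1 a)) = ε a
  φ_mul : ∀ (β γ α) (a : A α),
    φ β (γ * α * γ⁻¹) (φ γ α a) =
      castAlg (k := k) A (show β * γ * α * (β * γ)⁻¹ = β * (γ * α * γ⁻¹) * β⁻¹ by group)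
        (φ (β * γ) α a)
  /-- the family `Φ` is invariant under the crossing, in each of its three places -/
  φ_Φ : ∀ (η θ ϑ α β γ),
    Algebra.TensorProduct.map (φ η α).toAlgHom
        (Algebra.TensorProduct.map (φ θ β).toAlgHom (φ ϑ γ).toAlgHom) (Φ α β γ).val =
      (Φ (η * α * η⁻¹) (θ * β * θ⁻¹) (ϑ * γ * ϑ⁻¹)).val

end Algebra

section Representations

open scoped TensorProduct

section Lemmas

variable {k : Type u} [Field k]

@[simp] theorem castAlg_rfl {π : Type v} (A : π → Type u) [∀ α, Ring (A α)]
    [∀ α, Algebra k (A α)] {α : π} (h : α = α) (x : A α) : castAlg (k := k) A h x = x := rfl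

@[simp] theorem castAlg_castAlg {π : Type v} (A : π → Type u) [∀ α, Ring (A α)]
    [∀ α, Algebra k (A α)] {α β γ : π} (h : α = β) (h' : β = γ) (x : A α) :
    castAlg (k := k) A h' (castAlg (k := k) A h x) = castAlg (k := k) A (h.trans h') x := by
  subst h h'; rfl

variable {A B C D V W X Y : Type u} [Ring A] [Algebra k A] [Ring B] [Algebra k B]
  [Ring C] [Algebra k C] [Ring D] [Algebra k D]
  [AddCommGroup V] [Module k V] [AddCommGroup W] [Module k W]
  [AddCommGroup X] [Module k X] [AddCommGroup Y] [Module k Y]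

/-- The action of `A ⊗ B` on `V ⊗ W` built from actions of `A` on `V` and of `B` on `W`. -/
def tensorAct (f : A →ₐ[k] Module.End k V) (g : B →ₐ[k] Module.End k W) :
    A ⊗[k] B →ₐ[k] Module.End k (V ⊗[k] W) :=
  (Module.endTensorEndAlgHom (R := k) (S := k) (A := k) (M := V) (N := W)).comp
    (Algebra.TensorProduct.map f g)

@[simp] theorem tensorAct_tmul (f : A →ₐ[k] Module.End k V) (g : B →ₐ[k] Module.End k W)
    (a : A) (b : B) (v : V) (w : W) :
    tensorAct f g (a ⊗ₜ b) (v ⊗ₜ w) = f a v ⊗ₜ[k] g b w := rfl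

theorem tensorAct_map {f : A →ₐ[k] Module.End k V} {g : B →ₐ[k] Module.End k W}
    {f' : C →ₐ[k] Module.End k X} {g' : D →ₐ[k] Module.End k Y}
    {σ : A →ₐ[k] C} {τ : B →ₐ[k] D} {p : V →ₗ[k] X} {q : W →ₗ[k] Y}
    (hp : ∀ a v, p (f a v) = f' (σ a) (p v)) (hq : ∀ b w, q (g b w) = g' (τ b) (q w))
    (t : A ⊗[k] B) (z : V ⊗[k] W) :
    TensorProduct.map p q (tensorAct f g t z) =
      tensorAct f' g' (Algebra.TensorProduct.map σ τ t) (TensorProduct.map p q z) := by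
  induction t using TensorProduct.induction_on with
  | zero => simp
  | add s t hs ht => simp only [map_add, LinearMap.add_apply, hs, ht]
  | tmul a b =>
    induction z using TensorProduct.induction_on with
    | zero => simp
    | add s t hs ht => simp only [map_add, hs, ht]
    | tmul v w => simp [hp, hq]

theorem tensorAct_assoc (f : A →ₐ[k] Module.End k V) (g : B →ₐ[k] Module.End k W)
    (h : C →ₐ[k] Module.End k X) (t : (A ⊗[k] B) ⊗[k] C) (z : (V ⊗[k] W) ⊗[k] X) :
    TensorProduct.assoc k V W X (tensorAct (tensorAct f g) h t z) =
      tensorAct f (tensorAct g h) (Algebra.TensorProduct.assoc k k k A B C t)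
        (TensorProduct.assoc k V W X z) := by
  induction t using TensorProduct.induction_on with
  | zero => simp
  | add s t hs ht => simp only [map_add, LinearMap.add_apply, hs, ht]
  | tmul s c =>
    induction s using TensorProduct.induction_on with
    | zero => simp
    | add s t hs ht => simp only [map_add, TensorProduct.add_tmul, LinearMap.add_apply, hs, ht]
    | tmul a b =>
      induction z using TensorProduct.induction_on with
      | zero => simp
      | add s t hs ht => simp only [map_add, hs, ht]
      | tmul v x =>
        induction v using TensorProduct.induction_on with
        | zero => simp
        | add s t hs ht => simp only [map_add, TensorProduct.add_tmul, hs, ht]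
        | tmul v w => simp

theorem tensorAct_comp (f : A →ₐ[k] Module.End k V) (g : B →ₐ[k] Module.End k W)
    (σ : C →ₐ[k] A) (τ : D →ₐ[k] B) (t : C ⊗[k] D) :
    tensorAct (f.comp σ) (g.comp τ) t = tensorAct f g (Algebra.TensorProduct.map σ τ t) := by
  induction t using TensorProduct.induction_on with
  | zero => simp
  | add s t hs ht => simp only [map_add, hs, ht]
  | tmul a b => ext v w; simp

theorem tensorAct_comp_left (f : A →ₐ[k] Module.End k V) (g : B →ₐ[k] Module.End k W)
    (σ : C →ₐ[k] A) : tensorAct (f.comp σ) g =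
      (tensorAct f g).comp (Algebra.TensorProduct.map σ (AlgHom.id k B)) :=
  AlgHom.ext fun t => tensorAct_comp f g σ (AlgHom.id k B) t

theorem tensorAct_comp_right (f : A →ₐ[k] Module.End k V) (g : B →ₐ[k] Module.End k W)
    (τ : D →ₐ[k] B) : tensorAct f (g.comp τ) =
      (tensorAct f g).comp (Algebra.TensorProduct.map (AlgHom.id k A) τ) :=
  AlgHom.ext fun t => tensorAct_comp f g (AlgHom.id k A) τ t

end Lemmas

variable {k : Type u} [Field k] {π : Type v} [Group π]

namespace QuasiTuraevCoalgebra

variable (H : QuasiTuraevCoalgebra k π)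

/-- The identification of `H_α` and `H_β` for equal indices `α = β`. -/
def cast {α β : π} (h : α = β) : H.A α ≃ₐ[k] H.A β := castAlg (k := k) H.A h

variable {H}

@[simp] theorem cast_rfl {α : π} (h : α = α) (x : H.A α) : H.cast h x = x := rfl

@[simp] theorem cast_cast {α β γ : π} (h : α = β) (h' : β = γ) (x : H.A α) :
    H.cast h' (H.cast h x) = H.cast (h.trans h') x := by
  subst h h'; rfl

theorem Δ_cast {α α' β β' : π} (h : α = α') (h' : β = β') (e : α * β = α' * β')
    (x : H.A (α * β)) :
    H.Δ α' β' (H.cast e x) =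
      Algebra.TensorProduct.map (H.cast h).toAlgHom (H.cast h').toAlgHom (H.Δ α β x) := by
  subst h h'
  exact (DFunLike.congr_fun (Algebra.TensorProduct.map_id (R := k) (S := k)) _).symm

theorem Φ_cast {α α' β β' γ γ' : π} (h : α = α') (h' : β = β') (h'' : γ = γ') :
    Algebra.TensorProduct.map (H.cast h).toAlgHom
      (Algebra.TensorProduct.map (H.cast h').toAlgHom (H.cast h'').toAlgHom) (H.Φ α β γ).val =
      (H.Φ α' β' γ').val := by
  subst h h' h''
  have : Algebra.TensorProduct.map (AlgHom.id k (H.A α)) (Algebra.TensorProduct.map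
      (AlgHom.id k (H.A β)) (AlgHom.id k (H.A γ))) = AlgHom.id k _ := by
    rw [Algebra.TensorProduct.map_id, Algebra.TensorProduct.map_id]
  exact DFunLike.congr_fun this _

theorem φ_cast {β β' α α' : π} (h : β = β') (h' : α = α') (x : H.A α) :
    H.φ β' α' (H.cast h' x) = H.cast (by rw [h, h']) (H.φ β α x) := by
  subst h h'; rfl

end QuasiTuraevCoalgebra

/-- An object of the representation category `Rep(H)`: a left module over some `H_α`. The index `α`
is part of the object, and the action is given as an algebra homomorphism. -/
structure HRep (H : QuasiTuraevCoalgebra k π) where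
  /-- the index `α` -/
  deg : π
  /-- the underlying vector space -/
  V : Type u
  [addCommGroup : AddCommGroup V]
  [module : Module k V]
  /-- the action of `H_α` -/
  act : H.A deg →ₐ[k] Module.End k V

attribute [instance] HRep.addCommGroup HRep.module

namespace HRep

variable {H : QuasiTuraevCoalgebra k π}

/-- Morphisms of `Rep(H)`: the `H_α`-linear maps; there are none between modules over components
with different indices. -/
@[ext] structure Hom (X Y : HRep H) where
  deg_eq : X.deg = Y.deg
  /-- the underlying linear map -/
  lin : X.V →ₗ[k] Y.V
  comm : ∀ h x, lin (X.act h x) = Y.act (H.cast deg_eq h) (lin x)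

open CategoryTheory

instance : Category (HRep H) where
  Hom := Hom
  id X := ⟨rfl, LinearMap.id, fun _ _ => rfl⟩
  comp f g := ⟨f.deg_eq.trans g.deg_eq, g.lin ∘ₗ f.lin, fun h x => by simp [f.comm, g.comm]⟩

@[ext] theorem hom_ext {X Y : HRep H} {f g : X ⟶ Y} (h : f.lin = g.lin) : f = g := Hom.ext h

@[simp] theorem id_lin (X : HRep H) : Hom.lin (𝟙 X) = LinearMap.id := rfl

@[simp] theorem comp_lin {X Y Z : HRep H} (f : X ⟶ Y) (g : Y ⟶ Z) :
    (f ≫ g).lin = g.lin ∘ₗ f.lin := rfl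

/-- The tensor product of an `H_α`-module and an `H_β`-module, an `H_{αβ}`-module via `Δ_{α,β}`. -/
abbrev tensor (X Y : HRep H) : HRep H where
  deg := X.deg * Y.deg
  V := X.V ⊗[k] Y.V
  act := (tensorAct X.act Y.act).comp (H.Δ X.deg Y.deg)

/-- The unit object: the `H_1`-module `k`, with action through the counit. -/
abbrev unit : HRep H where
  deg := 1
  V := k
  act := (Algebra.lmul k k).comp H.ε

/-- The isomorphism given by a linear equivalence that commutes with the actions. -/
def isoMk {X Y : HRep H} (h : X.deg = Y.deg) (e : X.V ≃ₗ[k] Y.V)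
    (c : ∀ a x, e (X.act a x) = Y.act (H.cast h a) (e x)) : X ≅ Y where
  hom := ⟨h, e.toLinearMap, c⟩
  inv := ⟨h.symm, e.symm.toLinearMap, fun a y => e.injective (by simp [c])⟩
  hom_inv_id := by ext; simp
  inv_hom_id := by ext; simp

/-- The tensor product of morphisms is the tensor product of linear maps. -/
def tensorMap {X X' Y Y' : HRep H} (f : X ⟶ X') (g : Y ⟶ Y') : tensor X Y ⟶ tensor X' Y' where
  deg_eq := congrArg₂ (· * ·) f.deg_eq g.deg_eq
  lin := TensorProduct.map f.lin g.lin
  comm h x := by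
    change TensorProduct.map f.lin g.lin (tensorAct X.act Y.act (H.Δ _ _ h) x) =
      tensorAct X'.act Y'.act (H.Δ _ _ (H.cast _ h)) _
    rw [QuasiTuraevCoalgebra.Δ_cast f.deg_eq g.deg_eq]
    exact tensorAct_map f.comm g.comm _ _

/-- The action of `Φ` on a threefold tensor product. -/
def ΦEquiv (X Y Z : HRep H) : X.V ⊗[k] (Y.V ⊗[k] Z.V) ≃ₗ[k] X.V ⊗[k] (Y.V ⊗[k] Z.V) :=
  LinearEquiv.ofLinearMap
    (tensorAct X.act (tensorAct Y.act Z.act) (H.Φ X.deg Y.deg Z.deg).val)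
    (tensorAct X.act (tensorAct Y.act Z.act) (H.Φ X.deg Y.deg Z.deg).inv)
    (by rw [← Module.End.mul_eq_comp, ← map_mul, Units.val_inv, map_one]; rfl)
    (by rw [← Module.End.mul_eq_comp, ← map_mul, Units.inv_val, map_one]; rfl)

/-- The associativity constraint `(x ⊗ y) ⊗ z ↦ Φ · (x ⊗ (y ⊗ z))`. -/
def assocIso (X Y Z : HRep H) : tensor (tensor X Y) Z ≅ tensor X (tensor Y Z) :=
  isoMk (mul_assoc _ _ _) ((TensorProduct.assoc k X.V Y.V Z.V).trans (ΦEquiv X Y Z)) (by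
    intro a x
    change H.A (X.deg * Y.deg * Z.deg) at a
    change tensorAct X.act (tensorAct Y.act Z.act) _ (TensorProduct.assoc k X.V Y.V Z.V
      (tensorAct ((tensorAct X.act Y.act).comp _) (Z.act.comp (AlgHom.id _ _)) _ x)) =
      tensorAct (X.act.comp (AlgHom.id _ _)) ((tensorAct Y.act Z.act).comp _) _
        (tensorAct X.act (tensorAct Y.act Z.act) _ _)
    rw [tensorAct_comp, tensorAct_comp, tensorAct_assoc]
    rw [← Module.End.mul_apply, ← map_mul]
    refine Eq.trans ?_ (Module.End.mul_apply _ _ _)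
    rw [← map_mul]
    congr 2
    exact (H.quasi_coassoc _ _ _ _).symm)

/-- The left unit constraint. -/
def lidIso (X : HRep H) : tensor unit X ≅ X :=
  isoMk (one_mul _) (TensorProduct.lid k X.V) (by
    intro a x
    have key : ∀ (t : H.A 1 ⊗[k] H.A X.deg) (z : k ⊗[k] X.V),
        TensorProduct.lid k X.V (tensorAct ((Algebra.lmul k k).comp H.ε) X.act t z) =
        X.act (Algebra.TensorProduct.lid k (H.A X.deg) (Algebra.TensorProduct.map H.ε
          (AlgHom.id k _) t)) (TensorProduct.lid k X.V z) := by
      intro t z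
      induction t using TensorProduct.induction_on with
      | zero => simp
      | add s t hs ht => simp only [map_add, LinearMap.add_apply, hs, ht]
      | tmul a b =>
        induction z using TensorProduct.induction_on with
        | zero => simp
        | add s t hs ht => simp only [map_add, hs, ht]
        | tmul v w => simp [← mul_smul, mul_comm]
    refine (key _ _).trans ?_
    have := H.counit_left X.deg (H.cast (one_mul _) a)
    change Algebra.TensorProduct.lid k (H.A X.deg) (Algebra.TensorProduct.map H.ε (AlgHom.id k _)
      (H.Δ _ _ (H.cast _ (H.cast _ a)))) = _ at this
    rw [QuasiTuraevCoalgebra.cast_cast, QuasiTuraevCoalgebra.cast_rfl] at this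
    change X.act (Algebra.TensorProduct.lid k (H.A X.deg) (Algebra.TensorProduct.map H.ε (AlgHom.id k _)
      (H.Δ 1 X.deg a))) _ = _
    rw [this])

/-- The right unit constraint. -/
def ridIso (X : HRep H) : tensor X unit ≅ X :=
  isoMk (mul_one _) (TensorProduct.rid k X.V) (by
    intro a x
    have key : ∀ (t : H.A X.deg ⊗[k] H.A 1) (z : X.V ⊗[k] k),
        TensorProduct.rid k X.V (tensorAct X.act ((Algebra.lmul k k).comp H.ε) t z) =
        X.act (Algebra.TensorProduct.rid k k (H.A X.deg) (Algebra.TensorProduct.map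
          (AlgHom.id k _) H.ε t)) (TensorProduct.rid k X.V z) := by
      intro t z
      induction t using TensorProduct.induction_on with
      | zero => simp
      | add s t hs ht => simp only [map_add, LinearMap.add_apply, hs, ht]
      | tmul a b =>
        induction z using TensorProduct.induction_on with
        | zero => simp
        | add s t hs ht => simp only [map_add, hs, ht]
        | tmul v w => simp [← mul_smul, mul_comm]
    refine (key _ _).trans ?_
    have := H.counit_right X.deg (H.cast (mul_one _) a)
    change Algebra.TensorProduct.rid k k (H.A X.deg) (Algebra.TensorProduct.map (AlgHom.id k _) H.ε
      (H.Δ _ _ (H.cast _ (H.cast _ a)))) = _ at this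
    rw [QuasiTuraevCoalgebra.cast_cast, QuasiTuraevCoalgebra.cast_rfl] at this
    change X.act (Algebra.TensorProduct.rid k k (H.A X.deg) (Algebra.TensorProduct.map (AlgHom.id k _) H.ε
      (H.Δ X.deg 1 a))) _ = _
    rw [this])

open MonoidalCategory

instance : MonoidalCategoryStruct (HRep H) where
  tensorObj := tensor
  tensorUnit := unit
  tensorHom := tensorMap
  whiskerLeft X _ _ f := tensorMap (𝟙 X) f
  whiskerRight f Y := tensorMap f (𝟙 Y)
  associator := assocIso
  leftUnitor := lidIso
  rightUnitor := ridIso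

set_option maxHeartbeats 2000000 in
theorem pentagon_aux (W X Y Z : HRep H) :
    tensorMap (assocIso W X Y).hom (𝟙 Z) ≫ (assocIso W (tensor X Y) Z).hom ≫
      tensorMap (𝟙 W) (assocIso X Y Z).hom =
    (assocIso (tensor W X) Y Z).hom ≫ (assocIso W X (tensor Y Z)).hom := by
  apply hom_ext
  refine TensorProduct.ext_fourfold fun w x y z => ?_
  let A4 := tensorAct W.act (tensorAct X.act (tensorAct Y.act Z.act))
  let z4 := w ⊗ₜ[k] (x ⊗ₜ[k] (y ⊗ₜ[k] z))
  -- the first map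
  have h1 : Hom.lin (tensorMap (assocIso W X Y).hom (𝟙 Z)) (((w ⊗ₜ[k] x) ⊗ₜ[k] y) ⊗ₜ[k] z) =
      tensorAct (tensorAct W.act (tensorAct X.act Y.act)) Z.act
        ((H.Φ W.deg X.deg Y.deg).val ⊗ₜ[k] (1 : H.A Z.deg))
          ((w ⊗ₜ[k] (x ⊗ₜ[k] y)) ⊗ₜ[k] z) := by
    rw [tensorAct_tmul, map_one]; rfl
  -- the second map
  have h2 : ∀ s, Hom.lin (assocIso W (tensor X Y) Z).hom s =
      tensorAct W.act (tensorAct (tensorAct X.act Y.act) Z.act)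
        (Algebra.TensorProduct.map (AlgHom.id k _) (Algebra.TensorProduct.map
          (H.Δ X.deg Y.deg) (AlgHom.id k _)) (H.Φ W.deg (X.deg * Y.deg) Z.deg).val)
        (TensorProduct.assoc k W.V (X.V ⊗[k] Y.V) Z.V s) := by
    intro s
    have : (assocIso W (tensor X Y) Z).hom.lin s = tensorAct W.act
      (tensorAct ((tensorAct X.act Y.act).comp (H.Δ X.deg Y.deg)) Z.act)
      (H.Φ W.deg (X.deg * Y.deg) Z.deg).val
      (TensorProduct.assoc k W.V (X.V ⊗[k] Y.V) Z.V s) := rfl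
    rw [this, tensorAct_comp_left, tensorAct_comp_right]
    rfl
  -- the third map
  have h3 : ∀ s, Hom.lin (tensorMap (𝟙 W) (assocIso X Y Z).hom) s =
      A4 (1 ⊗ₜ[k] (H.Φ X.deg Y.deg Z.deg).val)
        (TensorProduct.map LinearMap.id (TensorProduct.assoc k X.V Y.V Z.V).toLinearMap s) := by
    intro s
    induction s using TensorProduct.induction_on with
    | zero => simp
    | add s t hs ht => simp only [map_add, hs, ht]
    | tmul a b =>
      simp only [TensorProduct.map_tmul]
      rw [tensorAct_tmul, map_one]; rfl
  have h4 : ∀ s, Hom.lin (assocIso (tensor W X) Y Z).hom s =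
      tensorAct (tensorAct W.act X.act) (tensorAct Y.act Z.act)
        (Algebra.TensorProduct.map (H.Δ W.deg X.deg) (AlgHom.id k _)
          (H.Φ (W.deg * X.deg) Y.deg Z.deg).val)
        (TensorProduct.assoc k (W.V ⊗[k] X.V) Y.V Z.V s) := by
    intro s
    have : (assocIso (tensor W X) Y Z).hom.lin s =
      tensorAct ((tensorAct W.act X.act).comp (H.Δ W.deg X.deg)) (tensorAct Y.act Z.act)
      (H.Φ (W.deg * X.deg) Y.deg Z.deg).val
      (TensorProduct.assoc k (W.V ⊗[k] X.V) Y.V Z.V s) := rfl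
    rw [this, tensorAct_comp_left]
    rfl
  have h5 : ∀ s, Hom.lin (assocIso W X (tensor Y Z)).hom s =
      A4 (Algebra.TensorProduct.map (AlgHom.id k _) (Algebra.TensorProduct.map
          (AlgHom.id k _) (H.Δ Y.deg Z.deg)) (H.Φ W.deg X.deg (Y.deg * Z.deg)).val)
        (TensorProduct.assoc k W.V X.V (Y.V ⊗[k] Z.V) s) := by
    intro s
    have : (assocIso W X (tensor Y Z)).hom.lin s =
      tensorAct W.act (tensorAct X.act ((tensorAct Y.act Z.act).comp (H.Δ Y.deg Z.deg)))
      (H.Φ W.deg X.deg (Y.deg * Z.deg)).val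
      (TensorProduct.assoc k W.V X.V (Y.V ⊗[k] Z.V) s) := rfl
    rw [this, tensorAct_comp_right, tensorAct_comp_right]
    rfl
  have h6 : ∀ t s, TensorProduct.map LinearMap.id (TensorProduct.assoc k X.V Y.V Z.V).toLinearMap
      (tensorAct W.act (tensorAct (tensorAct X.act Y.act) Z.act) t s) =
      A4 (Algebra.TensorProduct.map (AlgHom.id k _)
        (Algebra.TensorProduct.assoc k k k _ _ _).toAlgHom t)
        (TensorProduct.map LinearMap.id (TensorProduct.assoc k X.V Y.V Z.V).toLinearMap s) :=
    fun t s => tensorAct_map (fun _ _ => rfl) (fun b w => tensorAct_assoc _ _ _ b w) t s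
  have hp := congrArg (fun e => A4 e z4) (H.Φ_pentagon W.deg X.deg Y.deg Z.deg)
  simp only [map_mul, Module.End.mul_apply] at hp
  change Hom.lin (tensorMap (𝟙 W) (assocIso X Y Z).hom) (Hom.lin (assocIso W (tensor X Y) Z).hom
    (Hom.lin (tensorMap (assocIso W X Y).hom (𝟙 Z)) (((w ⊗ₜ[k] x) ⊗ₜ[k] y) ⊗ₜ[k] z))) =
    Hom.lin (assocIso W X (tensor Y Z)).hom (Hom.lin (assocIso (tensor W X) Y Z).hom
      (((w ⊗ₜ[k] x) ⊗ₜ[k] y) ⊗ₜ[k] z))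
  rw [h1, h2, h3, h4, h5, tensorAct_assoc, h6, h6, tensorAct_assoc]
  refine Eq.trans ?_ hp
  congr 2
  have h7 : ∀ t, Algebra.TensorProduct.map (AlgHom.id k (H.A W.deg))
        (Algebra.TensorProduct.assoc k k k (H.A X.deg) (H.A Y.deg) (H.A Z.deg)).toAlgHom
        (Algebra.TensorProduct.map (AlgHom.id k _) (Algebra.TensorProduct.map
          (H.Δ X.deg Y.deg) (AlgHom.id k _)) t) =
      Algebra.TensorProduct.map (AlgHom.id k (H.A W.deg))
        ((Algebra.TensorProduct.assoc k k k (H.A X.deg) (H.A Y.deg) (H.A Z.deg)).toAlgHom.comp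
          (Algebra.TensorProduct.map (H.Δ X.deg Y.deg) (AlgHom.id k _))) t := by
    intro t
    induction t using TensorProduct.induction_on with
    | zero => simp
    | add s t hs ht => simp only [map_add, hs, ht]
    | tmul a b => rfl
  rw [h7]

theorem triangle_aux (X Y : HRep H) :
    (assocIso X unit Y).hom ≫ tensorMap (𝟙 X) (lidIso Y).hom =
      tensorMap (ridIso X).hom (𝟙 Y) := by
  apply hom_ext
  refine TensorProduct.ext_threefold fun x c y => ?_
  have key : ∀ (t : H.A X.deg ⊗[k] (H.A 1 ⊗[k] H.A Y.deg)) (s : X.V ⊗[k] (k ⊗[k] Y.V)),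
      TensorProduct.map LinearMap.id (TensorProduct.lid k Y.V).toLinearMap
        (tensorAct X.act (tensorAct ((Algebra.lmul k k).comp H.ε) Y.act) t s) =
      tensorAct X.act Y.act (Algebra.TensorProduct.map (AlgHom.id k _)
        ((Algebra.TensorProduct.lid k (H.A Y.deg)).toAlgHom.comp
          (Algebra.TensorProduct.map H.ε (AlgHom.id k _))) t)
        (TensorProduct.map LinearMap.id (TensorProduct.lid k Y.V).toLinearMap s) := by
    refine fun t s => tensorAct_map (fun _ _ => rfl) (fun t z => ?_) t s
    induction t using TensorProduct.induction_on with
    | zero => simp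
    | add s t hs ht => simp only [map_add, LinearMap.add_apply, hs, ht]
    | tmul a b =>
      induction z using TensorProduct.induction_on with
      | zero => simp
      | add s t hs ht => simp only [map_add, hs, ht]
      | tmul v w => simp [← mul_smul, mul_comm]
  refine (key (H.Φ X.deg 1 Y.deg).val (x ⊗ₜ[k] (c ⊗ₜ[k] y))).trans ?_
  rw [H.Φ_counit, map_one]
  change x ⊗ₜ[k] (TensorProduct.lid k Y.V) (c ⊗ₜ[k] y) =
    (TensorProduct.rid k X.V) (x ⊗ₜ[k] c) ⊗ₜ[k] y
  simp [TensorProduct.smul_tmul]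

open MonoidalCategory

instance : MonoidalCategory (HRep H) :=
  MonoidalCategory.ofTensorHom
    (id_tensorHom_id := fun X Y => hom_ext TensorProduct.map_id)
    (id_tensorHom := fun _ _ _ _ => rfl)
    (tensorHom_id := fun _ _ => rfl)
    (tensorHom_comp_tensorHom := fun f₁ f₂ g₁ g₂ =>
      hom_ext (TensorProduct.map_comp _ _ _ _).symm)
    (associator_naturality := fun {X₁ X₂ X₃ Y₁ Y₂ Y₃} f₁ f₂ f₃ => by
      apply hom_ext
      refine TensorProduct.ext_threefold fun x y z => ?_
      change tensorAct Y₁.act (tensorAct Y₂.act Y₃.act) (H.Φ Y₁.deg Y₂.deg Y₃.deg).val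
          (TensorProduct.map f₁.lin (TensorProduct.map f₂.lin f₃.lin) (x ⊗ₜ[k] (y ⊗ₜ[k] z))) =
        TensorProduct.map f₁.lin (TensorProduct.map f₂.lin f₃.lin)
          (tensorAct X₁.act (tensorAct X₂.act X₃.act) (H.Φ X₁.deg X₂.deg X₃.deg).val
            (x ⊗ₜ[k] (y ⊗ₜ[k] z)))
      have c₁ : ∀ a v, f₁.lin (X₁.act a v) = Y₁.act ((H.cast f₁.deg_eq).toAlgHom a) (f₁.lin v) :=
        f₁.comm
      have c₂ : ∀ a v, f₂.lin (X₂.act a v) = Y₂.act ((H.cast f₂.deg_eq).toAlgHom a) (f₂.lin v) :=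
        f₂.comm
      have c₃ : ∀ a v, f₃.lin (X₃.act a v) = Y₃.act ((H.cast f₃.deg_eq).toAlgHom a) (f₃.lin v) :=
        f₃.comm
      rw [tensorAct_map c₁ (fun t s => tensorAct_map c₂ c₃ t s),
        QuasiTuraevCoalgebra.Φ_cast f₁.deg_eq f₂.deg_eq f₃.deg_eq])
    (leftUnitor_naturality := fun {X Y} f => by
      apply hom_ext
      refine TensorProduct.ext' fun c x => ?_
      exact (f.lin.map_smul c x).symm)
    (rightUnitor_naturality := fun {X Y} f => by
      apply hom_ext
      refine TensorProduct.ext' fun x c => ?_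
      exact (f.lin.map_smul c x).symm)
    (pentagon := pentagon_aux)
    (triangle := triangle_aux)

end HRep

end Representations

section CrossedCategories

open CategoryTheory MonoidalCategory

universe w₁ w₂ w₃ w₄

/-- A functor between monoidal categories that preserves the tensor product, the unit and the
constraints strictly. (Equality of morphisms between objects that are only propositionally equal
is heterogeneous equality.) -/
structure IsStrictMonoidal {C : Type w₁} [Category.{w₂} C] [MonoidalCategory C]
    {D : Type w₃} [Category.{w₄} D] [MonoidalCategory D] (F : C ⥤ D) : Prop where
  obj_unit : F.obj (𝟙_ C) = 𝟙_ D
  obj_tensor : ∀ X Y, F.obj (X ⊗ Y) = F.obj X ⊗ F.obj Y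
  map_tensor : ∀ {X X' Y Y' : C} (f : X ⟶ X') (g : Y ⟶ Y'),
    HEq (F.map (f ⊗ₘ g)) (F.map f ⊗ₘ F.map g)
  map_associator : ∀ X Y Z,
    HEq (F.map (α_ X Y Z).hom) (α_ (F.obj X) (F.obj Y) (F.obj Z)).hom
  map_leftUnitor : ∀ X, HEq (F.map (λ_ X).hom) (λ_ (F.obj X)).hom
  map_rightUnitor : ∀ X, HEq (F.map (ρ_ X).hom) (ρ_ (F.obj X)).hom

/-- The structure of a crossed T-category over the group `π` on a tensor category `C`. The
component `C_α` is the full subcategory of the objects `X` with `deg X = α`; there are no morphisms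
between different components. -/
structure CrossedCategory (π : Type v) [Group π] (C : Type w₁) [Category.{w₂} C]
    [MonoidalCategory C] where
  /-- the index of the component of an object -/
  deg : C → π
  deg_eq_of_hom : ∀ {X Y : C}, (X ⟶ Y) → deg X = deg Y
  deg_tensor : ∀ X Y : C, deg (X ⊗ Y) = deg X * deg Y
  /-- the conjugation functors `φ_β = ^β(-)` -/
  conj : π → C ⥤ C
  conj_strict : ∀ β, IsStrictMonoidal (conj β)
  conj_one : conj 1 = 𝟭 C
  conj_mul : ∀ β γ, conj (β * γ) = conj γ ⋙ conj β
  deg_conj : ∀ (β) (X : C), deg ((conj β).obj X) = β * deg X * β⁻¹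

variable {π : Type v} [Group π] {C : Type w₁} [Category.{w₂} C] [MonoidalCategory C]

/-- A braiding on a crossed T-category, `c_{X,Y} : X ⊗ Y → ^X Y ⊗ X`. -/
structure CrossedBraiding (T : CrossedCategory π C) where
  /-- the isomorphisms `c_{X,Y}` -/
  c : ∀ X Y : C, X ⊗ Y ≅ (T.conj (T.deg X)).obj Y ⊗ X
  natural : ∀ {X X' Y Y' : C} (f : X ⟶ X') (g : Y ⟶ Y'),
    HEq ((c X Y).hom ≫ ((T.conj (T.deg X)).map g ⊗ₘ f)) ((f ⊗ₘ g) ≫ (c X' Y').hom)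
  hexagon_right : ∀ X Y Z : C,
    HEq (c X (Y ⊗ Z)).hom
      ((α_ X Y Z).inv ≫ (c X Y).hom ▷ Z ≫ (α_ ((T.conj (T.deg X)).obj Y) X Z).hom ≫
        (T.conj (T.deg X)).obj Y ◁ (c X Z).hom ≫
        (α_ ((T.conj (T.deg X)).obj Y) ((T.conj (T.deg X)).obj Z) X).inv)
  hexagon_left : ∀ X Y Z : C,
    HEq (c (X ⊗ Y) Z).hom
      ((α_ X Y Z).hom ≫ X ◁ (c Y Z).hom ≫ (α_ X ((T.conj (T.deg Y)).obj Z) Y).inv ≫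
        (c X ((T.conj (T.deg Y)).obj Z)).hom ▷ Y ≫
        (α_ ((T.conj (T.deg X)).obj ((T.conj (T.deg Y)).obj Z)) X Y).hom)
  conj_c : ∀ (β : π) (X Y : C),
    HEq ((T.conj β).map (c X Y).hom) (c ((T.conj β).obj X) ((T.conj β).obj Y)).hom

/-- A functor between braided crossed T-categories over `π` that preserves the tensor structure,
the components, the conjugation and the braiding strictly. -/
structure IsStrictBraidedCrossed {D : Type w₃} [Category.{w₄} D] [MonoidalCategory D]
    {T : CrossedCategory π C} (b : CrossedBraiding T) {T' : CrossedCategory π D}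
    (b' : CrossedBraiding T') (F : C ⥤ D) : Prop where
  strict : IsStrictMonoidal F
  deg_obj : ∀ X, T'.deg (F.obj X) = T.deg X
  conj_comm : ∀ β, T.conj β ⋙ F = F ⋙ T'.conj β
  map_c : ∀ X Y, HEq (F.map (b.c X Y).hom) (b'.c (F.obj X) (F.obj Y)).hom

/-- The condition on a family `c_X : U ⊗ X → ^U X ⊗ U` of isomorphisms to be natural in `X` and to
be compatible with the tensor product in `X`. -/
structure IsHalfBraiding (T : CrossedCategory π C) (U : C)
    (c : ∀ X : C, U ⊗ X ≅ (T.conj (T.deg U)).obj X ⊗ U) : Prop where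
  natural : ∀ {X Y : C} (g : X ⟶ Y),
    (c X).hom ≫ (T.conj (T.deg U)).map g ▷ U = U ◁ g ≫ (c Y).hom
  hexagon : ∀ X Y : C,
    HEq (c (X ⊗ Y)).hom
      ((α_ U X Y).inv ≫ (c X).hom ▷ Y ≫ (α_ ((T.conj (T.deg U)).obj X) U Y).hom ≫
        (T.conj (T.deg U)).obj X ◁ (c Y).hom ≫
        (α_ ((T.conj (T.deg U)).obj X) ((T.conj (T.deg U)).obj Y) U).inv)

/-- The objects of the center of a crossed T-category. -/
structure CrossedCenter (T : CrossedCategory π C) where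
  /-- the underlying object `U` -/
  obj : C
  /-- the half-braiding `c_{U,-}` -/
  c : ∀ X : C, obj ⊗ X ≅ (T.conj (T.deg obj)).obj X ⊗ obj
  isHalfBraiding : IsHalfBraiding T obj c

namespace CrossedCenter

variable {T : CrossedCategory π C}

/-- The morphisms of the center: the morphisms of `C` that commute with the half-braidings. -/
@[ext] structure Hom (Z Z' : CrossedCenter T) where
  /-- the underlying morphism of `C` -/
  hom : Z.obj ⟶ Z'.obj
  comm : ∀ X : C,
    HEq ((Z.c X).hom ≫ (T.conj (T.deg Z.obj)).obj X ◁ hom) (hom ▷ X ≫ (Z'.c X).hom)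

theorem comm_iff {Z Z' : CrossedCenter T} (f : Z.obj ⟶ Z'.obj) (X : C) :
    HEq ((Z.c X).hom ≫ (T.conj (T.deg Z.obj)).obj X ◁ f) (f ▷ X ≫ (Z'.c X).hom) ↔
      (Z.c X).hom ≫ (T.conj (T.deg Z.obj)).obj X ◁ f ≫
        eqToHom (by rw [T.deg_eq_of_hom f]) = f ▷ X ≫ (Z'.c X).hom := by
  rw [← Category.assoc, ← heq_iff_eq, comp_eqToHom_heq_iff]

theorem whisker_eqToHom {A B : C} (h : A = B) {X Y : C} (g : X ⟶ Y) :
    A ◁ g ≫ eqToHom (by rw [h]) = eqToHom (by rw [h]) ≫ B ◁ g := by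
  subst h; simp

instance : Category (CrossedCenter T) where
  Hom := Hom
  id Z := ⟨𝟙 _, fun X => by simp⟩
  comp {Z Z' Z''} f g := ⟨f.hom ≫ g.hom, fun X => by
    have hf := (comm_iff f.hom X).1 (f.comm X)
    have hg := (comm_iff g.hom X).1 (g.comm X)
    rw [comm_iff, comp_whiskerRight, Category.assoc, ← hg, ← reassoc_of% hf,
      ← reassoc_of% whisker_eqToHom (by rw [T.deg_eq_of_hom f.hom]) g.hom]
    simp⟩
  id_comp f := Hom.ext (Category.id_comp f.hom)
  comp_id f := Hom.ext (Category.comp_id f.hom)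
  assoc f g h := Hom.ext (Category.assoc f.hom g.hom h.hom)

/-- The forgetful functor from the center of `C` to `C`. -/
def forget (T : CrossedCategory π C) : CrossedCenter T ⥤ C where
  obj Z := Z.obj
  map f := f.hom

/-- The braided crossed T-category structure of the center: the given structure of a braided
crossed T-category on `Z(C)` is the one with

* `(U, c) ⊗ (V, c') = (U ⊗ V, c ⊗ c')`, where
  `(c ⊗ c')_W = a ∘ (c_{^V W} ⊗ V) ∘ a⁻¹ ∘ (U ⊗ c'_W) ∘ a`, tensor product of morphisms and
  constraints being those of `C`;
* unit `(I, c)` with `c_X : I ⊗ X ≅ X ≅ X ⊗ I` the canonical isomorphism;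
* components `Z_α(C)` consisting of the `(U, c)` with `U` in `C_α`;
* conjugation `^β(U, c) = (^β U, ^β(c_{^{β⁻¹}(-)}))`, on morphisms that of `C`;
* braiding `c_{(U, c), (V, c')} = c_V`. -/
structure IsCenterStructure [MonoidalCategory (CrossedCenter T)]
    (TZ : CrossedCategory π (CrossedCenter T)) (b : CrossedBraiding TZ) : Prop where
  tensor_obj : ∀ Z Z' : CrossedCenter T, ∃ c h, Z ⊗ Z' = ⟨Z.obj ⊗ Z'.obj, c, h⟩ ∧
    ∀ W, HEq (c W).hom
      ((α_ Z.obj Z'.obj W).hom ≫ Z.obj ◁ (Z'.c W).hom ≫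
        (α_ Z.obj ((T.conj (T.deg Z'.obj)).obj W) Z'.obj).inv ≫
        (Z.c ((T.conj (T.deg Z'.obj)).obj W)).hom ▷ Z'.obj ≫
        (α_ ((T.conj (T.deg Z.obj)).obj ((T.conj (T.deg Z'.obj)).obj W)) Z.obj Z'.obj).hom)
  unit_obj : ∃ c h, 𝟙_ (CrossedCenter T) = ⟨𝟙_ C, c, h⟩ ∧
    ∀ X, HEq (c X).hom ((λ_ X).hom ≫ (ρ_ X).inv)
  forget_strict : IsStrictMonoidal (forget T)
  deg_obj : ∀ Z, TZ.deg Z = T.deg Z.obj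
  conj_obj : ∀ (β : π) (Z : CrossedCenter T), ∃ c h,
    (TZ.conj β).obj Z = ⟨(T.conj β).obj Z.obj, c, h⟩ ∧
    ∀ X, HEq (c X).hom ((T.conj β).map (Z.c ((T.conj β⁻¹).obj X)).hom)
  conj_forget : ∀ β, TZ.conj β ⋙ forget T = forget T ⋙ T.conj β
  braiding : ∀ Z Z' : CrossedCenter T,
    HEq ((forget T).map (b.c Z Z').hom) (Z.c Z'.obj).hom

end CrossedCenter

end CrossedCategories

section RepCrossed

open CategoryTheory MonoidalCategory
open scoped TensorProduct

variable {k : Type u} [Field k] {π : Type v} [Group π] {H : QuasiTuraevCoalgebra k π}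

namespace QuasiTuraevCoalgebra

theorem φ_symm_cast {β β' α α' : π} (h : β = β') (h' : α = α')
    (e : β * α * β⁻¹ = β' * α' * β'⁻¹) (x : H.A (β * α * β⁻¹)) :
    (H.φ β' α').symm (H.cast e x) = H.cast h' ((H.φ β α).symm x) := by
  subst h h'; rfl

theorem φ_one (α : π) (x : H.A α) : H.φ 1 α x = H.cast (by group) x := by
  apply (H.φ 1 (1 * α * 1⁻¹)).injective
  refine (H.φ_mul 1 1 α x).trans ?_
  rw [φ_cast rfl (show α = 1 * α * 1⁻¹ by group)]
  have : ∀ {β : π} (h : β = 1) (e : β * α * β⁻¹ = 1 * (1 * α * 1⁻¹) * 1⁻¹),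
      H.cast e (H.φ β α x) = H.cast (by group) (H.φ 1 α x) := by
    intro β h e; subst h; rfl
  exact this (one_mul 1) _

/-- The inverse of `φ_β : H_α → H_{βαβ⁻¹}` is `φ_{β⁻¹}`. -/
theorem φ_symm_eq (β α : π) (x : H.A (β * α * β⁻¹)) :
    (H.φ β α).symm x = H.cast (by group) (H.φ β⁻¹ (β * α * β⁻¹) x) := by
  obtain ⟨y, rfl⟩ := (H.φ β α).surjective x
  rw [AlgEquiv.symm_apply_apply]
  have h1 := H.φ_mul β⁻¹ β α y
  have : ∀ {γ : π} (h : γ = 1) (e : γ * α * γ⁻¹ = β⁻¹ * (β * α * β⁻¹) * β⁻¹⁻¹),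
      H.cast e (H.φ γ α y) = H.cast (by group) y := by
    intro γ h e; subst h; rw [φ_one, cast_cast]
  rw [h1]
  change _ = H.cast _ (H.cast _ _)
  rw [this (inv_mul_cancel β), cast_cast, cast_rfl]

end QuasiTuraevCoalgebra

namespace HRep

theorem mk_eq_mk {d d' : π} {V : Type u} [AddCommGroup V] [Module k V]
    {a : H.A d →ₐ[k] Module.End k V} {a' : H.A d' →ₐ[k] Module.End k V}
    (h : d = d') (ha : ∀ x, a x = a' (H.cast h x)) :
    (⟨d, V, a⟩ : HRep H) = ⟨d', V, a'⟩ := by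
  subst h
  obtain rfl : a = a' := AlgHom.ext ha
  rfl

theorem hom_heq {X X' Y Y' : HRep H} (hX : X = X') (hY : Y = Y') {f : X ⟶ Y} {g : X' ⟶ Y'}
    (h : HEq f.lin g.lin) : HEq f g := by
  subst hX hY
  exact heq_of_eq (hom_ext (eq_of_heq h))

/-- The conjugate `^β X` of an `H_α`-module `X`: the same vector space, on which
`h ∈ H_{βαβ⁻¹}` acts as `φ_β⁻¹(h) = φ_{β⁻¹}(h)`. -/
abbrev conjObj (β : π) (X : HRep H) : HRep H where
  deg := β * X.deg * β⁻¹
  V := X.V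
  act := X.act.comp (H.φ β X.deg).symm.toAlgHom

/-- The conjugation functors of `Rep(H)`. -/
abbrev conjFunctor (β : π) : HRep H ⥤ HRep H where
  obj X := conjObj β X
  map {X Y} f :=
    { deg_eq := congrArg (β * · * β⁻¹) f.deg_eq
      lin := f.lin
      comm := fun h x => by
        have := f.comm ((H.φ β X.deg).symm h) x
        rw [← QuasiTuraevCoalgebra.φ_symm_cast rfl f.deg_eq
          (congrArg (β * · * β⁻¹) f.deg_eq)] at this
        exact this }

theorem conjObj_tensor (β : π) (X Y : HRep H) :
    conjObj β (tensor X Y) = tensor (conjObj β X) (conjObj β Y) := by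
  refine mk_eq_mk (by group) fun x => ?_
  obtain ⟨y, rfl⟩ := (H.φ β (X.deg * Y.deg)).surjective x
  change tensorAct X.act Y.act (H.Δ _ _ ((H.φ β (X.deg * Y.deg)).symm (H.φ β _ y))) =
    tensorAct (X.act.comp (H.φ β X.deg).symm.toAlgHom) (Y.act.comp (H.φ β Y.deg).symm.toAlgHom)
      (H.Δ (β * X.deg * β⁻¹) (β * Y.deg * β⁻¹) (H.cast _ _))
  have := H.φ_comul β X.deg Y.deg y
  change _ = H.Δ _ _ (H.cast _ _) at this
  rw [AlgEquiv.symm_apply_apply, ← this, tensorAct_comp]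
  congr 1
  generalize H.Δ X.deg Y.deg y = t
  induction t using TensorProduct.induction_on with
  | zero => simp
  | add s t hs ht => rw [map_add, map_add, ← hs, ← ht]
  | tmul a b => simp

theorem conjObj_unit (β : π) : conjObj β (unit : HRep H) = unit := by
  refine mk_eq_mk (by group) fun x => ?_
  obtain ⟨y, rfl⟩ := (H.φ β 1).surjective x
  change (Algebra.lmul k k) (H.ε ((H.φ β 1).symm (H.φ β 1 y))) =
    (Algebra.lmul k k) (H.ε (H.cast _ (H.φ β 1 y)))
  rw [AlgEquiv.symm_apply_apply]
  exact congrArg _ (H.φ_counit β y).symm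

theorem conj_assoc_lin (β : π) (X Y Z : HRep H) :
    (assocIso X Y Z).hom.lin =
      (assocIso (conjObj β X) (conjObj β Y) (conjObj β Z)).hom.lin := by
  refine TensorProduct.ext_threefold fun x y z => ?_
  change tensorAct X.act (tensorAct Y.act Z.act) (H.Φ _ _ _).val (x ⊗ₜ[k] (y ⊗ₜ[k] z)) =
    tensorAct (X.act.comp (H.φ β X.deg).symm.toAlgHom)
      (tensorAct (Y.act.comp (H.φ β Y.deg).symm.toAlgHom)
        (Z.act.comp (H.φ β Z.deg).symm.toAlgHom))
      (H.Φ (β * X.deg * β⁻¹) (β * Y.deg * β⁻¹) (β * Z.deg * β⁻¹)).val (x ⊗ₜ[k] (y ⊗ₜ[k] z))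
  rw [← H.φ_Φ β β β]
  generalize (H.Φ X.deg Y.deg Z.deg).val = t
  induction t using TensorProduct.induction_on with
  | zero => simp
  | add s t hs ht => simp only [map_add, LinearMap.add_apply, hs, ht]
  | tmul a t =>
    induction t using TensorProduct.induction_on with
    | zero => simp
    | add s t hs ht => simp only [map_add, TensorProduct.tmul_add, LinearMap.add_apply, hs, ht]
    | tmul b c => simp

theorem conj_strict (β : π) : IsStrictMonoidal (conjFunctor (H := H) β) where
  obj_unit := conjObj_unit β
  obj_tensor := conjObj_tensor β
  map_tensor {X X' Y Y'} f g :=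
    hom_heq (conjObj_tensor β X Y) (conjObj_tensor β X' Y') HEq.rfl
  map_associator X Y Z :=
    hom_heq ((conjObj_tensor β (tensor X Y) Z).trans
        (congrArg (tensor · (conjObj β Z)) (conjObj_tensor β X Y)))
      ((conjObj_tensor β X (tensor Y Z)).trans
        (congrArg (tensor (conjObj β X)) (conjObj_tensor β Y Z)))
      (heq_of_eq (conj_assoc_lin β X Y Z))
  map_leftUnitor X :=
    hom_heq ((conjObj_tensor β unit X).trans (congrArg (tensor · (conjObj β X)) (conjObj_unit β)))
      rfl HEq.rfl
  map_rightUnitor X :=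
    hom_heq ((conjObj_tensor β X unit).trans (congrArg (tensor (conjObj β X)) (conjObj_unit β)))
      rfl HEq.rfl

theorem conjObj_one (X : HRep H) : conjObj 1 X = X := by
  refine mk_eq_mk (by group) fun x => ?_
  obtain ⟨y, rfl⟩ := (H.φ 1 X.deg).surjective x
  change X.act ((H.φ 1 X.deg).symm (H.φ 1 X.deg y)) = _
  rw [AlgEquiv.symm_apply_apply, QuasiTuraevCoalgebra.φ_one, QuasiTuraevCoalgebra.cast_cast,
    QuasiTuraevCoalgebra.cast_rfl]

theorem conjObj_mul (β γ : π) (X : HRep H) :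
    conjObj (β * γ) X = conjObj β (conjObj γ X) := by
  refine mk_eq_mk (by group) fun x => ?_
  obtain ⟨y, rfl⟩ := (H.φ (β * γ) X.deg).surjective x
  change X.act ((H.φ (β * γ) X.deg).symm (H.φ (β * γ) X.deg y)) =
    X.act ((H.φ γ X.deg).symm ((H.φ β (γ * X.deg * γ⁻¹)).symm (H.cast _ _)))
  have := H.φ_mul β γ X.deg y
  change _ = H.cast _ _ at this
  rw [AlgEquiv.symm_apply_apply, ← this, AlgEquiv.symm_apply_apply, AlgEquiv.symm_apply_apply]

/-- The representation category `Rep(H)` as a crossed T-category. -/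
def crossed (H : QuasiTuraevCoalgebra k π) : CrossedCategory π (HRep H) where
  deg := HRep.deg
  deg_eq_of_hom f := f.deg_eq
  deg_tensor _ _ := rfl
  conj := conjFunctor
  conj_strict := conj_strict
  conj_one := CategoryTheory.Functor.hext conjObj_one
    fun X Y _ => hom_heq (conjObj_one X) (conjObj_one Y) HEq.rfl
  conj_mul β γ := CategoryTheory.Functor.hext (conjObj_mul β γ)
    fun X Y _ => hom_heq (conjObj_mul β γ X) (conjObj_mul β γ Y) HEq.rfl
  deg_conj _ _ := rfl

end HRep

end RepCrossed

section YetterDrinfeld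

open CategoryTheory MonoidalCategory
open scoped TensorProduct

variable {k : Type u} [Field k] {π : Type v} [Group π]

namespace QuasiTuraevCoalgebra

variable (H : QuasiTuraevCoalgebra k π)

/-- The action of `H_α` on itself by left multiplication. -/
def reg (α : π) : H.A α →ₐ[k] Module.End k (H.A α) := Algebra.lmul k (H.A α)

/-- The antipode `S_{α⁻¹} : H_{α⁻¹} → H_α`. -/
def S (α : π) : H.A α⁻¹ →ₗ[k] H.A α :=
  (H.cast (inv_inv α)).toLinearMap ∘ₗ
    (MulOpposite.opLinearEquiv k).symm.toLinearMap ∘ₗ (H.antipode α⁻¹).toLinearMap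

/-- The inverse antipode `S_α⁻¹ : H_{α⁻¹} → H_α`. -/
def SInv (α : π) : H.A α⁻¹ →ₗ[k] H.A α :=
  (H.antipode α).symm.toLinearMap ∘ₗ (MulOpposite.opLinearEquiv k).toLinearMap

/-- `J_{α,β} = Y¹ ⊗ S_β⁻¹(p Y³) Y² ∈ H_α ⊗ H_β`, where `Φ_{α,β,β⁻¹} = Y¹ ⊗ Y² ⊗ Y³`. -/
def J (α β : π) : H.A α ⊗[k] H.A β :=
  TensorProduct.map LinearMap.id
    (mulMid (H.SInv β ∘ₗ LinearMap.mulLeft k (H.p β⁻¹)) 1 LinearMap.id ∘ₗ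
      (TensorProduct.comm k (H.A β) (H.A β⁻¹)).toLinearMap) (H.Φ α β β⁻¹).val

/-- `I_{α,β} = Y² S_α⁻¹(Y¹ q) ⊗ Y³ ∈ H_α ⊗ H_β`, where `Φ_{α⁻¹,α,β} = Y¹ ⊗ Y² ⊗ Y³`. -/
def I (α β : π) : H.A α ⊗[k] H.A β :=
  TensorProduct.map
    (mulMid LinearMap.id 1 (H.SInv α ∘ₗ LinearMap.mulRight k (H.q α⁻¹)) ∘ₗ
      (TensorProduct.comm k (H.A α⁻¹) (H.A α)).toLinearMap) LinearMap.id
    ((TensorProduct.assoc k (H.A α⁻¹) (H.A α) (H.A β)).symm (H.Φ α⁻¹ α β).val)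

/-- `φ_{α⁻¹}(J¹₁) y¹ ⊗ J¹₂ y² ⊗ J² y³ ∈ H_l ⊗ H_α ⊗ H_{l⁻¹}`, where `J_{αl,l⁻¹} = J¹ ⊗ J²`,
`J¹₁ ⊗ J¹₂` is the image of `J¹` under `Δ_{αlα⁻¹,α}`, and `Φ⁻¹_{l,α,l⁻¹} = y¹ ⊗ y² ⊗ y³`. -/
def K (α l : π) : H.A l ⊗[k] (H.A α ⊗[k] H.A l⁻¹) :=
  TensorProduct.assoc k (H.A l) (H.A α) (H.A l⁻¹)
      (TensorProduct.map
        (TensorProduct.map (H.φ α l).symm.toLinearMap LinearMap.id ∘ₗ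
          (H.Δ (α * l * α⁻¹) α).toLinearMap ∘ₗ
          (H.cast (show α * l = α * l * α⁻¹ * α by group)).toLinearMap)
        LinearMap.id (H.J (α * l) l⁻¹)) *
    (H.Φ l α l⁻¹).inv

end QuasiTuraevCoalgebra

/-- For a linear map `ρ : v ↦ v₀ ⊗ v₁`, the linear map `b ⊗ v ↦ v₀ ⊗ v₁ b`. -/
def coactMul {V B : Type u} [AddCommGroup V] [Module k V] [Ring B] [Algebra k B]
    (ρ : V →ₗ[k] V ⊗[k] B) : B ⊗[k] V →ₗ[k] V ⊗[k] B :=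
  TensorProduct.map LinearMap.id (LinearMap.mul' k B) ∘ₗ
    (TensorProduct.assoc k V B B).toLinearMap ∘ₗ TensorProduct.map ρ LinearMap.id ∘ₗ
    (TensorProduct.comm k B V).toLinearMap

/-- The axioms of a Yetter-Drinfeld module on an `H_α`-module `X` with linear maps
`ρ_l : X → X ⊗ H_l, v ↦ v₀ ⊗ v_{1,l}`. -/
structure IsYD {H : QuasiTuraevCoalgebra k π} (X : HRep H)
    (ρ : ∀ l : π, X.V →ₗ[k] X.V ⊗[k] H.A l) : Prop where
  counit : ∀ v, TensorProduct.rid k X.V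
    (TensorProduct.map LinearMap.id H.ε.toLinearMap (ρ 1 v)) = v
  /-- `(y² v₀)₀ ⊗ (y² v₀)_{1,l₁} y¹ ⊗ y³ v_{1,l₂}` (with `Φ⁻¹_{l₁,α,l₂} = y¹ ⊗ y² ⊗ y³`) equals
  `Φ⁻¹_{α,l₁,l₂} · ((y³ v)₀ ⊗ Δ_{l₁,l₂}((y³ v)_{1,l₁l₂}) (y¹ ⊗ y²))`
  (with `Φ⁻¹_{l₁,l₂,α} = y¹ ⊗ y² ⊗ y³`) -/
  quasi_coassoc : ∀ (l₁ l₂ : π) (v : X.V),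
    TensorProduct.assoc k X.V (H.A l₁) (H.A l₂)
      (TensorProduct.map (coactMul (ρ l₁)) LinearMap.id
        ((TensorProduct.assoc k (H.A l₁) X.V (H.A l₂)).symm
          (tensorAct (H.reg l₁) (tensorAct X.act (H.reg l₂)) (H.Φ l₁ X.deg l₂).inv
            ((1 : H.A l₁) ⊗ₜ[k] ρ l₂ v)))) =
    tensorAct X.act (tensorAct (H.reg l₁) (H.reg l₂)) (H.Φ X.deg l₁ l₂).inv
      (coactMul (TensorProduct.map LinearMap.id (H.Δ l₁ l₂).toLinearMap ∘ₗ ρ (l₁ * l₂))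
        ((TensorProduct.assoc k (H.A l₁) (H.A l₂) X.V).symm
          (tensorAct (H.reg l₁) (tensorAct (H.reg l₂) X.act) (H.Φ l₁ l₂ X.deg).inv
            ((1 : H.A l₁) ⊗ₜ[k] ((1 : H.A l₂) ⊗ₜ[k] v)))))
  /-- `h₁ v₀ ⊗ h₂ v_{1,l} = (h₂ v)₀ ⊗ (h₂ v)_{1,l} φ_{α⁻¹}(h₁)`, with `Δ_{α,l}(h)` on the left and
  `Δ_{αlα⁻¹,α}(h)` on the right -/
  crossed : ∀ (l : π) (h : H.A (X.deg * l)) (v : X.V),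
    tensorAct X.act (H.reg l) (H.Δ X.deg l h) (ρ l v) =
    coactMul (ρ l)
      (tensorAct ((H.reg l).comp (H.φ X.deg l).symm.toAlgHom) X.act
        (H.Δ (X.deg * l * X.deg⁻¹) X.deg
          (H.cast (show X.deg * l = X.deg * l * X.deg⁻¹ * X.deg by group) h))
        ((1 : H.A l) ⊗ₜ[k] v))

/-- A Yetter-Drinfeld module over `H`, that is, a `YD_α`-module for some `α`. -/
structure YD (H : QuasiTuraevCoalgebra k π) where
  /-- the underlying `H_α`-module -/
  rep : HRep H
  /-- the coaction -/
  ρ : ∀ l : π, rep.V →ₗ[k] rep.V ⊗[k] H.A l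
  isYD : IsYD rep ρ

namespace YD

variable {H : QuasiTuraevCoalgebra k π}

/-- Morphisms of Yetter-Drinfeld modules. There are none between `YD_α`- and `YD_β`-modules for
`α ≠ β`. -/
@[ext] structure Hom (X Y : YD H) where
  /-- the underlying `H_α`-linear map -/
  hom : X.rep ⟶ Y.rep
  comm : ∀ (l : π) (v : X.rep.V),
    Y.ρ l (hom.lin v) = TensorProduct.map hom.lin LinearMap.id (X.ρ l v)

/-- The category `YD(H)`, the disjoint union of the categories `YD_α(H)`. -/
instance : Category (YD H) where
  Hom := Hom
  id X := ⟨𝟙 _, fun l v => by simp⟩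
  comp {X Y Z} f g := ⟨f.hom ≫ g.hom, fun l v => by
    simp only [HRep.comp_lin, LinearMap.comp_apply, g.comm, f.comm]
    rw [← LinearMap.comp_apply, ← TensorProduct.map_comp, LinearMap.id_comp]⟩
  id_comp f := Hom.ext (Category.id_comp f.hom)
  comp_id f := Hom.ext (Category.comp_id f.hom)
  assoc f g h := Hom.ext (Category.assoc f.hom g.hom h.hom)

/-- The forgetful functor from `YD(H)` to `Rep(H)`. -/
def forget (H : QuasiTuraevCoalgebra k π) : YD H ⥤ HRep H where
  obj X := X.rep
  map f := f.hom

/-- The coaction `ρ_l(1) = 1 ⊗ 1_l` on the unit object `k`. -/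
def unitCoact (H : QuasiTuraevCoalgebra k π) (l : π) :
    (𝟙_ (HRep H)).V →ₗ[k] (𝟙_ (HRep H)).V ⊗[k] H.A l :=
  TensorProduct.map LinearMap.id (Algebra.linearMap k (H.A l)) ∘ₗ
    (TensorProduct.rid k k).symm.toLinearMap

/-- The coaction on the tensor product of a `YD_α`-module `X` and a `YD_β`-module `Y`,
`ρ_l(v ⊗ w) = t¹ Y¹ (y² v)₀ ⊗ t² (Y³ y³ w)₀ ⊗
  t³ (Y³ y³ w)_{1,l} Y² φ_{β⁻¹}((y² v)_{1,βlβ⁻¹}) y¹`,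
where `Φ⁻¹_{l,α,β} = y¹ ⊗ y² ⊗ y³`, `Φ_{α,l,β} = Y¹ ⊗ Y² ⊗ Y³`, `Φ⁻¹_{α,β,l} = t¹ ⊗ t² ⊗ t³`. -/
def tensorCoact (X Y : YD H) (l : π) :
    (X.rep ⊗ Y.rep).V →ₗ[k] (X.rep ⊗ Y.rep).V ⊗[k] H.A l :=
  -- the maps are composed from bottom to top
  (TensorProduct.assoc k X.rep.V Y.rep.V (H.A l)).symm.toLinearMap ∘ₗ
  -- action of `t¹ ⊗ t² ⊗ t³`
  tensorAct X.rep.act (tensorAct Y.rep.act (H.reg l)) (H.Φ X.rep.deg Y.rep.deg l).inv ∘ₗ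
  -- `v ⊗ b ⊗ w ↦ v ⊗ w₀ ⊗ w₁ b`
  TensorProduct.map LinearMap.id (coactMul (Y.ρ l)) ∘ₗ
  -- action of `Y¹ ⊗ Y² ⊗ Y³`
  tensorAct X.rep.act (tensorAct (H.reg l) Y.rep.act) (H.Φ X.rep.deg l Y.rep.deg).val ∘ₗ
  (TensorProduct.assoc k X.rep.V (H.A l) Y.rep.V).toLinearMap ∘ₗ
  -- `b ⊗ v ⊗ w ↦ v₀ ⊗ φ_{β⁻¹}(v₁) b ⊗ w`
  TensorProduct.map
    (coactMul (TensorProduct.map LinearMap.id (H.φ Y.rep.deg l).symm.toLinearMap ∘ₗ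
      X.ρ (Y.rep.deg * l * Y.rep.deg⁻¹))) LinearMap.id ∘ₗ
  (TensorProduct.assoc k (H.A l) X.rep.V Y.rep.V).symm.toLinearMap ∘ₗ
  -- action of `y¹ ⊗ y² ⊗ y³`
  tensorAct (H.reg l) (tensorAct X.rep.act Y.rep.act) (H.Φ l X.rep.deg Y.rep.deg).inv ∘ₗ
  -- `v ⊗ w ↦ 1 ⊗ v ⊗ w`
  TensorProduct.mk k (H.A l) (X.rep.V ⊗[k] Y.rep.V) 1

/-- The coaction on the conjugate `^β X`: `ρ_l(^β v) = ^β(v₀) ⊗ φ_β(v_{1,β⁻¹lβ})`. -/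
def conjCoact (β : π) (X : YD H) (l : π) :
    (((HRep.crossed H).conj β).obj X.rep).V →ₗ[k]
      (((HRep.crossed H).conj β).obj X.rep).V ⊗[k] H.A l :=
  TensorProduct.map LinearMap.id
      ((H.cast (show β * (β⁻¹ * l * β) * β⁻¹ = l by group)).toLinearMap ∘ₗ
        (H.φ β (β⁻¹ * l * β)).toLinearMap) ∘ₗ X.ρ (β⁻¹ * l * β)

/-- For a `YD_α`-module `X` and an index `l`, the linear map
`v ↦ φ_{α⁻¹}(J¹₁) y¹ S(J² y³ (I² v)_{1,l⁻¹} I¹) ⊗ J¹₂ y² (I² v)₀ ∈ H_l ⊗ X`,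
where `J¹₁ ⊗ J¹₂ = Δ_{αlα⁻¹,α}(J¹)`, `J¹ ⊗ J² = J_{αl,l⁻¹}`, `I¹ ⊗ I² = I_{l⁻¹,α}`,
`y¹ ⊗ y² ⊗ y³ = Φ⁻¹_{l,α,l⁻¹}`. -/
def braidElt (X : YD H) (l : π) : X.rep.V →ₗ[k] H.A l ⊗[k] X.rep.V :=
  -- `a ⊗ v ⊗ b ↦ a S(b) ⊗ v`
  TensorProduct.map (mulMid LinearMap.id 1 (H.S l)) LinearMap.id ∘ₗ
  (TensorProduct.assoc k (H.A l) (H.A l⁻¹) X.rep.V).symm.toLinearMap ∘ₗ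
  TensorProduct.map LinearMap.id (TensorProduct.comm k X.rep.V (H.A l⁻¹)).toLinearMap ∘ₗ
  -- action of `φ_{α⁻¹}(J¹₁) y¹ ⊗ J¹₂ y² ⊗ J² y³`
  tensorAct (H.reg l) (tensorAct X.rep.act (H.reg l⁻¹)) (H.K X.rep.deg l) ∘ₗ
  TensorProduct.mk k (H.A l) (X.rep.V ⊗[k] H.A l⁻¹) 1 ∘ₗ
  -- `v ↦ (I² v)₀ ⊗ (I² v)₁ I¹`
  coactMul (X.ρ l⁻¹) ∘ₗ
  tensorAct (H.reg l⁻¹) X.rep.act (H.I l⁻¹ X.rep.deg) ∘ₗ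
  TensorProduct.mk k (H.A l⁻¹) X.rep.V 1

/-- For a `YD_α`-module `X` and an `H_l`-module `M`, the vector
`^α[φ_{α⁻¹}(J¹₁) y¹ S(J² y³ (I² v)_{1,l⁻¹} I¹) · m] ⊗ J¹₂ y² (I² v)₀` of `^α M ⊗ X`. -/
def braidFormula (X : YD H) (M : HRep H) (v : X.rep.V) (m : M.V) :
    (((HRep.crossed H).conj X.rep.deg).obj M ⊗ X.rep).V :=
  TensorProduct.map (M.act.toLinearMap.flip m) LinearMap.id (X.braidElt M.deg v)

/-- The given structure of a braided crossed T-category on `YD(H)` is the one with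

* tensor product, unit and conjugation having the underlying modules of `Rep(H)` and the coactions
  `tensorCoact`, `unitCoact`, `conjCoact`; tensor product and conjugation of morphisms and
  the constraints are those of `Rep(H)`;
* components the categories `YD_α(H)`;
* braiding given by `braidFormula`. -/
structure IsYDStructure [MonoidalCategory (YD H)] (T : CrossedCategory π (YD H))
    (b : CrossedBraiding T) : Prop where
  tensor_obj : ∀ X Y : YD H, ∃ h, X ⊗ Y = ⟨X.rep ⊗ Y.rep, tensorCoact X Y, h⟩
  unit_obj : ∃ h, 𝟙_ (YD H) = ⟨𝟙_ (HRep H), unitCoact H, h⟩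
  forget_strict : IsStrictMonoidal (forget H)
  deg_obj : ∀ X, T.deg X = X.rep.deg
  conj_obj : ∀ (β : π) (X : YD H), ∃ h,
    (T.conj β).obj X = ⟨((HRep.crossed H).conj β).obj X.rep, conjCoact β X, h⟩
  conj_forget : ∀ β, T.conj β ⋙ forget H = forget H ⋙ (HRep.crossed H).conj β
  braiding : ∀ X Y : YD H,
    ∃ m : X.rep ⊗ Y.rep ⟶ ((HRep.crossed H).conj X.rep.deg).obj Y.rep ⊗ X.rep,
      (∀ v w, m.lin (v ⊗ₜ[k] w) = braidFormula X Y.rep v w) ∧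
      HEq ((forget H).map (b.c X Y).hom) m

end YD

/-- `H_l` as a left module over itself. -/
def HRep.regular (H : QuasiTuraevCoalgebra k π) (l : π) : HRep H where
  deg := l
  V := H.A l
  act := H.reg l

/-- For an object `Z = (V, c)` of the center of `Rep(H)`, with `V` an `H_α`-module, the linear maps
`ρ_l(v) = c_{H_l}⁻¹(^α 1_l ⊗ v)`. -/
def centerCoact {H : QuasiTuraevCoalgebra k π} (Z : CrossedCenter (HRep.crossed H)) (l : π) :
    Z.obj.V →ₗ[k] Z.obj.V ⊗[k] H.A l :=
  (Z.c (HRep.regular H l)).inv.lin ∘ₗ TensorProduct.mk k (H.A l) Z.obj.V 1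

end YetterDrinfeld

section

open CategoryTheory MonoidalCategory
open scoped TensorProduct

/-! ### Linear maps underlying morphisms of `Rep(H)`; constraints under conjugation; invariant
vectors. -/

namespace HRep

variable {k : Type u} [Field k] {π : Type v} [Group π] {H : QuasiTuraevCoalgebra k π}

/-! Everything is expressed through the inverses d_M = c_M⁻¹ : ^U M ⊗ U → U ⊗ M of a half-braiding.
For m in an H_l-module M the map h ↦ h m is a morphism H_l → M, so naturality forces d_M(m ⊗ v) = v₀
⊗ v₁ m, where v₀ ⊗ v₁ = d_{H_l}(1 ⊗ v). Natural families d are therefore encoded by linear maps ρ_l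
(`IsOpHalfBraiding.lin_eq_coactOn`, `coactOn_natural`). In this dictionary every condition can be
tested at the units of regular modules: linearity of d is the crossed condition on ρ, the hexagon is
quasi-coassociativity, and the canonical value at the unit object is the counit condition
(`isOpHalfBraiding_coactHom`, `IsOpHalfBraiding.isYD`). For a half-braiding the value at the unit
object is not an axiom; it follows from the hexagon and invertibility (`unit_of_isHalfBraiding`).

It remains to see that the d built from a Yetter-Drinfeld module is invertible (`opInverse_d`,
`d_opInverse`). The antipode gives a substitute for duality that works in every dimension. The map b
⊗ m ↦ S(b) p m from H_{l⁻¹} ⊗ M to the space M with trivial action (`evalS`) plays the role of an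
evaluation. The map a ⊗ b ↦ a q S(b) from H_l ⊗ H_{l⁻¹} to H_l with the adjoint action (`mulS`)
sends 1 ⊗ 1 to the invariant vector q, which plays the role of a coevaluation. The identity Y¹ q
S(Y²) p Y³ = 1 is the zigzag relation (`zigzag_one`). As in a rigid category, the inverse of d_M
inserts H_l ⊗ H_{l⁻¹}, moves H_{l⁻¹} past U by d, evaluates it against M, and lets H_l act.
Invariant vectors are images of 1 under morphisms from the unit object, so the constraints and d
treat them as scalars. Written out, this inverse is the stated formula, since S cancels the inverse
antipodes in J and I (`braidFormula_eq`).

Tensor products, unit and conjugates are constructed once for families d (`tensorFamily`,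
`unitFamily`, `conjFamily`), with morphisms tested by `IsCentral`. The center and YD(H) differ only
in how they store d, through its inverse or through ρ, so both inherit their structure from the same
lemmas. Because Φ is invariant under the crossing in each place separately, conjugating an argument
does not change the associativity constraint as a linear map. All canonical identifications are the
identity on vectors, so equalities of objects and heterogeneous equalities of morphisms reduce to
equalities of linear maps. -/

theorem lin_heq_of_heq {X X' Y Y' : HRep H} (hX : X = X') (hY : Y = Y') {f : X ⟶ Y}
    {g : X' ⟶ Y'} (h : HEq f g) : HEq f.lin g.lin := by
  subst hX hY; cases h; rfl

@[simp] theorem tensorHom_lin {X X' Y Y' : HRep H} (f : X ⟶ X') (g : Y ⟶ Y') :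
    (f ⊗ₘ g).lin = TensorProduct.map f.lin g.lin := rfl

@[simp] theorem whiskerLeft_lin (X : HRep H) {Y Y' : HRep H} (g : Y ⟶ Y') :
    (X ◁ g).lin = TensorProduct.map LinearMap.id g.lin := rfl

@[simp] theorem whiskerRight_lin {X X' : HRep H} (f : X ⟶ X') (Y : HRep H) :
    (f ▷ Y).lin = TensorProduct.map f.lin LinearMap.id := rfl

@[simp] theorem hom_inv_lin_apply {X Y : HRep H} (e : X ≅ Y) (x : X.V) :
    e.inv.lin (e.hom.lin x) = x :=
  LinearMap.congr_fun (congrArg Hom.lin e.hom_inv_id) x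

@[simp] theorem inv_hom_lin_apply {X Y : HRep H} (e : X ≅ Y) (y : Y.V) :
    e.hom.lin (e.inv.lin y) = y :=
  LinearMap.congr_fun (congrArg Hom.lin e.inv_hom_id) y

/-- The linear equivalence underlying an isomorphism of `Rep(H)`. -/
def linEquiv {X Y : HRep H} (e : X ≅ Y) : X.V ≃ₗ[k] Y.V :=
  LinearEquiv.ofLinearMap e.hom.lin e.inv.lin
    (LinearMap.ext (inv_hom_lin_apply e)) (LinearMap.ext (hom_inv_lin_apply e))

/-- Converts an equality of modules into an isomorphism that is the identity on vectors: when both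
underlying spaces agree definitionally, the heterogeneous equality pins `e` down to the identity. -/
theorem comm_of_eq {X Y : HRep H} (h : X = Y) :
    ∃ e : X.V ≃ₗ[k] Y.V, HEq e (LinearEquiv.refl k X.V) ∧
      ∀ a x, e (X.act a x) = Y.act (H.cast (congrArg deg h) a) (e x) := by
  subst h; exact ⟨_, HEq.rfl, fun _ _ => rfl⟩

/-- The isomorphism `^β(X ⊗ Y) ≅ ^β X ⊗ ^β Y`, the identity on vectors. -/
def conjTensorIso (β : π) (X Y : HRep H) : conjObj β (X ⊗ Y) ≅ conjObj β X ⊗ conjObj β Y :=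
  isoMk (congrArg deg (conjObj_tensor β X Y)) (LinearEquiv.refl k (X.V ⊗[k] Y.V)) fun a x => by
    obtain ⟨e, he, h⟩ := comm_of_eq (conjObj_tensor β X Y)
    obtain rfl := eq_of_heq he
    exact h a x

/-- The isomorphism `^{βγ} X ≅ ^β(^γ X)`, the identity on vectors. -/
def conjMulIso (β γ : π) (X : HRep H) : conjObj (β * γ) X ≅ conjObj β (conjObj γ X) :=
  isoMk (congrArg deg (conjObj_mul β γ X)) (LinearEquiv.refl k X.V) fun a x => by
    obtain ⟨e, he, h⟩ := comm_of_eq (conjObj_mul β γ X)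
    obtain rfl := eq_of_heq he
    exact h a x

/-- The isomorphism `^1 X ≅ X`, the identity on vectors. -/
def conjOneIso (X : HRep H) : conjObj 1 X ≅ X :=
  isoMk (congrArg deg (conjObj_one X)) (LinearEquiv.refl k X.V) fun a x => by
    obtain ⟨e, he, h⟩ := comm_of_eq (conjObj_one X)
    obtain rfl := eq_of_heq he
    exact h a x

/-- The isomorphism `^β I ≅ I`, the identity on vectors. -/
def conjUnitIso (β : π) : conjObj β (𝟙_ (HRep H)) ≅ 𝟙_ (HRep H) :=
  isoMk (congrArg deg (conjObj_unit β)) (LinearEquiv.refl k k) fun a x => by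
    obtain ⟨e, he, h⟩ := comm_of_eq (conjObj_unit (H := H) β)
    obtain rfl := eq_of_heq he
    exact h a x

/-- The isomorphism `^β X ≅ ^γ X` for `β = γ`, the identity on vectors. -/
def conjCongrIso {β γ : π} (h : β = γ) (X : HRep H) : conjObj β X ≅ conjObj γ X :=
  isoMk (by rw [h]) (LinearEquiv.refl k X.V) fun a x => by subst h; rfl

@[simp] theorem conjTensorIso_inv_lin (β : π) (X Y : HRep H) :
    (conjTensorIso β X Y).inv.lin = LinearMap.id := rfl
@[simp] theorem conjMulIso_hom_lin (β γ : π) (X : HRep H) :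
    (conjMulIso β γ X).hom.lin = LinearMap.id := rfl
@[simp] theorem conjOneIso_hom_lin (X : HRep H) :
    (conjOneIso X).hom.lin = LinearMap.id := rfl

/-- The associativity constraint is not changed by conjugating its arguments separately. -/
theorem conjObj_associator_hom_lin (η θ ϑ : π) (X Y Z : HRep H) :
    (α_ (conjObj η X) (conjObj θ Y) (conjObj ϑ Z)).hom.lin = (α_ X Y Z).hom.lin := by
  refine TensorProduct.ext_threefold fun x y z => ?_
  change tensorAct (X.act.comp (H.φ η X.deg).symm.toAlgHom)
      (tensorAct (Y.act.comp (H.φ θ Y.deg).symm.toAlgHom)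
        (Z.act.comp (H.φ ϑ Z.deg).symm.toAlgHom))
      (H.Φ (η * X.deg * η⁻¹) (θ * Y.deg * θ⁻¹) (ϑ * Z.deg * ϑ⁻¹)).val (x ⊗ₜ[k] (y ⊗ₜ[k] z)) =
    tensorAct X.act (tensorAct Y.act Z.act) (H.Φ _ _ _).val (x ⊗ₜ[k] (y ⊗ₜ[k] z))
  -- This uses the invariance of Φ under three independent crossings; the inverse crossings in the
  -- actions then cancel them factor by factor.
  rw [← H.φ_Φ η θ ϑ]
  generalize (H.Φ X.deg Y.deg Z.deg).val = t
  induction t using TensorProduct.induction_on with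
  | zero => simp
  | add s t hs ht => simp only [map_add, LinearMap.add_apply, hs, ht]
  | tmul a t =>
    induction t using TensorProduct.induction_on with
    | zero => simp
    | add s t hs ht => simp only [map_add, TensorProduct.tmul_add, LinearMap.add_apply, hs, ht]
    | tmul b c => simp

theorem conjObj_associator_inv_lin (η θ ϑ : π) (X Y Z : HRep H) :
    (α_ (conjObj η X) (conjObj θ Y) (conjObj ϑ Z)).inv.lin = (α_ X Y Z).inv.lin := by
  refine LinearMap.ext fun t => (linEquiv (α_ X Y Z)).injective ?_
  refine Eq.trans ?_ (inv_hom_lin_apply (α_ X Y Z) t).symm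
  change (α_ X Y Z).hom.lin _ = _
  rw [← conjObj_associator_hom_lin η θ ϑ]
  exact inv_hom_lin_apply (α_ (conjObj η X) (conjObj θ Y) (conjObj ϑ Z)) t

/-- Conjugation of the first argument does not change the associativity constraint. -/
theorem conjObj_left_associator_hom_lin (η : π) (X Y Z : HRep H) :
    (α_ (conjObj η X) Y Z).hom.lin = (α_ X Y Z).hom.lin := by
  -- Naturality along `conjOneIso` replaces the remaining arguments by their conjugates under 1, so
  -- the lemma with three conjugations applies.
  have h := congrArg Hom.lin
    (associator_naturality (𝟙 (conjObj η X)) (conjOneIso Y).hom (conjOneIso Z).hom)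
  simp only [comp_lin, tensorHom_lin, id_lin, conjOneIso_hom_lin, TensorProduct.map_id] at h
  exact h.trans (conjObj_associator_hom_lin η 1 1 X Y Z)

/-- Conjugation of the second argument does not change the associativity constraint. -/
theorem conjObj_middle_associator_hom_lin (η : π) (X Y Z : HRep H) :
    (α_ X (conjObj η Y) Z).hom.lin = (α_ X Y Z).hom.lin := by
  have h := congrArg Hom.lin
    (associator_naturality (conjOneIso X).hom (𝟙 (conjObj η Y)) (conjOneIso Z).hom)
  simp only [comp_lin, tensorHom_lin, id_lin, conjOneIso_hom_lin, TensorProduct.map_id] at h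
  exact h.trans (conjObj_associator_hom_lin 1 η 1 X Y Z)

theorem conjObj_left_associator_inv_lin (η : π) (X Y Z : HRep H) :
    (α_ (conjObj η X) Y Z).inv.lin = (α_ X Y Z).inv.lin := by
  have h := congrArg Hom.lin
    (associator_inv_naturality (𝟙 (conjObj η X)) (conjOneIso Y).hom (conjOneIso Z).hom)
  simp only [comp_lin, tensorHom_lin, id_lin, conjOneIso_hom_lin, TensorProduct.map_id] at h
  exact h.trans (conjObj_associator_inv_lin η 1 1 X Y Z)

theorem conjObj_middle_associator_inv_lin (η : π) (X Y Z : HRep H) :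
    (α_ X (conjObj η Y) Z).inv.lin = (α_ X Y Z).inv.lin := by
  have h := congrArg Hom.lin
    (associator_inv_naturality (conjOneIso X).hom (𝟙 (conjObj η Y)) (conjOneIso Z).hom)
  simp only [comp_lin, tensorHom_lin, id_lin, conjOneIso_hom_lin, TensorProduct.map_id] at h
  exact h.trans (conjObj_associator_inv_lin 1 η 1 X Y Z)

/-- The morphism `H_l → M`, `h ↦ h m`, for an element `m` of an `H_l`-module `M`. -/
def elt (M : HRep H) (m : M.V) : regular H M.deg ⟶ M where
  deg_eq := rfl
  lin := M.act.toLinearMap.flip m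
  comm := fun (h x : H.A M.deg) => by
    change M.act (h * x) m = M.act h (M.act x m)
    rw [map_mul]; rfl

@[simp] theorem elt_lin_apply (M : HRep H) (m : M.V) (h : H.A M.deg) :
    (elt M m).lin h = M.act h m := rfl

theorem elt_lin_one (M : HRep H) (m : M.V) : (elt M m).lin (1 : H.A M.deg) = m := by
  rw [elt_lin_apply, map_one]; rfl

/-- The conjugate of a morphism. -/
abbrev conjMap (β : π) {X Y : HRep H} (f : X ⟶ Y) : conjObj β X ⟶ conjObj β Y :=
  (conjFunctor β).map f

/-- The axioms of the inverse of a half-braiding on `U`, a family of morphisms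
`d_M : ^U M ⊗ U → U ⊗ M`. -/
structure IsOpHalfBraiding (U : HRep H) (d : ∀ M : HRep H, conjObj U.deg M ⊗ U ⟶ U ⊗ M) :
    Prop where
  natural : ∀ {M N : HRep H} (f : M ⟶ N), conjMap U.deg f ▷ U ≫ d N = d M ≫ U ◁ f
  hexagon : ∀ M N : HRep H, (conjTensorIso U.deg M N).inv ▷ U ≫ d (M ⊗ N) =
    (α_ (conjObj U.deg M) (conjObj U.deg N) U).hom ≫ conjObj U.deg M ◁ d N ≫
      (α_ (conjObj U.deg M) U N).inv ≫ d M ▷ N ≫ (α_ U M N).hom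
  unit : d (𝟙_ (HRep H)) = (conjUnitIso U.deg).hom ▷ U ≫ (λ_ U).hom ≫ (ρ_ U).inv

/-- A vector `n` of an `H_1`-module is invariant if `h n = ε(h) n`, that is, if it is the image of
`1` under a morphism from the unit object. -/
def IsInvariant (N : HRep H) (n : N.V) : Prop := ∃ e : 𝟙_ (HRep H) ⟶ N, e.lin (1 : k) = n

namespace IsInvariant

variable {N : HRep H} {n : N.V}

theorem conj (h : IsInvariant N n) (β : π) : IsInvariant (conjObj β N) n := by
  obtain ⟨e, rfl⟩ := h
  exact ⟨(conjUnitIso β).inv ≫ conjMap β e, rfl⟩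

/-- By naturality the constraint may be computed with the unit object in place of N, where coherence
makes it trivial. The next two lemmas use the same argument for the other two positions. -/
theorem associator_left (h : IsInvariant N n) (X Y : HRep H) (x : X.V) (y : Y.V) :
    (α_ N X Y).inv.lin (n ⊗ₜ[k] (x ⊗ₜ[k] y)) = (n ⊗ₜ[k] x) ⊗ₜ[k] y := by
  obtain ⟨e, rfl⟩ := h
  have h1 : (λ_ (X ⊗ Y)).inv ≫ e ▷ (X ⊗ Y) ≫ (α_ N X Y).inv =
      (λ_ X).inv ▷ Y ≫ (e ▷ X) ▷ Y := by simp
  exact LinearMap.congr_fun (congrArg Hom.lin h1) (x ⊗ₜ[k] y)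

theorem associator_middle (h : IsInvariant N n) (X Y : HRep H) (x : X.V) (y : Y.V) :
    (α_ X N Y).hom.lin ((x ⊗ₜ[k] n) ⊗ₜ[k] y) = x ⊗ₜ[k] (n ⊗ₜ[k] y) := by
  obtain ⟨e, rfl⟩ := h
  have h1 : (ρ_ X).inv ▷ Y ≫ (X ◁ e) ▷ Y ≫ (α_ X N Y).hom =
      X ◁ (λ_ Y).inv ≫ X ◁ (e ▷ Y) := by simp
  exact LinearMap.congr_fun (congrArg Hom.lin h1) (x ⊗ₜ[k] y)

theorem associator_right (h : IsInvariant N n) (X Y : HRep H) (x : X.V) (y : Y.V) :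
    (α_ X Y N).inv.lin (x ⊗ₜ[k] (y ⊗ₜ[k] n)) = (x ⊗ₜ[k] y) ⊗ₜ[k] n := by
  obtain ⟨e, rfl⟩ := h
  have h1 : X ◁ (ρ_ Y).inv ≫ X ◁ (Y ◁ e) ≫ (α_ X Y N).inv =
      (ρ_ (X ⊗ Y)).inv ≫ (X ⊗ Y) ◁ e := by simp
  exact LinearMap.congr_fun (congrArg Hom.lin h1) (x ⊗ₜ[k] y)

/-- Naturality along the morphism from the unit object reduces this to the unit axiom of d. -/
theorem opHalfBraiding (h : IsInvariant N n) {U : HRep H}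
    {d : ∀ M : HRep H, conjObj U.deg M ⊗ U ⟶ U ⊗ M} (hd : IsOpHalfBraiding U d) (v : U.V) :
    (d N).lin (n ⊗ₜ[k] v) = v ⊗ₜ[k] n := by
  obtain ⟨e, rfl⟩ := h
  have h1 := LinearMap.congr_fun (congrArg Hom.lin (hd.natural e)) ((1 : k) ⊗ₜ[k] v)
  rw [hd.unit] at h1
  refine h1.trans ?_
  change TensorProduct.map LinearMap.id e.lin ((TensorProduct.rid k U.V).symm
    (TensorProduct.lid k U.V (TensorProduct.map LinearMap.id LinearMap.id
      ((1 : k) ⊗ₜ[k] v)))) = _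
  simp

end IsInvariant

/-- A vector space as an `H_1`-module with action through the counit. -/
def trivial (H : QuasiTuraevCoalgebra k π) (W : Type u) [AddCommGroup W] [Module k W] :
    HRep H where
  deg := 1
  V := W
  act := (Algebra.ofId k (Module.End k W)).comp H.ε

theorem isInvariant_trivial {W : Type u} [AddCommGroup W] [Module k W] (w : W) :
    IsInvariant (trivial H W) w := by
  refine ⟨⟨rfl, LinearMap.toSpanSingleton k W w, fun (h : H.A 1) (x : k) => ?_⟩, ?_⟩
  · change (H.ε h * x) • w = H.ε h • (x • w)
    rw [mul_smul]
  · exact one_smul k w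

end HRep

/-! ### The antipode as a source of evaluation and coevaluation morphisms. -/

namespace QuasiTuraevCoalgebra

variable {k : Type u} [Field k] {π : Type v} [Group π] (H : QuasiTuraevCoalgebra k π)

theorem S_mul (l : π) (a b : H.A l⁻¹) : H.S l (a * b) = H.S l b * H.S l a := by
  change H.cast _ (MulOpposite.unop (H.antipode l⁻¹ (a * b))) = 
    H.cast _ (MulOpposite.unop (H.antipode l⁻¹ b)) * H.cast _ (MulOpposite.unop (H.antipode l⁻¹ a))
  rw [map_mul, MulOpposite.unop_mul, map_mul]

theorem S_one (l : π) : H.S l 1 = 1 := by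
  change H.cast _ (MulOpposite.unop (H.antipode l⁻¹ 1)) = 1
  rw [map_one, MulOpposite.unop_one, map_one]

theorem S_SInv (l : π) (a : H.A l⁻¹⁻¹) : H.S l (H.SInv l⁻¹ a) = H.cast (inv_inv l) a := by
  change H.cast _ (MulOpposite.unop (H.antipode l⁻¹ ((H.antipode l⁻¹).symm (MulOpposite.op a)))) = _
  rw [AlgEquiv.apply_symm_apply, MulOpposite.unop_op]

theorem S_p (l : π) (h : H.A 1) :
    mulMid (H.S l) (H.p l) LinearMap.id
      (H.Δ l⁻¹ l (H.cast (inv_mul_cancel l).symm h)) = H.ε h • H.p l := by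
  -- The axiom at index l⁻¹ lives in the algebra of index l⁻¹⁻¹; generalizing that index to a
  -- variable allows the identification with l to be substituted away.
  have key : ∀ (l' : π) (e : l⁻¹⁻¹ = l') (e' : 1 = l⁻¹ * l'),
      mulMid ((H.cast e).toLinearMap ∘ₗ (MulOpposite.opLinearEquiv k).symm.toLinearMap ∘ₗ
        (H.antipode l⁻¹).toLinearMap) (H.p l') LinearMap.id (H.Δ l⁻¹ l' (H.cast e' h)) =
      H.ε h • H.p l' := by
    intro l' e e'; subst e; exact H.antipode_p l⁻¹ h
  exact key l (inv_inv l) _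

end QuasiTuraevCoalgebra

namespace HRep

variable {k : Type u} [Field k] {π : Type v} [Group π] {H : QuasiTuraevCoalgebra k π}

/-- The linear map `b ⊗ m ↦ S(b) p m` on `H_{l⁻¹} ⊗ M`. -/
def actS (M : HRep H) : H.A M.deg⁻¹ ⊗[k] M.V →ₗ[k] M.V :=
  TensorProduct.lift (M.act.toLinearMap ∘ₗ LinearMap.mulRight k (H.p M.deg) ∘ₗ H.S M.deg)

theorem actS_tensorAct (M : HRep H) (b : H.A M.deg⁻¹) (m : M.V)
    (t : H.A M.deg⁻¹ ⊗[k] H.A M.deg) :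
    actS M (tensorAct (H.reg M.deg⁻¹) M.act t (b ⊗ₜ[k] m)) =
      M.act (H.S M.deg b * mulMid (H.S M.deg) (H.p M.deg) LinearMap.id t) m := by
  induction t using TensorProduct.induction_on with
  | zero => simp
  | add s t hs ht => simp only [map_add, LinearMap.add_apply, mul_add, hs, ht]
  | tmul x y =>
    change M.act (H.S M.deg (x * b) * H.p M.deg) (M.act y m) =
      M.act (H.S M.deg b * (H.S M.deg x * H.p M.deg * y)) m
    rw [H.S_mul, ← Module.End.mul_apply, ← map_mul]
    simp only [mul_assoc]

/-- Since S reverses products, S(h₁ b) p h₂ m = S(b) (S(h₁) p h₂) m, and the axiom for p collapses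
the bracket to ε(h) p. -/
theorem actS_comul (M : HRep H) (h : H.A (M.deg⁻¹ * M.deg)) (z : H.A M.deg⁻¹ ⊗[k] M.V) :
    actS M (tensorAct (H.reg M.deg⁻¹) M.act (H.Δ _ _ h) z) =
      H.ε (H.cast (inv_mul_cancel M.deg) h) • actS M z := by
  induction z using TensorProduct.induction_on with
  | zero => simp
  | add s t hs ht => simp only [map_add, smul_add, hs, ht]
  | tmul b m =>
    have h1 := H.S_p M.deg (H.cast (inv_mul_cancel M.deg) h)
    rw [QuasiTuraevCoalgebra.cast_cast, QuasiTuraevCoalgebra.cast_rfl] at h1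
    rw [actS_tensorAct, h1, mul_smul_comm, map_smul]; rfl

/-- The morphism `H_{l⁻¹} ⊗ M → M`, `b ⊗ m ↦ S(b) p m`, where the target has the trivial action. -/
def evalS (M : HRep H) : regular H M.deg⁻¹ ⊗ M ⟶ trivial H M.V where
  deg_eq := inv_mul_cancel M.deg
  lin := actS M
  comm := actS_comul M

/-- The antipode `S_{l⁻¹}` as an algebra homomorphism to the opposite algebra. -/
def _root_.QuasiTuraevCoalgebra.SOp (H : QuasiTuraevCoalgebra k π) (l : π) :
    H.A l⁻¹ →ₐ[k] (H.A l)ᵐᵒᵖ :=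
  AlgHom.ofLinearMap ((MulOpposite.opLinearEquiv k).toLinearMap ∘ₗ H.S l)
    (congrArg MulOpposite.op (H.S_one l))
    (fun a b => congrArg MulOpposite.op (H.S_mul l a b))

/-- The action `(a ⊗ b) t = a t S(b)` of `H_l ⊗ H_{l⁻¹}` on `H_l`. -/
def _root_.QuasiTuraevCoalgebra.adj (H : QuasiTuraevCoalgebra k π) (l : π) :
    H.A l ⊗[k] H.A l⁻¹ →ₐ[k] Module.End k (H.A l) :=
  (AlgHom.mulLeftRight k (H.A l)).comp
    (Algebra.TensorProduct.map (AlgHom.id k (H.A l)) (H.SOp l))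

theorem _root_.QuasiTuraevCoalgebra.adj_tmul (l : π) (a : H.A l) (b : H.A l⁻¹) (t : H.A l) :
    H.adj l (a ⊗ₜ[k] b) t = a * t * H.S l b := by
  change AlgHom.mulLeftRight k (H.A l) (a ⊗ₜ[k] H.SOp l b) t = _
  rw [AlgHom.mulLeftRight_apply]; rfl

theorem _root_.QuasiTuraevCoalgebra.adj_q (l : π) (h : H.A 1) :
    H.adj l (H.Δ l l⁻¹ (H.cast (mul_inv_cancel l).symm h)) (H.q l) = H.ε h • H.q l := by
  refine Eq.trans ?_ (H.antipode_q l h)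
  change H.adj l (H.Δ l l⁻¹ (H.cast _ h)) _ =
    mulMid LinearMap.id (H.q l) (H.S l) (H.Δ l l⁻¹ (H.cast _ h))
  generalize H.Δ l l⁻¹ (H.cast _ h) = t
  induction t using TensorProduct.induction_on with
  | zero => simp
  | add s t hs ht => simp only [map_add, LinearMap.add_apply, hs, ht]
  | tmul x y => rw [H.adj_tmul]; rfl

/-- On pure tensors this is (x a) q S(y b) = x (a q S(b)) S(y). It makes `mulS` a morphism to the
adjoint module. -/
theorem _root_.QuasiTuraevCoalgebra.adj_mulMid (l : π) (t z : H.A l ⊗[k] H.A l⁻¹) :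
    mulMid LinearMap.id (H.q l) (H.S l) (tensorAct (H.reg l) (H.reg l⁻¹) t z) =
      H.adj l t (mulMid LinearMap.id (H.q l) (H.S l) z) := by
  induction t using TensorProduct.induction_on with
  | zero => simp
  | add s t hs ht => simp only [map_add, LinearMap.add_apply, hs, ht]
  | tmul x y =>
    induction z using TensorProduct.induction_on with
    | zero => simp
    | add s t hs ht => simp only [map_add, hs, ht]
    | tmul a b =>
      rw [H.adj_tmul]
      change (x * a) * H.q l * H.S l (y * b) = x * (a * H.q l * H.S l b) * H.S l y
      rw [H.S_mul]; simp only [mul_assoc]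

/-- The space `H_l` with the action `h t = h₁ t S(h₂)`. -/
def adjoint (H : QuasiTuraevCoalgebra k π) (l : π) : HRep H where
  deg := l * l⁻¹
  V := H.A l
  act := (H.adj l).comp (H.Δ l l⁻¹)

/-- The axiom h₁ q S(h₂) = ε(h) q is precisely invariance for the adjoint action. Thus q can be
moved freely through constraints and families d, although 1 ⊗ 1 in H_l ⊗ H_{l⁻¹} cannot. -/
theorem isInvariant_q (l : π) : IsInvariant (adjoint H l) (H.q l) := by
  refine ⟨⟨(mul_inv_cancel l).symm, LinearMap.toSpanSingleton k (H.A l) (H.q l),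
    fun (h : H.A 1) (x : k) => ?_⟩, one_smul k (H.q l)⟩
  change (H.ε h * x) • H.q l = H.adj l (H.Δ l l⁻¹ (H.cast _ h)) (x • H.q l)
  rw [map_smul, H.adj_q, mul_comm, mul_smul]

/-- The morphism `H_l ⊗ H_{l⁻¹} → H_l`, `a ⊗ b ↦ a q S(b)`. -/
def mulS (H : QuasiTuraevCoalgebra k π) (l : π) :
    regular H l ⊗ regular H l⁻¹ ⟶ adjoint H l where
  deg_eq := rfl
  lin := mulMid (C := H.A l) LinearMap.id (H.q l) (H.S l)
  comm := fun (h : H.A (l * l⁻¹)) z => H.adj_mulMid l (H.Δ l l⁻¹ h) z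

theorem mulS_lin_one (l : π) :
    (mulS H l).lin ((1 : H.A l) ⊗ₜ[k] (1 : H.A l⁻¹)) = H.q l := by
  change (1 * H.q l * H.S l 1 : H.A l) = _
  rw [H.S_one, one_mul, mul_one]

end HRep

/-! ### Diagrammatic identities for moving a tensor factor past U. -/

section MonoidalIdentities

variable {C : Type*} [Category C] [MonoidalCategory C]

/-- The composite `((R ⊗ Y') ⊗ U) ⊗ M → (R ⊗ U) ⊗ (Y ⊗ M)` given by `d : Y' ⊗ U → U ⊗ Y`. -/
abbrev shuffle (R : C) {Y' U Y : C} (d : Y' ⊗ U ⟶ U ⊗ Y) (M : C) :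
    ((R ⊗ Y') ⊗ U) ⊗ M ⟶ (R ⊗ U) ⊗ (Y ⊗ M) :=
  (α_ R Y' U).hom ▷ M ≫ (R ◁ d) ▷ M ≫ (α_ R U Y).inv ▷ M ≫ (α_ (R ⊗ U) Y M).hom

/-- The morphism f acts on a factor disjoint from d, so it passes by the interchange law; g passes
by the hypothesis. It is applied to right multiplications on regular modules. -/
theorem shuffle_natural {R R₁ Y' Y₁' Y Y₁ U M : C} (f : R ⟶ R₁) (g' : Y' ⟶ Y₁') (g : Y ⟶ Y₁)
    (d : Y' ⊗ U ⟶ U ⊗ Y) (d₁ : Y₁' ⊗ U ⟶ U ⊗ Y₁) (h : g' ▷ U ≫ d₁ = d ≫ U ◁ g) :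
    ((f ⊗ₘ g') ▷ U) ▷ M ≫ shuffle R₁ d₁ M = shuffle R d M ≫ (f ▷ U ⊗ₘ g ▷ M) := by
  calc _ = 𝟙 _ ⊗≫ f ▷ Y' ▷ U ▷ M ⊗≫ R₁ ◁ (g' ▷ U ≫ d₁) ▷ M ⊗≫ 𝟙 _ := by
        rw [MonoidalCategory.tensorHom_def]; monoidal
    _ = 𝟙 _ ⊗≫ (f ▷ (Y' ⊗ U) ≫ R₁ ◁ d) ▷ M ⊗≫ R₁ ◁ U ◁ g ▷ M ⊗≫ 𝟙 _ := by
        rw [h]; monoidal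
    _ = _ := by rw [← whisker_exchange, MonoidalCategory.tensorHom_def]; monoidal

/-- Moving M and then Y past U amounts to moving Y ⊗ M, so by `h` the pairing `s` can be performed
before the move. The rest is coherence. This is used for the composite of d with its candidate
inverse on the left. -/
theorem shuffle_left {R Y' M' Y M N N' U : C} (dM : M' ⊗ U ⟶ U ⊗ M) (dY : Y' ⊗ U ⟶ U ⊗ Y)
    (dN : N' ⊗ U ⟶ U ⊗ N) (s' : Y' ⊗ M' ⟶ N') (s : Y ⊗ M ⟶ N)
    (h : ((α_ Y' M' U).hom ≫ Y' ◁ dM ≫ (α_ Y' U M).inv ≫ dY ▷ M ≫ (α_ U Y M).hom) ≫ U ◁ s =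
      s' ▷ U ≫ dN) :
    (R ⊗ Y') ◁ dM ≫ (α_ (R ⊗ Y') U M).inv ≫ shuffle R dY M ≫ (R ⊗ U) ◁ s =
      (α_ (R ⊗ Y') M' U).inv ≫ ((α_ R Y' M').hom ≫ R ◁ s') ▷ U ≫ (α_ R N' U).hom ≫
        R ◁ dN ≫ (α_ R U N).inv := by
  calc _ = 𝟙 _ ⊗≫ R ◁ (((α_ Y' M' U).hom ≫ Y' ◁ dM ≫ (α_ Y' U M).inv ≫ dY ▷ M ≫
        (α_ U Y M).hom) ≫ U ◁ s) ⊗≫ 𝟙 _ := by monoidal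
    _ = _ := by rw [h]; monoidal

/-- Interchanging `s` with `dR` puts the two moves past U next to each other, in the shape of the
right side of the hexagon for R ⊗ Y. This serves the composite in the other order. -/
theorem shuffle_right {R' R Y' M Y N U : C} (dR : R' ⊗ U ⟶ U ⊗ R) (dY : Y' ⊗ U ⟶ U ⊗ Y)
    (s : Y ⊗ M ⟶ N) :
    shuffle R' dY M ≫ (R' ⊗ U) ◁ s ≫ dR ▷ N =
      ((α_ R' Y' U).hom ≫ R' ◁ dY ≫ (α_ R' U Y).inv ≫ dR ▷ Y ≫ (α_ U R Y).hom) ▷ M ≫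
        (α_ U (R ⊗ Y) M).hom ≫ U ◁ ((α_ R Y M).hom ≫ R ◁ s) ≫ (α_ U R N).inv := by
  rw [whisker_exchange]
  monoidal

end MonoidalIdentities

/-! ### Invertibility of the morphisms d_M. -/

namespace HRep

variable {k : Type u} [Field k] {π : Type v} [Group π] {H : QuasiTuraevCoalgebra k π}

/-- The linear map `t ⊗ (a ⊗ n) ↦ a t n`. -/
def actMul₂ (M : HRep H) : H.A M.deg ⊗[k] (H.A M.deg ⊗[k] M.V) →ₗ[k] M.V :=
  TensorProduct.lift M.act.toLinearMap ∘ₗ TensorProduct.map (LinearMap.mul' k (H.A M.deg) ∘ₗ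
    (TensorProduct.comm k (H.A M.deg) (H.A M.deg)).toLinearMap) LinearMap.id ∘ₗ
    (TensorProduct.assoc k (H.A M.deg) (H.A M.deg) M.V).symm.toLinearMap

/-- The linear map `a ⊗ n ↦ a t n`. -/
def actMul (M : HRep H) (t : H.A M.deg) : H.A M.deg ⊗[k] M.V →ₗ[k] M.V :=
  actMul₂ M ∘ₗ TensorProduct.mk k _ _ t

/-- The linear map `(a ⊗ v) ⊗ n ↦ a t n ⊗ v`. -/
def actMulSwap (M : HRep H) (V : Type u) [AddCommGroup V] [Module k V] (t : H.A M.deg) :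
    (H.A M.deg ⊗[k] V) ⊗[k] M.V →ₗ[k] M.V ⊗[k] V :=
  TensorProduct.map (actMul M t) LinearMap.id ∘ₗ
    (TensorProduct.rightComm k (H.A M.deg) V M.V).toLinearMap

/-- The linear map `(t ⊗ w) ⊗ x ↦ a t n ⊗ v`, where `(a ⊗ v) ⊗ n = f (w ⊗ x)`. -/
def actMulSwapLift (M : HRep H) {V W X : Type u} [AddCommGroup V] [Module k V]
    [AddCommGroup W] [Module k W] [AddCommGroup X] [Module k X]
    (f : W ⊗[k] X →ₗ[k] (H.A M.deg ⊗[k] V) ⊗[k] M.V) :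
    (H.A M.deg ⊗[k] W) ⊗[k] X →ₗ[k] M.V ⊗[k] V :=
  TensorProduct.map (actMul₂ M) LinearMap.id ∘ₗ
    (TensorProduct.assoc k (H.A M.deg) (H.A M.deg ⊗[k] M.V) V).symm.toLinearMap ∘ₗ
    TensorProduct.map LinearMap.id
      ((TensorProduct.rightComm k (H.A M.deg) V M.V).toLinearMap ∘ₗ f) ∘ₗ
    (TensorProduct.assoc k (H.A M.deg) W X).toLinearMap

theorem actMulSwapLift_tmul (M : HRep H) {V W X : Type u} [AddCommGroup V] [Module k V]
    [AddCommGroup W] [Module k W] [AddCommGroup X] [Module k X]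
    (f : W ⊗[k] X →ₗ[k] (H.A M.deg ⊗[k] V) ⊗[k] M.V) (t : H.A M.deg) (w : W) (x : X) :
    actMulSwapLift M f ((t ⊗ₜ[k] w) ⊗ₜ[k] x) = actMulSwap M V t (f (w ⊗ₜ[k] x)) := by
  simp only [actMulSwapLift, actMulSwap, LinearMap.comp_apply, LinearEquiv.coe_coe,
    TensorProduct.assoc_tmul, TensorProduct.map_tmul, LinearMap.id_apply]
  generalize TensorProduct.rightComm k (H.A M.deg) V M.V (f (w ⊗ₜ[k] x)) = y
  induction y using TensorProduct.induction_on with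
  | zero => simp
  | add s t hs ht => simp only [map_add, TensorProduct.tmul_add, hs, ht]
  | tmul a v => rfl

/-- The linear map `(a ⊗ b) ⊗ m ↦ Y¹ a q S(Y² b) p Y³ m`, with `Φ_{l,l⁻¹,l} = Y¹ ⊗ Y² ⊗ Y³`. -/
def zigzag (M : HRep H) :
    (H.A M.deg ⊗[k] H.A M.deg⁻¹) ⊗[k] M.V →ₗ[k] M.V :=
  actMul M (H.q M.deg) ∘ₗ TensorProduct.map LinearMap.id (actS M) ∘ₗ
    (α_ (regular H M.deg) (regular H M.deg⁻¹) M).hom.lin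

theorem actMul_tensorAct_actS (M : HRep H) (t : H.A M.deg ⊗[k] (H.A M.deg⁻¹ ⊗[k] H.A M.deg))
    (m : M.V) :
    actMul M (H.q M.deg) (TensorProduct.map LinearMap.id (actS M)
      (tensorAct (H.reg M.deg) (tensorAct (H.reg M.deg⁻¹) M.act) t
        ((1 : H.A M.deg) ⊗ₜ[k] ((1 : H.A M.deg⁻¹) ⊗ₜ[k] m)))) =
    M.act (mulMid LinearMap.id (H.q M.deg)
      (mulMid (H.S M.deg) (H.p M.deg) LinearMap.id) t) m := by
  induction t using TensorProduct.induction_on with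
  | zero => simp
  | add s t hs ht => simp only [map_add, LinearMap.add_apply, hs, ht]
  | tmul a t =>
    induction t using TensorProduct.induction_on with
    | zero => simp
    | add s t hs ht => simp only [map_add, TensorProduct.tmul_add, LinearMap.add_apply, hs, ht]
    | tmul b c =>
      change M.act (a * 1 * H.q M.deg) (M.act (H.S M.deg (b * 1) * H.p M.deg) (M.act c m)) =
        M.act (a * H.q M.deg * (H.S M.deg b * H.p M.deg * c)) m
      simp only [mul_one, map_mul, Module.End.mul_apply]

/-- The left side is Y¹ q S(Y²) p Y³ m, so this is the antipode axiom involving Φ. -/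
theorem zigzag_one (M : HRep H) (m : M.V) :
    zigzag M (((1 : H.A M.deg) ⊗ₜ[k] (1 : H.A M.deg⁻¹)) ⊗ₜ[k] m) = m := by
  refine (actMul_tensorAct_actS M (H.Φ M.deg M.deg⁻¹ M.deg).val m).trans ?_
  have := H.antipode_Φ M.deg
  change mulMid LinearMap.id _ (mulMid (H.S M.deg) _ _) _ = 1 at this
  rw [this, map_one]; rfl

/-- Right multiplication by `a` as an endomorphism of the regular module. -/
def mulRight (H : QuasiTuraevCoalgebra k π) (l : π) (a : H.A l) : regular H l ⟶ regular H l :=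
  elt (regular H l) a

/-- Because S reverses products, S(y b) = S(b) S(y), so both right multiplications end up next to q
and replace it by a q S(b). -/
theorem actMul_mulRight (M : HRep H) (a : H.A M.deg) (b : H.A M.deg⁻¹)
    (z : H.A M.deg ⊗[k] (H.A M.deg⁻¹ ⊗[k] M.V)) :
    actMul M (H.q M.deg) (TensorProduct.map LinearMap.id (actS M)
      (TensorProduct.map (LinearMap.mulRight k a)
        (TensorProduct.map (LinearMap.mulRight k b) LinearMap.id) z)) =
    actMul M (a * H.q M.deg * H.S M.deg b) (TensorProduct.map LinearMap.id (actS M) z) := by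
  induction z using TensorProduct.induction_on with
  | zero => simp
  | add s t hs ht => simp only [map_add, hs, ht]
  | tmul x z =>
    induction z using TensorProduct.induction_on with
    | zero => simp
    | add s t hs ht => simp only [map_add, TensorProduct.tmul_add, hs, ht]
    | tmul y m =>
      change M.act (x * a * H.q M.deg) (M.act (H.S M.deg (y * b) * H.p M.deg) m) =
        M.act (x * (a * H.q M.deg * H.S M.deg b)) (M.act (H.S M.deg y * H.p M.deg) m)
      rw [H.S_mul]
      simp only [← Module.End.mul_apply, ← map_mul, mul_assoc]

/-- The map `zigzag` factors through `a ⊗ b ↦ a q S(b)`. -/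
theorem exists_zigzag_eq (M : HRep H) :
    ∃ f : H.A M.deg ⊗[k] M.V →ₗ[k] M.V,
      zigzag M = f ∘ₗ TensorProduct.map (mulS H M.deg).lin LinearMap.id ∧
      ∀ m, f (H.q M.deg ⊗ₜ[k] m) = m := by
  -- Here g(m) = Y¹ ⊗ S(Y²) p Y³ m, and the factorization will be f(t ⊗ m) = Y¹ t S(Y²) p Y³ m.
  let g : M.V →ₗ[k] H.A M.deg ⊗[k] M.V :=
    TensorProduct.map LinearMap.id (actS M) ∘ₗ
      (α_ (regular H M.deg) (regular H M.deg⁻¹) M).hom.lin ∘ₗ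
      TensorProduct.mk k (H.A M.deg ⊗[k] H.A M.deg⁻¹) M.V (1 ⊗ₜ[k] 1)
  have hg : ∀ a b m, zigzag M ((a ⊗ₜ[k] b) ⊗ₜ[k] m) =
      actMul M (a * H.q M.deg * H.S M.deg b) (g m) := by
    intro a b m
    -- Right multiplications are endomorphisms of the regular modules, so naturality of the
    -- associativity constraint reduces a ⊗ b to 1 ⊗ 1.
    have h := LinearMap.congr_fun (congrArg Hom.lin
      (associator_naturality (mulRight H M.deg a) (mulRight H M.deg⁻¹ b) (𝟙 M)))
      (((1 : H.A M.deg) ⊗ₜ[k] (1 : H.A M.deg⁻¹)) ⊗ₜ[k] m)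
    refine Eq.trans ?_ (actMul_mulRight M a b _)
    refine Eq.trans ?_ (congrArg (fun z => actMul M (H.q M.deg)
      (TensorProduct.map LinearMap.id (actS M) z)) h)
    change _ = actMul M (H.q M.deg) (TensorProduct.map LinearMap.id (actS M)
      ((α_ (regular H M.deg) (regular H M.deg⁻¹) M).hom.lin
        (((1 * a : H.A M.deg) ⊗ₜ[k] (1 * b : H.A M.deg⁻¹)) ⊗ₜ[k] m)))
    rw [one_mul, one_mul]; rfl
  have h1 : zigzag M = (actMul₂ M ∘ₗ TensorProduct.map LinearMap.id g) ∘ₗ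
      TensorProduct.map (mulS H M.deg).lin LinearMap.id :=
    TensorProduct.ext_threefold hg
  refine ⟨_, h1, fun m => ?_⟩
  have h2 := LinearMap.congr_fun h1 (((1 : H.A M.deg) ⊗ₜ[k] (1 : H.A M.deg⁻¹)) ⊗ₜ[k] m)
  rw [zigzag_one] at h2
  refine Eq.trans ?_ h2.symm
  rw [← mulS_lin_one]; rfl

/-- The composite of `shuffle` for `R = H_l`, `Y = H_{l⁻¹}` with the evaluation `Y ⊗ M → M`. -/
abbrev shuffleEval (U : HRep H) (d : ∀ M : HRep H, conjObj U.deg M ⊗ U ⟶ U ⊗ M) (M : HRep H) :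
    ((conjObj U.deg (regular H M.deg) ⊗ conjObj U.deg (regular H M.deg⁻¹)) ⊗ U) ⊗ M ⟶
      (conjObj U.deg (regular H M.deg) ⊗ U) ⊗ trivial H M.V :=
  shuffle (conjObj U.deg (regular H M.deg)) (d (regular H M.deg⁻¹)) M ≫
    (conjObj U.deg (regular H M.deg) ⊗ U) ◁ evalS M

/-- The candidate for the inverse of `d_M`. -/
def opInverse (U : HRep H) (d : ∀ M : HRep H, conjObj U.deg M ⊗ U ⟶ U ⊗ M) (M : HRep H) :
    U.V ⊗[k] M.V →ₗ[k] M.V ⊗[k] U.V :=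
  actMulSwap M U.V (H.q M.deg) ∘ₗ (shuffleEval U d M).lin ∘ₗ
    TensorProduct.map (TensorProduct.mk k (H.A M.deg ⊗[k] H.A M.deg⁻¹) U.V (1 ⊗ₜ[k] 1))
      LinearMap.id

theorem opInverse_tmul (U : HRep H) (d : ∀ M : HRep H, conjObj U.deg M ⊗ U ⟶ U ⊗ M) (M : HRep H)
    (v : U.V) (m : M.V) :
    opInverse U d M (v ⊗ₜ[k] m) = actMulSwap M U.V (H.q M.deg) ((shuffleEval U d M).lin
      ((((1 : H.A M.deg) ⊗ₜ[k] (1 : H.A M.deg⁻¹)) ⊗ₜ[k] v) ⊗ₜ[k] m)) := rfl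

theorem actMulSwap_mulRight (M : HRep H) {V : Type u} [AddCommGroup V] [Module k V]
    (a : H.A M.deg) (b : H.A M.deg⁻¹) (z : (H.A M.deg ⊗[k] V) ⊗[k] (H.A M.deg⁻¹ ⊗[k] M.V)) :
    actMulSwap M V (H.q M.deg) (TensorProduct.map LinearMap.id (actS M)
      (TensorProduct.map (TensorProduct.map (LinearMap.mulRight k a) LinearMap.id)
        (TensorProduct.map (LinearMap.mulRight k b) LinearMap.id) z)) =
    actMulSwap M V (a * H.q M.deg * H.S M.deg b) (TensorProduct.map LinearMap.id (actS M) z) := by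
  induction z using TensorProduct.induction_on with
  | zero => simp
  | add s t hs ht => simp only [map_add, hs, ht]
  | tmul x z =>
    induction x using TensorProduct.induction_on with
    | zero => simp
    | add s t hs ht => simp only [map_add, TensorProduct.add_tmul, hs, ht]
    | tmul x v =>
      induction z using TensorProduct.induction_on with
      | zero => simp
      | add s t hs ht => simp only [map_add, TensorProduct.tmul_add, hs, ht]
      | tmul y m =>
        change M.act (x * a * H.q M.deg) (M.act (H.S M.deg (y * b) * H.p M.deg) m) ⊗ₜ[k] v =
          M.act (x * (a * H.q M.deg * H.S M.deg b)) (M.act (H.S M.deg y * H.p M.deg) m) ⊗ₜ[k] v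
        rw [H.S_mul]
        simp only [← Module.End.mul_apply, ← map_mul, mul_assoc]

namespace IsOpHalfBraiding

variable {U : HRep H} {d : ∀ M : HRep H, conjObj U.deg M ⊗ U ⟶ U ⊗ M}

/-- Right multiplications pass through `shuffle`. -/
theorem shuffleEval_tmul (hd : IsOpHalfBraiding U d) (M : HRep H) (a : H.A M.deg) (b : H.A M.deg⁻¹) (v : U.V) (m : M.V) :
    actMulSwap M U.V (H.q M.deg) ((shuffleEval U d M).lin (((a ⊗ₜ[k] b) ⊗ₜ[k] v) ⊗ₜ[k] m)) =
    actMulSwap M U.V (a * H.q M.deg * H.S M.deg b) ((shuffleEval U d M).lin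
      ((((1 : H.A M.deg) ⊗ₜ[k] (1 : H.A M.deg⁻¹)) ⊗ₜ[k] v) ⊗ₜ[k] m)) := by
  have h := LinearMap.congr_fun (congrArg Hom.lin
    (shuffle_natural (M := M) (conjMap U.deg (mulRight H M.deg a))
      (conjMap U.deg (mulRight H M.deg⁻¹ b)) (mulRight H M.deg⁻¹ b) _ _
      (hd.natural (mulRight H M.deg⁻¹ b))))
    ((((1 : H.A M.deg) ⊗ₜ[k] (1 : H.A M.deg⁻¹)) ⊗ₜ[k] v) ⊗ₜ[k] m)
  refine Eq.trans ?_ (actMulSwap_mulRight M a b _)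
  refine Eq.trans ?_ (congrArg (fun z => actMulSwap M U.V (H.q M.deg)
    (TensorProduct.map LinearMap.id (actS M) z)) h)
  change _ = actMulSwap M U.V (H.q M.deg) ((shuffleEval U d M).lin
    ((((1 * a : H.A M.deg) ⊗ₜ[k] (1 * b : H.A M.deg⁻¹)) ⊗ₜ[k] v) ⊗ₜ[k] m))
  rw [one_mul, one_mul]

/-- The hypothesis of `shuffle_left` with the pairing `evalS`: the hexagon for H_{l⁻¹} and M,
followed by naturality of d along `evalS`. -/
theorem evalS_hexagon (hd : IsOpHalfBraiding U d) (M : HRep H) :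
    ((α_ (conjObj U.deg (regular H M.deg⁻¹)) (conjObj U.deg M) U).hom ≫
      conjObj U.deg (regular H M.deg⁻¹) ◁ d M ≫
      (α_ (conjObj U.deg (regular H M.deg⁻¹)) U M).inv ≫
      d (regular H M.deg⁻¹) ▷ M ≫ (α_ U (regular H M.deg⁻¹) M).hom) ≫ U ◁ evalS M =
    ((conjTensorIso U.deg (regular H M.deg⁻¹) M).inv ≫ conjMap U.deg (evalS M)) ▷ U ≫
      d (trivial H M.V) := by
  rw [← hd.hexagon, comp_whiskerRight, Category.assoc, Category.assoc, hd.natural]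

/-- Every vector of a trivial module is invariant, so both constraints and d only permute the
factors. -/
theorem actMulSwap_tail (hd : IsOpHalfBraiding U d) (M : HRep H) (z : (H.A M.deg ⊗[k] M.V) ⊗[k] U.V) :
    actMulSwap M U.V (H.q M.deg)
      (((α_ (conjObj U.deg (regular H M.deg)) (conjObj U.deg (trivial H M.V)) U).hom ≫
        conjObj U.deg (regular H M.deg) ◁ d (trivial H M.V) ≫
        (α_ (conjObj U.deg (regular H M.deg)) U (trivial H M.V)).inv).lin z) =
    TensorProduct.map (actMul M (H.q M.deg)) LinearMap.id z := by
  refine LinearMap.congr_fun (f := actMulSwap M U.V (H.q M.deg) ∘ₗ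
      ((α_ (conjObj U.deg (regular H M.deg)) (conjObj U.deg (trivial H M.V)) U).hom ≫
        conjObj U.deg (regular H M.deg) ◁ d (trivial H M.V) ≫
        (α_ (conjObj U.deg (regular H M.deg)) U (trivial H M.V)).inv).lin)
    (g := TensorProduct.map (actMul M (H.q M.deg)) LinearMap.id)
    (TensorProduct.ext_threefold fun a n v => ?_) z
  have h1 := ((isInvariant_trivial (H := H) n).conj U.deg).associator_middle
    (conjObj U.deg (regular H M.deg)) U a v
  have h2 := (isInvariant_trivial (H := H) n).associator_right
    (conjObj U.deg (regular H M.deg)) U a v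
  have h3 := (isInvariant_trivial (H := H) n).opHalfBraiding hd v
  exact congrArg (actMulSwap M U.V (H.q M.deg))
    (((congrArg (fun z => (α_ (conjObj U.deg (regular H M.deg)) U (trivial H M.V)).inv.lin
      ((conjObj U.deg (regular H M.deg) ◁ d (trivial H M.V)).lin z)) h1).trans
    (congrArg (fun z => (α_ (conjObj U.deg (regular H M.deg)) U (trivial H M.V)).inv.lin
      (a ⊗ₜ[k] z)) h3)).trans h2)

/-- By `shuffle_left` the evaluation can take place before anything is moved past U; the evaluated
vector then crosses U trivially, and the zigzag relation returns m. The point needing care is the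
regrouping of 1 ⊗ 1 with U and M, which is allowed because the outcome depends on a ⊗ b only through
a q S(b), that is, only on the invariant vector q. -/
theorem opInverse_d (hd : IsOpHalfBraiding U d) (M : HRep H) (m : M.V) (v : U.V) :
    opInverse U d M ((d M).lin (m ⊗ₜ[k] v)) = m ⊗ₜ[k] v := by
  obtain ⟨f, hf, hf1⟩ := exists_zigzag_eq M
  let R := conjObj U.deg (regular H M.deg)
  let Y := conjObj U.deg (regular H M.deg⁻¹)
  let τ : R ⊗ Y ⟶ conjObj U.deg (adjoint H M.deg) :=
    (conjTensorIso U.deg _ _).inv ≫ conjMap U.deg (mulS H M.deg)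
  have hq := (isInvariant_q (H := H) M.deg).conj U.deg
  -- `G` extends `opInverse` to `(H_l ⊗ U) ⊗ M`
  let E : U.V ⊗[k] M.V →ₗ[k] (H.A M.deg ⊗[k] U.V) ⊗[k] M.V := (shuffleEval U d M).lin ∘ₗ
    TensorProduct.map (TensorProduct.mk k (H.A M.deg ⊗[k] H.A M.deg⁻¹) U.V (1 ⊗ₜ[k] 1))
      LinearMap.id
  let G := actMulSwapLift M E
  have hG : ∀ z, actMulSwap M U.V (H.q M.deg) ((shuffleEval U d M).lin z) =
      G ((τ ▷ U ▷ M).lin z) := by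
    let F₁ : ((H.A M.deg ⊗[k] H.A M.deg⁻¹) ⊗[k] U.V) ⊗[k] M.V →ₗ[k] M.V ⊗[k] U.V :=
      actMulSwap M U.V (H.q M.deg) ∘ₗ (shuffleEval U d M).lin
    let F₂ : ((H.A M.deg ⊗[k] H.A M.deg⁻¹) ⊗[k] U.V) ⊗[k] M.V →ₗ[k] M.V ⊗[k] U.V :=
      G ∘ₗ (τ ▷ U ▷ M).lin
    have h : F₁ = F₂ := by
      refine TensorProduct.ext_fourfold fun a b v m => ?_
      refine (hd.shuffleEval_tmul M a b v m).trans ?_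
      exact (actMulSwapLift_tmul M E (a * H.q M.deg * H.S M.deg b) v m).symm
    exact LinearMap.congr_fun h
  have h1 : ∀ z : U.V ⊗[k] M.V, opInverse U d M z =
      G ((α_ (conjObj U.deg (adjoint H M.deg)) U M).inv.lin (H.q M.deg ⊗ₜ[k] z)) := by
    refine fun z => LinearMap.congr_fun (f := opInverse U d M) (g := G ∘ₗ
      (α_ (conjObj U.deg (adjoint H M.deg)) U M).inv.lin ∘ₗ
      TensorProduct.mk k (H.A M.deg) (U.V ⊗[k] M.V) (H.q M.deg)) ?_ z
    refine TensorProduct.ext' fun v m => ?_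
    refine Eq.trans ?_ (congrArg G (hq.associator_left U M v m)).symm
    exact (actMulSwapLift_tmul M E (H.q M.deg) v m).symm
  -- The inverse associator may be inserted at no cost: after `τ` it is applied to the invariant
  -- vector q, where it is trivial by `associator_left`.
  have h2 : ∀ z : U.V ⊗[k] M.V, opInverse U d M z =
      actMulSwap M U.V (H.q M.deg) ((shuffleEval U d M).lin
        ((α_ (R ⊗ Y) U M).inv.lin (((1 : H.A M.deg) ⊗ₜ[k] (1 : H.A M.deg⁻¹)) ⊗ₜ[k] z))) := by
    intro z
    rw [h1, hG]
    have := LinearMap.congr_fun (congrArg Hom.lin (associator_inv_naturality_left τ U M))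
      (((1 : H.A M.deg) ⊗ₜ[k] (1 : H.A M.deg⁻¹)) ⊗ₜ[k] z)
    refine congrArg G (Eq.trans ?_ this)
    change _ = (α_ (conjObj U.deg (adjoint H M.deg)) U M).inv.lin
      ((mulS H M.deg).lin ((1 : H.A M.deg) ⊗ₜ[k] (1 : H.A M.deg⁻¹)) ⊗ₜ[k] z)
    rw [mulS_lin_one]
  have h3 := LinearMap.congr_fun (congrArg Hom.lin
    (shuffle_left (R := R) (d M) (d (regular H M.deg⁻¹)) (d (trivial H M.V)) _ (evalS M)
      (hd.evalS_hexagon M)))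
    (((1 : H.A M.deg) ⊗ₜ[k] (1 : H.A M.deg⁻¹)) ⊗ₜ[k] (m ⊗ₜ[k] v))
  rw [h2]
  refine (congrArg (actMulSwap M U.V (H.q M.deg)) h3).trans ?_
  refine (hd.actMulSwap_tail M _).trans ?_
  -- As conjugation does not affect the associator on vectors, this composite is `zigzag` tensored
  -- with U, which factors through `τ`.
  have h4 : ∀ z : ((H.A M.deg ⊗[k] H.A M.deg⁻¹) ⊗[k] M.V) ⊗[k] U.V,
      TensorProduct.map (actMul M (H.q M.deg)) LinearMap.id
        ((((α_ R Y (conjObj U.deg M)).hom ≫ R ◁ ((conjTensorIso U.deg (regular H M.deg⁻¹) M).inv ≫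
          conjMap U.deg (evalS M))) ▷ U).lin z) =
      TensorProduct.map f LinearMap.id ((τ ▷ (conjObj U.deg M) ▷ U).lin z) := by
    refine fun z => LinearMap.congr_fun
      (f := TensorProduct.map (actMul M (H.q M.deg)) LinearMap.id ∘ₗ
        (((α_ R Y (conjObj U.deg M)).hom ≫ R ◁ ((conjTensorIso U.deg (regular H M.deg⁻¹) M).inv ≫
          conjMap U.deg (evalS M))) ▷ U).lin)
      (g := TensorProduct.map f LinearMap.id ∘ₗ (τ ▷ (conjObj U.deg M) ▷ U).lin) ?_ z
    refine TensorProduct.ext' fun x v => ?_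
    · refine congrArg (· ⊗ₜ[k] v) ((LinearMap.congr_fun hf x).symm.trans ?_).symm
      change _ = actMul M (H.q M.deg) (TensorProduct.map LinearMap.id (actS M)
        ((α_ R Y (conjObj U.deg M)).hom.lin x))
      rw [conjObj_associator_hom_lin]; rfl
  refine (h4 _).trans ?_
  have h5 := LinearMap.congr_fun (congrArg Hom.lin
    (associator_inv_naturality_left τ (conjObj U.deg M) U))
      (((1 : H.A M.deg) ⊗ₜ[k] (1 : H.A M.deg⁻¹)) ⊗ₜ[k] (m ⊗ₜ[k] v))
  refine (congrArg (TensorProduct.map f LinearMap.id) h5.symm).trans ?_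
  have h6 := hq.associator_left (conjObj U.deg M) U m v
  rw [← mulS_lin_one] at h6
  refine (congrArg (TensorProduct.map f LinearMap.id) h6).trans ?_
  refine congrArg (· ⊗ₜ[k] v) (Eq.trans ?_ (hf1 m))
  exact congrArg (fun q => f (q ⊗ₜ[k] m)) (mulS_lin_one M.deg)

/-- The value of `d_M` is determined by that of `d` on the regular module. -/
theorem d_act (hd : IsOpHalfBraiding U d) (M : HRep H) (a : H.A M.deg) (m : M.V) (v : U.V) :
    (d M).lin (M.act a m ⊗ₜ[k] v) =
      TensorProduct.map LinearMap.id (M.act.toLinearMap.flip m)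
        ((d (regular H M.deg)).lin (a ⊗ₜ[k] v)) :=
  LinearMap.congr_fun (congrArg Hom.lin (hd.natural (elt M m))) (a ⊗ₜ[k] v)

/-- By `d_act`, d_M after the action of H_l becomes d_{H_l} before it. The moves of H_l and H_{l⁻¹}
past U thereby become adjacent. -/
theorem d_actMulSwap (hd : IsOpHalfBraiding U d) (M : HRep H)
    (z : (H.A M.deg ⊗[k] U.V) ⊗[k] M.V) :
    (d M).lin (actMulSwap M U.V (H.q M.deg) z) =
      TensorProduct.map LinearMap.id (actMul M (H.q M.deg))
        (TensorProduct.assoc k U.V (H.A M.deg) M.V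
          (TensorProduct.map (d (regular H M.deg)).lin LinearMap.id z)) := by
  let F₁ : (H.A M.deg ⊗[k] U.V) ⊗[k] M.V →ₗ[k] U.V ⊗[k] M.V :=
    (d M).lin ∘ₗ actMulSwap M U.V (H.q M.deg)
  let F₂ : (H.A M.deg ⊗[k] U.V) ⊗[k] M.V →ₗ[k] U.V ⊗[k] M.V :=
    TensorProduct.map LinearMap.id (actMul M (H.q M.deg)) ∘ₗ
      (TensorProduct.assoc k U.V (H.A M.deg) M.V).toLinearMap ∘ₗ
      TensorProduct.map (d (regular H M.deg)).lin LinearMap.id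
  have h : F₁ = F₂ := by
    refine TensorProduct.ext_threefold fun a v n => ?_
    have h1 : (d M).lin (M.act (a * H.q M.deg) n ⊗ₜ[k] v) =
        TensorProduct.map LinearMap.id (M.act.toLinearMap.flip (M.act (H.q M.deg) n))
        ((d (regular H M.deg)).lin (a ⊗ₜ[k] v)) := by
      rw [← hd.d_act, map_mul]; rfl
    refine h1.trans ?_
    change _ = TensorProduct.map LinearMap.id (actMul M (H.q M.deg))
      (TensorProduct.assoc k U.V (H.A M.deg) M.V ((d (regular H M.deg)).lin (a ⊗ₜ[k] v) ⊗ₜ[k] n))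
    have h2 : ∀ y : U.V ⊗[k] H.A M.deg,
        TensorProduct.map LinearMap.id (M.act.toLinearMap.flip (M.act (H.q M.deg) n)) y =
        TensorProduct.map LinearMap.id (actMul M (H.q M.deg))
          (TensorProduct.assoc k U.V (H.A M.deg) M.V (y ⊗ₜ[k] n)) := by
      intro y
      induction y using TensorProduct.induction_on with
      | zero => simp
      | add s t hs ht => simp only [map_add, TensorProduct.add_tmul, hs, ht]
      | tmul w b =>
        change w ⊗ₜ[k] M.act b (M.act (H.q M.deg) n) = w ⊗ₜ[k] M.act (b * H.q M.deg) n
        rw [map_mul]; rfl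
    exact h2 _
  exact LinearMap.congr_fun h z

/-- The adjacent moves of H_l and H_{l⁻¹} combine by the hexagon into d on their tensor product. The
remaining pairing factors through `mulS`, and naturality carries `mulS` to the beginning, where it
produces q. This invariant vector crosses U trivially, and the factor `f` of the zigzag map then
returns m. -/
theorem d_opInverse (hd : IsOpHalfBraiding U d) (M : HRep H) (v : U.V) (m : M.V) :
    (d M).lin (opInverse U d M (v ⊗ₜ[k] m)) = v ⊗ₜ[k] m := by
  obtain ⟨f, hf, hf1⟩ := exists_zigzag_eq M
  let R := regular H M.deg
  let Y := regular H M.deg⁻¹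
  let τ : R ⊗ Y ⟶ adjoint H M.deg := mulS H M.deg
  have hq := isInvariant_q (H := H) M.deg
  rw [opInverse_tmul]
  refine (hd.d_actMulSwap M _).trans ?_
  have h1 := congrArg Hom.lin (shuffle_right (d R) (d Y) (evalS M))
  rw [← hd.hexagon] at h1
  have h1' := LinearMap.congr_fun h1
    ((((1 : H.A M.deg) ⊗ₜ[k] (1 : H.A M.deg⁻¹)) ⊗ₜ[k] v) ⊗ₜ[k] m)
  refine (congrArg (fun z => TensorProduct.map LinearMap.id (actMul M (H.q M.deg))
        (TensorProduct.assoc k U.V (H.A M.deg) M.V z)) h1').trans ?_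
  -- the last constraint acts trivially
  have h2 : ∀ z : U.V ⊗[k] (H.A M.deg ⊗[k] M.V),
      TensorProduct.assoc k U.V (H.A M.deg) M.V ((α_ U R (trivial H M.V)).inv.lin z) = z := by
    let F₁ : U.V ⊗[k] (H.A M.deg ⊗[k] M.V) →ₗ[k] U.V ⊗[k] (H.A M.deg ⊗[k] M.V) :=
      (TensorProduct.assoc k U.V (H.A M.deg) M.V).toLinearMap ∘ₗ
        (α_ U R (trivial H M.V)).inv.lin
    have h : F₁ = LinearMap.id := by
      refine TensorProduct.ext_threefold' fun u a n => ?_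
      exact congrArg (TensorProduct.assoc k U.V (H.A M.deg) M.V)
        ((isInvariant_trivial (H := H) n).associator_right U R u a)
    exact LinearMap.congr_fun h
  refine (congrArg (TensorProduct.map LinearMap.id (actMul M (H.q M.deg))) (h2 _)).trans ?_
  have h3 : ∀ z : U.V ⊗[k] ((H.A M.deg ⊗[k] H.A M.deg⁻¹) ⊗[k] M.V),
      TensorProduct.map LinearMap.id (actMul M (H.q M.deg))
        ((U ◁ ((α_ R Y M).hom ≫ R ◁ evalS M)).lin z) =
      TensorProduct.map LinearMap.id f ((U ◁ (τ ▷ M)).lin z) := by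
    let F₁ : U.V ⊗[k] ((H.A M.deg ⊗[k] H.A M.deg⁻¹) ⊗[k] M.V) →ₗ[k] U.V ⊗[k] M.V :=
      TensorProduct.map LinearMap.id (actMul M (H.q M.deg)) ∘ₗ
        (U ◁ ((α_ R Y M).hom ≫ R ◁ evalS M)).lin
    let F₂ : U.V ⊗[k] ((H.A M.deg ⊗[k] H.A M.deg⁻¹) ⊗[k] M.V) →ₗ[k] U.V ⊗[k] M.V :=
      TensorProduct.map LinearMap.id f ∘ₗ (U ◁ (τ ▷ M)).lin
    have h : F₁ = F₂ := TensorProduct.ext' fun u x =>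
      congrArg (u ⊗ₜ[k] ·) (LinearMap.congr_fun hf x)
    exact LinearMap.congr_fun h
  refine (h3 _).trans ?_
  -- `mulS` moves to the front, where it meets `1 ⊗ 1`
  have h4 : (((conjTensorIso U.deg R Y).inv ▷ U ≫ d (R ⊗ Y)) ▷ M) ≫ (α_ U (R ⊗ Y) M).hom ≫
      U ◁ (τ ▷ M) =
      ((((conjTensorIso U.deg R Y).inv ≫ conjMap U.deg τ) ▷ U ≫ d (adjoint H M.deg)) ▷ M) ≫
        (α_ U (adjoint H M.deg) M).hom := by
    rw [← associator_naturality_middle, ← comp_whiskerRight_assoc, Category.assoc, ← hd.natural,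
      comp_whiskerRight (conjTensorIso U.deg R Y).inv, Category.assoc]
  have h4' := LinearMap.congr_fun (congrArg Hom.lin h4)
    ((((1 : H.A M.deg) ⊗ₜ[k] (1 : H.A M.deg⁻¹)) ⊗ₜ[k] v) ⊗ₜ[k] m)
  refine (congrArg (TensorProduct.map LinearMap.id f) h4').trans ?_
  have h5 : (((((conjTensorIso U.deg R Y).inv ≫ conjMap U.deg τ) ▷ U ≫
      d (adjoint H M.deg)) ▷ M) ≫ (α_ U (adjoint H M.deg) M).hom).lin
      ((((1 : H.A M.deg) ⊗ₜ[k] (1 : H.A M.deg⁻¹)) ⊗ₜ[k] v) ⊗ₜ[k] m) =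
      v ⊗ₜ[k] (H.q M.deg ⊗ₜ[k] m) := by
    refine Eq.trans ?_ (hq.associator_middle U M v m)
    refine congrArg (fun z => (α_ U (adjoint H M.deg) M).hom.lin (z ⊗ₜ[k] m))
      (Eq.trans ?_ (hq.opHalfBraiding hd v))
    exact congrArg (fun q => (d (adjoint H M.deg)).lin (q ⊗ₜ[k] v)) (mulS_lin_one M.deg)
  refine (congrArg (TensorProduct.map LinearMap.id f) h5).trans ?_
  exact congrArg (v ⊗ₜ[k] ·) (hf1 m)

/-- The inverses of the morphisms `d_M`. -/
def iso (hd : IsOpHalfBraiding U d) (M : HRep H) : U ⊗ M ≅ conjObj U.deg M ⊗ U :=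
  (isoMk (d M).deg_eq (LinearEquiv.ofLinearMap (d M).lin (opInverse U d M)
    (TensorProduct.ext' (hd.d_opInverse M)) (TensorProduct.ext' (hd.opInverse_d M)))
    (d M).comm).symm

end IsOpHalfBraiding

end HRep

/-! ### The correspondence between coactions and inverse half-braidings. -/

section MonoidalIdentities

variable {C : Type*} [Category C] [MonoidalCategory C]

/-- The composite `M' ⊗ (N' ⊗ U) → (U ⊗ M) ⊗ N` given by morphisms `M' ⊗ U → U ⊗ M` and
`N' ⊗ U → U ⊗ N`. -/
abbrev moveTwo {M' M N' N U : C} (dM : M' ⊗ U ⟶ U ⊗ M) (dN : N' ⊗ U ⟶ U ⊗ N) :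
    M' ⊗ (N' ⊗ U) ⟶ (U ⊗ M) ⊗ N :=
  M' ◁ dN ≫ (α_ M' U N).inv ≫ dM ▷ N

/-- The composite `M' ⊗ (N' ⊗ U) → (U ⊗ M) ⊗ N` given by a morphism
`(M' ⊗ N') ⊗ U → U ⊗ (M ⊗ N)`. -/
abbrev moveTensor {M' M N' N U : C} (D : (M' ⊗ N') ⊗ U ⟶ U ⊗ (M ⊗ N)) :
    M' ⊗ (N' ⊗ U) ⟶ (U ⊗ M) ⊗ N :=
  (α_ M' N' U).inv ≫ D ≫ (α_ U M N).inv

/-- Together with `moveTensor_natural`, this reduces the hexagon on arbitrary modules to regular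
modules. -/
theorem moveTwo_natural {M' M N' N U M₁' M₁ N₁' N₁ : C} {dM : M' ⊗ U ⟶ U ⊗ M}
    {dN : N' ⊗ U ⟶ U ⊗ N} {dM₁ : M₁' ⊗ U ⟶ U ⊗ M₁} {dN₁ : N₁' ⊗ U ⟶ U ⊗ N₁}
    {f' : M' ⟶ M₁'} {f : M ⟶ M₁} {g' : N' ⟶ N₁'} {g : N ⟶ N₁}
    (hf : f' ▷ U ≫ dM₁ = dM ≫ U ◁ f) (hg : g' ▷ U ≫ dN₁ = dN ≫ U ◁ g) :
    (f' ⊗ₘ (g' ▷ U)) ≫ moveTwo dM₁ dN₁ = moveTwo dM dN ≫ ((U ◁ f) ⊗ₘ g) := by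
  calc _ = f' ▷ (N' ⊗ U) ≫ M₁' ◁ (g' ▷ U ≫ dN₁) ≫ (α_ M₁' U N₁).inv ≫ dM₁ ▷ N₁ := by
        rw [MonoidalCategory.tensorHom_def, Category.assoc,
          MonoidalCategory.whiskerLeft_comp_assoc]
    _ = (f' ▷ (N' ⊗ U) ≫ M₁' ◁ dN) ≫ (α_ M₁' U N).inv ≫ ((M₁' ⊗ U) ◁ g ≫ dM₁ ▷ N₁) := by
        rw [hg]; simp
    _ = M' ◁ dN ⊗≫ (f' ▷ U ≫ dM₁) ▷ N ⊗≫ (U ⊗ M₁) ◁ g := by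
        rw [whisker_exchange, ← whisker_exchange]; monoidal
    _ = _ := by rw [hf, MonoidalCategory.tensorHom_def]; monoidal

theorem moveTensor_natural {M' M N' N U M₁' M₁ N₁' N₁ : C} {D : (M' ⊗ N') ⊗ U ⟶ U ⊗ (M ⊗ N)}
    {D₁ : (M₁' ⊗ N₁') ⊗ U ⟶ U ⊗ (M₁ ⊗ N₁)}
    {f' : M' ⟶ M₁'} {f : M ⟶ M₁} {g' : N' ⟶ N₁'} {g : N ⟶ N₁}
    (h : (f' ⊗ₘ g') ▷ U ≫ D₁ = D ≫ U ◁ (f ⊗ₘ g)) :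
    (f' ⊗ₘ (g' ▷ U)) ≫ moveTensor D₁ = moveTensor D ≫ ((U ◁ f) ⊗ₘ g) := by
  calc _ = (α_ M' N' U).inv ≫ ((f' ⊗ₘ g') ▷ U ≫ D₁) ≫ (α_ U M₁ N₁).inv := by
        simp [MonoidalCategory.tensorHom_def]
    _ = _ := by rw [h]; simp [MonoidalCategory.tensorHom_def]

theorem moveTwo_eq_moveTensor_iff {M' M N' N U : C} {dM : M' ⊗ U ⟶ U ⊗ M}
    {dN : N' ⊗ U ⟶ U ⊗ N} {D : (M' ⊗ N') ⊗ U ⟶ U ⊗ (M ⊗ N)} :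
    moveTwo dM dN = moveTensor D ↔ D = (α_ M' N' U).hom ≫ M' ◁ dN ≫ (α_ M' U N).inv ≫
      dM ▷ N ≫ (α_ U M N).hom := by
  constructor
  · intro h
    have := congrArg (fun f => (α_ M' N' U).hom ≫ f ≫ (α_ U M N).hom) h
    simpa using this.symm
  · rintro rfl; simp [moveTwo, moveTensor]

end MonoidalIdentities

namespace HRep

variable {k : Type u} [Field k] {π : Type v} [Group π] {H : QuasiTuraevCoalgebra k π}

/-- The linear map `m ⊗ v ↦ v₀ ⊗ v_{1,l} m` given by linear maps `v ↦ v₀ ⊗ v_{1,l}`. -/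
def coactOn {U : HRep H} (ρ : ∀ l : π, U.V →ₗ[k] U.V ⊗[k] H.A l) (M : HRep H) :
    M.V ⊗[k] U.V →ₗ[k] U.V ⊗[k] M.V :=
  TensorProduct.map LinearMap.id (TensorProduct.lift M.act.toLinearMap) ∘ₗ
    (TensorProduct.assoc k U.V (H.A M.deg) M.V).toLinearMap ∘ₗ
    TensorProduct.map (ρ M.deg) LinearMap.id ∘ₗ (TensorProduct.comm k M.V U.V).toLinearMap

section

variable {U : HRep H} (ρ : ∀ l : π, U.V →ₗ[k] U.V ⊗[k] H.A l)

theorem coactOn_tmul (M : HRep H) (m : M.V) (v : U.V) :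
    coactOn ρ M (m ⊗ₜ[k] v) =
      TensorProduct.map LinearMap.id (M.act.toLinearMap.flip m) (ρ M.deg v) := by
  simp only [coactOn, LinearMap.comp_apply, LinearEquiv.coe_coe, TensorProduct.comm_tmul,
    TensorProduct.map_tmul, LinearMap.id_apply]
  generalize ρ M.deg v = y
  induction y using TensorProduct.induction_on with
  | zero => simp
  | add s t hs ht => simp only [map_add, TensorProduct.add_tmul, hs, ht]
  | tmul w b => rfl

theorem coactMul_tmul {V B : Type u} [AddCommGroup V] [Module k V] [Ring B] [Algebra k B]
    (ρ : V →ₗ[k] V ⊗[k] B) (b : B) (v : V) :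
    coactMul ρ (b ⊗ₜ[k] v) = TensorProduct.map LinearMap.id (LinearMap.mulRight k b) (ρ v) := by
  simp only [coactMul, LinearMap.comp_apply, LinearEquiv.coe_coe, TensorProduct.comm_tmul,
    TensorProduct.map_tmul, LinearMap.id_apply]
  generalize ρ v = y
  induction y using TensorProduct.induction_on with
  | zero => simp
  | add s t hs ht => simp only [map_add, TensorProduct.add_tmul, hs, ht]
  | tmul w b => rfl

theorem coactOn_regular_one (l : π) (v : U.V) :
    coactOn ρ (regular H l) ((1 : H.A l) ⊗ₜ[k] v) = ρ l v := by
  have h : LinearMap.mulRight k (1 : H.A l) = LinearMap.id := LinearMap.ext fun b => mul_one b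
  refine (coactMul_tmul (ρ l) (1 : H.A l) v).trans ?_
  rw [h, TensorProduct.map_id]; rfl

theorem reg_tensorAct (l₁ l₂ : π) (s t : H.A l₁ ⊗[k] H.A l₂) :
    tensorAct (H.reg l₁) (H.reg l₂) s t = s * t := by
  induction s using TensorProduct.induction_on with
  | zero => simp
  | add a b ha hb => simp only [map_add, LinearMap.add_apply, add_mul, ha, hb]
  | tmul a b =>
    induction t using TensorProduct.induction_on with
    | zero => simp
    | add x y hx hy => simp only [map_add, mul_add, hx, hy]
    | tmul x y => rw [Algebra.TensorProduct.tmul_mul_tmul]; rfl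

/-- H_{l₁l₂} acts on the product of regular modules by multiplication after Δ. This produces the
comultiplied coaction in the quasi-coassociativity axiom. -/
theorem coactOn_regular_tensor (l₁ l₂ : π) :
    coactOn ρ (regular H l₁ ⊗ regular H l₂) =
      coactMul (TensorProduct.map LinearMap.id (H.Δ l₁ l₂).toLinearMap ∘ₗ ρ (l₁ * l₂)) := by
  refine TensorProduct.ext' fun z v => ?_
  refine (coactOn_tmul ρ (regular H l₁ ⊗ regular H l₂) z v).trans ?_
  change H.A l₁ ⊗[k] H.A l₂ at z
  refine Eq.trans ?_ (coactMul_tmul (B := H.A l₁ ⊗[k] H.A l₂)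
    (TensorProduct.map LinearMap.id (H.Δ l₁ l₂).toLinearMap ∘ₗ ρ (l₁ * l₂)) z v).symm
  change TensorProduct.map LinearMap.id _ (ρ (l₁ * l₂) v) = TensorProduct.map LinearMap.id
    (LinearMap.mulRight k z) (TensorProduct.map LinearMap.id _ (ρ (l₁ * l₂) v))
  generalize ρ (l₁ * l₂) v = y
  induction y using TensorProduct.induction_on with
  | zero => simp only [map_zero]
  | add s t hs ht => simp only [map_add, hs, ht]
  | tmul w b => exact congrArg (w ⊗ₜ[k] ·) (reg_tensorAct l₁ l₂ (H.Δ l₁ l₂ b) z)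

theorem coactOn_natural {M N : HRep H} (f : M ⟶ N) (z : M.V ⊗[k] U.V) :
    coactOn ρ N (TensorProduct.map f.lin LinearMap.id z) =
      TensorProduct.map LinearMap.id f.lin (coactOn ρ M z) := by
  obtain ⟨l, M, aM⟩ := M
  obtain ⟨l', N, aN⟩ := N
  obtain ⟨e, f, hf⟩ := f
  obtain rfl : l = l' := e
  induction z using TensorProduct.induction_on with
  | zero => simp
  | add s t hs ht => simp only [map_add, hs, ht]
  | tmul m v =>
    rw [TensorProduct.map_tmul, coactOn_tmul, coactOn_tmul]
    change TensorProduct.map LinearMap.id (aN.toLinearMap.flip (f m)) (ρ l v) =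
      TensorProduct.map LinearMap.id f (TensorProduct.map LinearMap.id (aM.toLinearMap.flip m) _)
    change _ = TensorProduct.map LinearMap.id f
      (TensorProduct.map LinearMap.id (aM.toLinearMap.flip m) (ρ l v))
    generalize ρ l v = y
    induction y using TensorProduct.induction_on with
    | zero => simp only [map_zero]
    | add s t hs ht => simp only [map_add, hs, ht]
    | tmul w h => exact congrArg (w ⊗ₜ[k] ·) (hf h m).symm

end

namespace IsOpHalfBraiding

variable {U : HRep H} {d : ∀ M : HRep H, conjObj U.deg M ⊗ U ⟶ U ⊗ M}

/-- A Yoneda argument: naturality along h ↦ h m determines d_M from the values d_{H_l}(1 ⊗ v). -/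
theorem lin_eq_coactOn (hd : IsOpHalfBraiding U d) (M : HRep H) :
    (d M).lin = coactOn (fun l => (d (regular H l)).lin ∘ₗ TensorProduct.mk k (H.A l) U.V 1) M := by
  refine TensorProduct.ext' fun m v => ?_
  rw [coactOn_tmul]
  refine Eq.trans ?_ (hd.d_act M 1 m v)
  rw [map_one]; rfl

end IsOpHalfBraiding

/-- This and `moveTensor_regular` identify the two sides of the quasi-coassociativity axiom with the
two sides of the hexagon on H_{l₁}, H_{l₂}, evaluated at 1 ⊗ (1 ⊗ v). -/
theorem moveTwo_regular {U : HRep H} {ρ : ∀ l : π, U.V →ₗ[k] U.V ⊗[k] H.A l}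
    {d : ∀ M : HRep H, conjObj U.deg M ⊗ U ⟶ U ⊗ M} (hρ : ∀ M, (d M).lin = coactOn ρ M)
    (l₁ l₂ : π) (v : U.V) :
    TensorProduct.assoc k U.V (H.A l₁) (H.A l₂)
      ((moveTwo (d (regular H l₁)) (d (regular H l₂))).lin
        ((1 : H.A l₁) ⊗ₜ[k] ((1 : H.A l₂) ⊗ₜ[k] v))) =
    TensorProduct.assoc k U.V (H.A l₁) (H.A l₂)
      (TensorProduct.map (coactMul (ρ l₁)) LinearMap.id
        ((TensorProduct.assoc k (H.A l₁) U.V (H.A l₂)).symm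
          (tensorAct (H.reg l₁) (tensorAct U.act (H.reg l₂)) (H.Φ l₁ U.deg l₂).inv
            ((1 : H.A l₁) ⊗ₜ[k] ρ l₂ v)))) := by
  refine congrArg (TensorProduct.assoc k U.V (H.A l₁) (H.A l₂)) ?_
  change TensorProduct.map (d (regular H l₁)).lin LinearMap.id
    ((α_ (conjObj U.deg (regular H l₁)) U (regular H l₂)).inv.lin
      ((1 : H.A l₁) ⊗ₜ[k] ((d (regular H l₂)).lin ((1 : H.A l₂) ⊗ₜ[k] v)))) = _
  rw [conjObj_left_associator_inv_lin, hρ, hρ, coactOn_regular_one]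
  rfl

theorem moveTensor_regular {U : HRep H} {ρ : ∀ l : π, U.V →ₗ[k] U.V ⊗[k] H.A l}
    {d : ∀ M : HRep H, conjObj U.deg M ⊗ U ⟶ U ⊗ M} (hρ : ∀ M, (d M).lin = coactOn ρ M)
    (l₁ l₂ : π) (v : U.V) :
    TensorProduct.assoc k U.V (H.A l₁) (H.A l₂)
      ((moveTensor ((conjTensorIso U.deg (regular H l₁) (regular H l₂)).inv ▷ U ≫
        d (regular H l₁ ⊗ regular H l₂))).lin
        ((1 : H.A l₁) ⊗ₜ[k] ((1 : H.A l₂) ⊗ₜ[k] v))) =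
    tensorAct U.act (tensorAct (H.reg l₁) (H.reg l₂)) (H.Φ U.deg l₁ l₂).inv
      (coactMul (TensorProduct.map LinearMap.id (H.Δ l₁ l₂).toLinearMap ∘ₗ ρ (l₁ * l₂))
        ((TensorProduct.assoc k (H.A l₁) (H.A l₂) U.V).symm
          (tensorAct (H.reg l₁) (tensorAct (H.reg l₂) U.act) (H.Φ l₁ l₂ U.deg).inv
            ((1 : H.A l₁) ⊗ₜ[k] ((1 : H.A l₂) ⊗ₜ[k] v))))) := by
  have h := (conjObj_left_associator_inv_lin U.deg (regular H l₁)
    (conjObj U.deg (regular H l₂)) U).trans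
    (conjObj_middle_associator_inv_lin U.deg (regular H l₁) (regular H l₂) U)
  change TensorProduct.assoc k U.V (H.A l₁) (H.A l₂)
    ((TensorProduct.assoc k U.V (H.A l₁) (H.A l₂)).symm
      (tensorAct U.act (tensorAct (H.reg l₁) (H.reg l₂)) (H.Φ U.deg l₁ l₂).inv
        ((d (regular H l₁ ⊗ regular H l₂)).lin (TensorProduct.map LinearMap.id LinearMap.id
          ((α_ (conjObj U.deg (regular H l₁)) (conjObj U.deg (regular H l₂)) U).inv.lin _))))) = _
  rw [LinearEquiv.apply_symm_apply, TensorProduct.map_id, h, hρ, coactOn_regular_tensor]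
  rfl

/-- The equivariance of `coactOn` on the regular module. -/
theorem coactOn_act {U : HRep H} {ρ : ∀ l : π, U.V →ₗ[k] U.V ⊗[k] H.A l} (hρ : IsYD U ρ)
    (M : HRep H) (h : H.A (U.deg * M.deg * U.deg⁻¹ * U.deg)) (z : M.V ⊗[k] U.V) :
    coactOn ρ M ((conjObj U.deg M ⊗ U).act h z) =
      (U ⊗ M).act (H.cast (show U.deg * M.deg * U.deg⁻¹ * U.deg = U.deg * M.deg by group) h)
        (coactOn ρ M z) := by
  induction z using TensorProduct.induction_on with
  | zero => simp
  | add s t hs ht => simp only [map_add, hs, ht]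
  | tmul m v =>
    -- The crossed axiom is equivariance at 1 ⊗ v for the regular module; both sides are carried to
    -- m ⊗ v by naturality along `elt M m`.
    have h1 := hρ.crossed M.deg (H.cast
      (show U.deg * M.deg * U.deg⁻¹ * U.deg = U.deg * M.deg by group) h) v
    rw [QuasiTuraevCoalgebra.cast_cast, QuasiTuraevCoalgebra.cast_rfl] at h1
    have h2 : (conjObj U.deg M ⊗ U).act h (m ⊗ₜ[k] v) =
        TensorProduct.map (elt M m).lin LinearMap.id
          (tensorAct ((H.reg M.deg).comp (H.φ U.deg M.deg).symm.toAlgHom) U.act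
            (H.Δ (U.deg * M.deg * U.deg⁻¹) U.deg h) ((1 : H.A M.deg) ⊗ₜ[k] v)) := by
      have h3 := (conjMap U.deg (elt M m) ▷ U).comm h ((1 : H.A M.deg) ⊗ₜ[k] v)
      refine Eq.trans ?_ h3.symm
      refine congrArg ((conjObj U.deg M ⊗ U).act h) ?_
      exact congrArg (· ⊗ₜ[k] v) (elt_lin_one M m).symm
    have h4 : (U ⊗ M).act (H.cast
        (show U.deg * M.deg * U.deg⁻¹ * U.deg = U.deg * M.deg by group) h)
        (coactOn ρ M (m ⊗ₜ[k] v)) =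
        TensorProduct.map LinearMap.id (elt M m).lin (tensorAct U.act (H.reg M.deg)
          (H.Δ U.deg M.deg (H.cast
            (show U.deg * M.deg * U.deg⁻¹ * U.deg = U.deg * M.deg by group) h)) (ρ M.deg v)) := by
      refine Eq.trans ?_ ((U ◁ elt M m).comm _ (ρ M.deg v)).symm
      refine congrArg ((U ⊗ M).act _) ?_
      exact coactOn_tmul ρ M m v
    rw [h2, h4, h1]
    exact coactOn_natural ρ (elt M m) _

/-- The morphisms `^U M ⊗ U → U ⊗ M`, `m ⊗ v ↦ v₀ ⊗ v₁ m`, for a Yetter-Drinfeld module `U`. -/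
def coactHom {U : HRep H} {ρ : ∀ l : π, U.V →ₗ[k] U.V ⊗[k] H.A l} (hρ : IsYD U ρ)
    (M : HRep H) : conjObj U.deg M ⊗ U ⟶ U ⊗ M where
  deg_eq := show U.deg * M.deg * U.deg⁻¹ * U.deg = U.deg * M.deg by group
  lin := coactOn ρ M
  comm := coactOn_act hρ M

/-- A vector m ⊗ (n ⊗ v) is the image of 1 ⊗ (1 ⊗ v) under `elt M m` and `elt N n`, so naturality
reduces the hexagon to the quasi-coassociativity axiom. The unit condition follows from the counit
axiom because the action on k is through ε. -/
theorem isOpHalfBraiding_coactHom {U : HRep H} {ρ : ∀ l : π, U.V →ₗ[k] U.V ⊗[k] H.A l}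
    (hρ : IsYD U ρ) : IsOpHalfBraiding U (coactHom hρ) := by
  have nat : ∀ {M N : HRep H} (f : M ⟶ N),
      conjMap U.deg f ▷ U ≫ coactHom hρ N = coactHom hρ M ≫ U ◁ f := fun f =>
    hom_ext (LinearMap.ext fun z => coactOn_natural ρ f z)
  refine ⟨nat, fun M N => ?_, ?_⟩
  · rw [← moveTwo_eq_moveTensor_iff]
    refine hom_ext (TensorProduct.ext_threefold' fun m n v => ?_)
    have h1 := LinearMap.congr_fun (congrArg Hom.lin
      (moveTwo_natural (nat (elt M m)) (nat (elt N n))))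
      ((1 : H.A M.deg) ⊗ₜ[k] ((1 : H.A N.deg) ⊗ₜ[k] v))
    have h2 := LinearMap.congr_fun (congrArg Hom.lin
      (moveTensor_natural (f' := conjMap U.deg (elt M m)) (f := elt M m)
        (g' := conjMap U.deg (elt N n)) (g := elt N n)
        (D := (conjTensorIso U.deg _ _).inv ▷ U ≫ coactHom hρ _)
        (D₁ := (conjTensorIso U.deg _ _).inv ▷ U ≫ coactHom hρ _) (by
        rw [Category.assoc, ← nat (elt M m ⊗ₘ elt N n), ← comp_whiskerRight_assoc,
          ← comp_whiskerRight_assoc]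
        rfl)))
      ((1 : H.A M.deg) ⊗ₜ[k] ((1 : H.A N.deg) ⊗ₜ[k] v))
    have h3 : m ⊗ₜ[k] (n ⊗ₜ[k] v) = (conjMap U.deg (elt M m) ⊗ₘ (conjMap U.deg (elt N n) ▷ U)).lin
        ((1 : H.A M.deg) ⊗ₜ[k] ((1 : H.A N.deg) ⊗ₜ[k] v)) :=
      (congrArg₂ (fun x y => x ⊗ₜ[k] (y ⊗ₜ[k] v)) (elt_lin_one M m) (elt_lin_one N n)).symm
    have h4 := hρ.quasi_coassoc M.deg N.deg v
    rw [← moveTwo_regular (d := coactHom hρ) (fun _ => rfl),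
      ← moveTensor_regular (d := coactHom hρ) (fun _ => rfl)] at h4
    have h5 := (TensorProduct.assoc k U.V (H.A M.deg) (H.A N.deg)).injective h4
    rw [h3]
    exact h1.trans ((congrArg (((U ◁ elt M m) ⊗ₘ elt N n).lin) h5).trans h2.symm)
  · refine hom_ext (TensorProduct.ext' fun c v => ?_)
    refine (coactOn_tmul ρ (𝟙_ (HRep H)) c v).trans ?_
    change TensorProduct.map LinearMap.id ((Algebra.lmul k k).toLinearMap.flip c ∘ₗ
      H.ε.toLinearMap) (ρ 1 v) = (TensorProduct.rid k U.V).symm (c • v)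
    have h : ∀ y : U.V ⊗[k] H.A 1, TensorProduct.rid k U.V (TensorProduct.map LinearMap.id
        ((Algebra.lmul k k).toLinearMap.flip c ∘ₗ H.ε.toLinearMap) y) =
        c • TensorProduct.rid k U.V (TensorProduct.map LinearMap.id H.ε.toLinearMap y) := by
      intro y
      induction y using TensorProduct.induction_on with
      | zero => simp only [map_zero, smul_zero]
      | add s t hs ht => simp only [map_add, smul_add, hs, ht]
      | tmul w b =>
        change (H.ε b * c) • w = c • (H.ε b • w)
        rw [mul_comm, mul_smul]
    rw [LinearEquiv.eq_symm_apply, h, hρ.counit]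

/-- Conversely, each axiom is obtained by evaluation at a unit: the unit condition at 1 in k, the
hexagon at 1 ⊗ 1 in two regular modules, linearity at 1 in one. -/
theorem IsOpHalfBraiding.isYD {U : HRep H} {d : ∀ M : HRep H, conjObj U.deg M ⊗ U ⟶ U ⊗ M}
    (hd : IsOpHalfBraiding U d) :
    IsYD U (fun l => (d (regular H l)).lin ∘ₗ TensorProduct.mk k (H.A l) U.V 1) where
  counit v := by
    have h := LinearMap.congr_fun (hd.lin_eq_coactOn (𝟙_ (HRep H))) ((1 : k) ⊗ₜ[k] v)
    rw [coactOn_tmul, hd.unit] at h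
    have h1 : TensorProduct.rid k U.V ((TensorProduct.rid k U.V).symm
      (TensorProduct.lid k U.V ((1 : k) ⊗ₜ[k] v))) = v := by simp
    refine Eq.trans ?_ h1
    refine (congrArg (TensorProduct.rid k U.V) (Eq.trans h ?_)).symm
    refine congrArg (TensorProduct.map LinearMap.id · _) ?_
    exact LinearMap.ext fun a => mul_one _
  quasi_coassoc l₁ l₂ v := by
    rw [← moveTwo_regular (d := d) hd.lin_eq_coactOn,
      ← moveTensor_regular (d := d) hd.lin_eq_coactOn,
      moveTwo_eq_moveTensor_iff.2 (hd.hexagon (regular H l₁) (regular H l₂))]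
  crossed l h v := by
    have h1 := (d (regular H l)).comm (H.cast
      (show U.deg * l = U.deg * l * U.deg⁻¹ * U.deg by group) h) ((1 : H.A l) ⊗ₜ[k] v)
    rw [hd.lin_eq_coactOn] at h1
    refine Eq.trans ?_ h1.symm
    rw [coactOn_regular_one]
    refine congrArg (fun h => tensorAct U.act (H.reg l) (H.Δ U.deg l h) _) ?_
    exact ((QuasiTuraevCoalgebra.cast_cast _ _ h).trans
      (QuasiTuraevCoalgebra.cast_rfl _ h)).symm

end HRep

/-! ### The explicit formula for the braiding. -/

namespace QuasiTuraevCoalgebra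

variable {k : Type u} [Field k] {π : Type v} [Group π] (H : QuasiTuraevCoalgebra k π)

theorem cast_p {α β : π} (h : α = β) : H.cast h (H.p α) = H.p β := by subst h; rfl

theorem cast_q {α β : π} (h : α = β) : H.cast h (H.q α) = H.q β := by subst h; rfl

end QuasiTuraevCoalgebra

namespace HRep

variable {k : Type u} [Field k] {π : Type v} [Group π] {H : QuasiTuraevCoalgebra k π}

/-- The linear map `a ⊗ (u ⊗ c) ↦ a t S(c) m ⊗ u`. -/
def actMulS (M : HRep H) (V : Type u) [AddCommGroup V] [Module k V] (t : H.A M.deg) (m : M.V) :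
    H.A M.deg ⊗[k] (V ⊗[k] H.A M.deg⁻¹) →ₗ[k] M.V ⊗[k] V :=
  TensorProduct.map (M.act.toLinearMap.flip m) LinearMap.id ∘ₗ
    TensorProduct.map (mulMid LinearMap.id t (H.S M.deg)) LinearMap.id ∘ₗ
    (TensorProduct.assoc k (H.A M.deg) (H.A M.deg⁻¹) V).symm.toLinearMap ∘ₗ
    TensorProduct.map LinearMap.id (TensorProduct.comm k V (H.A M.deg⁻¹)).toLinearMap

/-- Since S(Y² S⁻¹(Y¹ q)) = Y¹ q S(Y²), the element I inside the antipode amounts to the action of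
Φ, with q inserted in the middle of the product. -/
theorem actMulS_I (U M : HRep H) (ρ : ∀ l : π, U.V →ₗ[k] U.V ⊗[k] H.A l) (v : U.V) (m : M.V)
    (t : H.A M.deg ⊗[k] (H.A U.deg ⊗[k] H.A M.deg⁻¹)) :
    actMulS M U.V 1 m (tensorAct (H.reg M.deg) (tensorAct U.act (H.reg M.deg⁻¹)) t
      ((1 : H.A M.deg) ⊗ₜ[k] coactMul (ρ M.deg⁻¹)
        (tensorAct (H.reg M.deg⁻¹) U.act (H.I M.deg⁻¹ U.deg) ((1 : H.A M.deg⁻¹) ⊗ₜ[k] v)))) =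
    actMulS M U.V (H.q M.deg) m (tensorAct (H.reg M.deg) (tensorAct U.act (H.reg M.deg⁻¹)) t
      (TensorProduct.map LinearMap.id (coactMul (ρ M.deg⁻¹))
        (tensorAct (H.reg M.deg) (tensorAct (H.reg M.deg⁻¹) U.act)
          (H.Φ M.deg M.deg⁻¹ U.deg).val
          ((1 : H.A M.deg) ⊗ₜ[k] ((1 : H.A M.deg⁻¹) ⊗ₜ[k] v))))) := by
  -- The element `H.I M.deg⁻¹ U.deg` is built from Φ with first index l⁻¹⁻¹; it has to be
  -- transported to l.
  have hΦ := QuasiTuraevCoalgebra.Φ_cast (H := H) (inv_inv M.deg) (rfl : M.deg⁻¹ = M.deg⁻¹)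
    (rfl : U.deg = U.deg)
  rw [← hΦ, QuasiTuraevCoalgebra.I]
  generalize (H.Φ M.deg⁻¹⁻¹ M.deg⁻¹ U.deg).val = x
  induction x using TensorProduct.induction_on with
  | zero => simp
  | add s t hs ht =>
    simp only [map_add, LinearMap.add_apply, TensorProduct.tmul_add, hs, ht]
  | tmul x₁ x =>
    induction x using TensorProduct.induction_on with
    | zero => simp
    | add s t hs ht =>
      simp only [map_add, LinearMap.add_apply, TensorProduct.tmul_add, hs, ht]
    | tmul x₂ x₃ =>
      have h1 : tensorAct (H.reg M.deg⁻¹) U.act (TensorProduct.map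
          (mulMid LinearMap.id 1 (H.SInv M.deg⁻¹ ∘ₗ LinearMap.mulRight k (H.q M.deg⁻¹⁻¹)) ∘ₗ
            (TensorProduct.comm k (H.A M.deg⁻¹⁻¹) (H.A M.deg⁻¹)).toLinearMap) LinearMap.id
          ((TensorProduct.assoc k (H.A M.deg⁻¹⁻¹) (H.A M.deg⁻¹) (H.A U.deg)).symm
            (x₁ ⊗ₜ[k] (x₂ ⊗ₜ[k] x₃)))) ((1 : H.A M.deg⁻¹) ⊗ₜ[k] v) =
          (x₂ * 1 * H.SInv M.deg⁻¹ (x₁ * H.q M.deg⁻¹⁻¹) * 1) ⊗ₜ[k] U.act x₃ v := rfl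
      have h2 : TensorProduct.map LinearMap.id (coactMul (ρ M.deg⁻¹))
        (tensorAct (H.reg M.deg) (tensorAct (H.reg M.deg⁻¹) U.act)
          (Algebra.TensorProduct.map (H.cast (inv_inv M.deg)).toAlgHom
            (Algebra.TensorProduct.map (H.cast (rfl : M.deg⁻¹ = M.deg⁻¹)).toAlgHom
              (H.cast (rfl : U.deg = U.deg)).toAlgHom) (x₁ ⊗ₜ[k] (x₂ ⊗ₜ[k] x₃)))
          ((1 : H.A M.deg) ⊗ₜ[k] ((1 : H.A M.deg⁻¹) ⊗ₜ[k] v))) =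
          (H.cast (inv_inv M.deg) x₁ * 1) ⊗ₜ[k]
            coactMul (ρ M.deg⁻¹) ((x₂ * 1) ⊗ₜ[k] U.act x₃ v) := rfl
      rw [h1, h2, coactMul_tmul, coactMul_tmul]
      simp only [mul_one]
      generalize ρ M.deg⁻¹ (U.act x₃ v) = r
      induction r using TensorProduct.induction_on with
      | zero => simp
      | add s t hs ht =>
        simp only [map_add, TensorProduct.tmul_add, hs, ht]
      | tmul r₀ r₁ =>
        induction t using TensorProduct.induction_on with
        | zero => simp
        | add s t hs ht => simp only [map_add, LinearMap.add_apply, hs, ht]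
        | tmul a t =>
          induction t using TensorProduct.induction_on with
          | zero => simp
          | add s t hs ht =>
            simp only [map_add, LinearMap.add_apply, TensorProduct.tmul_add, hs, ht]
          | tmul b c =>
            change M.act (a * 1 * 1 * H.S M.deg (c * (r₁ *
                (x₂ * H.SInv M.deg⁻¹ (x₁ * H.q M.deg⁻¹⁻¹))))) m ⊗ₜ[k] U.act b r₀ =
              M.act (a * H.cast (inv_inv M.deg) x₁ * H.q M.deg *
                H.S M.deg (c * (r₁ * x₂))) m ⊗ₜ[k] U.act b r₀
            simp only [H.S_mul, H.S_SInv, map_mul, H.cast_q, mul_one, mul_assoc]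

/-- Since S(S⁻¹(p Y³) Y² c) = S(Y² c) p Y³, applying the antipode to J produces the evaluation
`actS` after an action of Φ. The comultiplied first leg of J is the action on the tensor product of
the conjugated regular module with U. -/
theorem actMulS_J (U M : HRep H) (m : M.V) (t : H.A M.deg)
    (w : H.A M.deg ⊗[k] (U.V ⊗[k] H.A M.deg⁻¹)) :
    actMulS M U.V t m (tensorAct (H.reg M.deg) (tensorAct U.act (H.reg M.deg⁻¹))
      (TensorProduct.assoc k (H.A M.deg) (H.A U.deg) (H.A M.deg⁻¹)
        (TensorProduct.map (TensorProduct.map (H.φ U.deg M.deg).symm.toLinearMap LinearMap.id ∘ₗ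
          (H.Δ (U.deg * M.deg * U.deg⁻¹) U.deg).toLinearMap ∘ₗ
          (H.cast (show U.deg * M.deg = U.deg * M.deg * U.deg⁻¹ * U.deg by group)).toLinearMap)
          LinearMap.id (H.J (U.deg * M.deg) M.deg⁻¹))) w) =
    actMulSwap M U.V t (TensorProduct.map LinearMap.id (actS M)
      (tensorAct ((tensorAct ((H.reg M.deg).comp (H.φ U.deg M.deg).symm.toAlgHom) U.act).comp
          (H.Δ (U.deg * M.deg * U.deg⁻¹) U.deg)) (tensorAct (H.reg M.deg⁻¹) M.act)
        (H.Φ (U.deg * M.deg * U.deg⁻¹ * U.deg) M.deg⁻¹ M.deg).val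
        (TensorProduct.assoc k (H.A M.deg ⊗[k] U.V) (H.A M.deg⁻¹) M.V
          ((TensorProduct.assoc k (H.A M.deg) U.V (H.A M.deg⁻¹)).symm w ⊗ₜ[k] m)))) := by
  have hΦ := QuasiTuraevCoalgebra.Φ_cast (H := H)
    (show U.deg * M.deg = U.deg * M.deg * U.deg⁻¹ * U.deg by group)
    (rfl : M.deg⁻¹ = M.deg⁻¹) (inv_inv M.deg)
  rw [← hΦ, QuasiTuraevCoalgebra.J]
  generalize (H.Φ (U.deg * M.deg) M.deg⁻¹ M.deg⁻¹⁻¹).val = x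
  induction x using TensorProduct.induction_on with
  | zero => simp
  | add s t hs ht => simp only [map_add, LinearMap.add_apply, hs, ht]
  | tmul x₁ x =>
    induction x using TensorProduct.induction_on with
    | zero => simp
    | add s t hs ht =>
      simp only [map_add, LinearMap.add_apply, TensorProduct.tmul_add, hs, ht]
    | tmul x₂ x₃ =>
      have h1 : TensorProduct.assoc k (H.A M.deg) (H.A U.deg) (H.A M.deg⁻¹)
        (TensorProduct.map (TensorProduct.map (H.φ U.deg M.deg).symm.toLinearMap LinearMap.id ∘ₗ
          (H.Δ (U.deg * M.deg * U.deg⁻¹) U.deg).toLinearMap ∘ₗ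
          (H.cast (show U.deg * M.deg = U.deg * M.deg * U.deg⁻¹ * U.deg by group)).toLinearMap)
          LinearMap.id (TensorProduct.map LinearMap.id
            (mulMid (H.SInv M.deg⁻¹ ∘ₗ LinearMap.mulLeft k (H.p M.deg⁻¹⁻¹)) 1 LinearMap.id ∘ₗ
            (TensorProduct.comm k (H.A M.deg⁻¹) (H.A M.deg⁻¹⁻¹)).toLinearMap)
              (x₁ ⊗ₜ[k] (x₂ ⊗ₜ[k] x₃)))) =
          TensorProduct.assoc k (H.A M.deg) (H.A U.deg) (H.A M.deg⁻¹)
          ((TensorProduct.map (H.φ U.deg M.deg).symm.toLinearMap LinearMap.id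
            (H.Δ (U.deg * M.deg * U.deg⁻¹) U.deg (H.cast
              (show U.deg * M.deg = U.deg * M.deg * U.deg⁻¹ * U.deg by group) x₁))) ⊗ₜ[k]
            (H.SInv M.deg⁻¹ (H.p M.deg⁻¹⁻¹ * x₃) * 1 * x₂)) := rfl
      have h2 : ∀ y, tensorAct ((tensorAct ((H.reg M.deg).comp (H.φ U.deg M.deg).symm.toAlgHom)
          U.act).comp (H.Δ (U.deg * M.deg * U.deg⁻¹) U.deg)) (tensorAct (H.reg M.deg⁻¹) M.act)
          (Algebra.TensorProduct.map (H.cast (show U.deg * M.deg =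
            U.deg * M.deg * U.deg⁻¹ * U.deg by group)).toAlgHom
            (Algebra.TensorProduct.map (H.cast (rfl : M.deg⁻¹ = M.deg⁻¹)).toAlgHom
              (H.cast (inv_inv M.deg)).toAlgHom) (x₁ ⊗ₜ[k] (x₂ ⊗ₜ[k] x₃))) y =
          tensorAct (tensorAct ((H.reg M.deg).comp (H.φ U.deg M.deg).symm.toAlgHom) U.act)
            (tensorAct (H.reg M.deg⁻¹) M.act)
            (H.Δ (U.deg * M.deg * U.deg⁻¹) U.deg (H.cast (show U.deg * M.deg =
              U.deg * M.deg * U.deg⁻¹ * U.deg by group) x₁) ⊗ₜ[k]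
              (x₂ ⊗ₜ[k] H.cast (inv_inv M.deg) x₃)) y := fun y => rfl
      rw [h1, h2]
      generalize H.Δ (U.deg * M.deg * U.deg⁻¹) U.deg _ = D
      induction D using TensorProduct.induction_on with
      | zero => simp
      | add s t hs ht =>
        simp only [map_add, LinearMap.add_apply, TensorProduct.add_tmul, hs, ht]
      | tmul d₁ d₂ =>
        induction w using TensorProduct.induction_on with
        | zero => simp
        | add s t hs ht => simp only [map_add, TensorProduct.add_tmul, hs, ht]
        | tmul a w =>
          induction w using TensorProduct.induction_on with
          | zero => simp
          | add s t hs ht =>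
            simp only [map_add, TensorProduct.tmul_add, TensorProduct.add_tmul, hs, ht]
          | tmul u c =>
            change M.act ((H.φ U.deg M.deg).symm d₁ * a * t * H.S M.deg
                (H.SInv M.deg⁻¹ (H.p M.deg⁻¹⁻¹ * x₃) * 1 * x₂ * c)) m ⊗ₜ[k] U.act d₂ u =
              M.act ((H.φ U.deg M.deg).symm d₁ * a * t) (M.act (H.S M.deg (x₂ * c) * H.p M.deg)
                (M.act (H.cast (inv_inv M.deg) x₃) m)) ⊗ₜ[k] U.act d₂ u
            simp only [H.S_mul, H.S_SInv, map_mul, H.cast_p, mul_one, Module.End.mul_apply]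

/-- The elements I and J account for the associators before and after the move of H_{l⁻¹}, together
with q and p; the factor Φ⁻¹ in `K` is the associator immediately after this move. What remains is
to discard the conjugations in the constraints of `shuffle`. -/
theorem braidFormula_eq (X : YD H) (M : HRep H) (v : X.rep.V) (m : M.V) :
    X.braidFormula M v m = opInverse X.rep (coactHom X.isYD) M (v ⊗ₜ[k] m) := by
  have h1 : X.braidFormula M v m = actMulS M X.rep.V 1 m (tensorAct (H.reg M.deg)
      (tensorAct X.rep.act (H.reg M.deg⁻¹)) (H.K X.rep.deg M.deg)
      ((1 : H.A M.deg) ⊗ₜ[k] coactMul (X.ρ M.deg⁻¹)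
        (tensorAct (H.reg M.deg⁻¹) X.rep.act (H.I M.deg⁻¹ X.rep.deg)
          ((1 : H.A M.deg⁻¹) ⊗ₜ[k] v)))) := rfl
  rw [h1, actMulS_I, QuasiTuraevCoalgebra.K, map_mul, Module.End.mul_apply, actMulS_J,
    opInverse_tmul]
  refine congrArg (fun z => actMulSwap M X.rep.V (H.q M.deg) (TensorProduct.map LinearMap.id
    (actS M) ((α_ (conjObj X.rep.deg (regular H M.deg) ⊗ X.rep) (regular H M.deg⁻¹) M).hom.lin
      (z ⊗ₜ[k] m)))) ?_
  have h2 := (conjObj_left_associator_hom_lin X.rep.deg (regular H M.deg)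
    (conjObj X.rep.deg (regular H M.deg⁻¹)) X.rep).trans
    (conjObj_middle_associator_hom_lin X.rep.deg (regular H M.deg) (regular H M.deg⁻¹) X.rep)
  have h3 := conjObj_left_associator_inv_lin X.rep.deg (regular H M.deg) X.rep
    (regular H M.deg⁻¹)
  change _ = (α_ (conjObj X.rep.deg (regular H M.deg)) X.rep (regular H M.deg⁻¹)).inv.lin
    (TensorProduct.map LinearMap.id (coactMul (X.ρ M.deg⁻¹))
    ((α_ (conjObj X.rep.deg (regular H M.deg)) (conjObj X.rep.deg (regular H M.deg⁻¹))
      X.rep).hom.lin (((1 : H.A M.deg) ⊗ₜ[k] (1 : H.A M.deg⁻¹)) ⊗ₜ[k] v)))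
  rw [h2, h3]
  rfl

end HRep

/-! ### Moving one or two factors past a tensor product. -/

section MonoidalIdentities

variable {C : Type*} [Category C] [MonoidalCategory C]

/-- The composite `M'' ⊗ (U ⊗ V) → (U ⊗ V) ⊗ M` given by morphisms `M'' ⊗ U → U ⊗ M'` and
`M' ⊗ V → V ⊗ M`. -/
def moveThrough {M'' M' M U V : C} (dU : M'' ⊗ U ⟶ U ⊗ M') (dV : M' ⊗ V ⟶ V ⊗ M) :
    M'' ⊗ (U ⊗ V) ⟶ (U ⊗ V) ⊗ M :=
  (α_ M'' U V).inv ≫ dU ▷ V ≫ (α_ U M' V).hom ≫ U ◁ dV ≫ (α_ U V M).inv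

/-- The composite `(M' ⊗ N') ⊗ U → U ⊗ (M ⊗ N)` given by morphisms `M' ⊗ U → U ⊗ M` and
`N' ⊗ U → U ⊗ N`. -/
def movePair {M' M N' N U : C} (dM : M' ⊗ U ⟶ U ⊗ M) (dN : N' ⊗ U ⟶ U ⊗ N) :
    (M' ⊗ N') ⊗ U ⟶ U ⊗ (M ⊗ N) :=
  (α_ M' N' U).hom ≫ M' ◁ dN ≫ (α_ M' U N).inv ≫ dM ▷ N ≫ (α_ U M N).hom

theorem moveThrough_natural {M'' M' M U V M₁'' M₁' M₁ U₁ V₁ : C} {dU : M'' ⊗ U ⟶ U ⊗ M'}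
    {dV : M' ⊗ V ⟶ V ⊗ M} {dU₁ : M₁'' ⊗ U₁ ⟶ U₁ ⊗ M₁'} {dV₁ : M₁' ⊗ V₁ ⟶ V₁ ⊗ M₁}
    {e'' : M'' ⟶ M₁''} {e' : M' ⟶ M₁'} {e : M ⟶ M₁} {f : U ⟶ U₁} {g : V ⟶ V₁}
    (hU : (e'' ⊗ₘ f) ≫ dU₁ = dU ≫ (f ⊗ₘ e')) (hV : (e' ⊗ₘ g) ≫ dV₁ = dV ≫ (g ⊗ₘ e)) :
    (e'' ⊗ₘ (f ⊗ₘ g)) ≫ moveThrough dU₁ dV₁ = moveThrough dU dV ≫ ((f ⊗ₘ g) ⊗ₘ e) := by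
  unfold moveThrough
  calc _ = (α_ M'' U V).inv ≫ (((e'' ⊗ₘ f) ≫ dU₁) ⊗ₘ g) ≫ (α_ U₁ M₁' V₁).hom ≫ U₁ ◁ dV₁ ≫
        (α_ U₁ V₁ M₁).inv := by
        rw [associator_inv_naturality_assoc, ← tensorHom_id dU₁, tensorHom_comp_tensorHom_assoc,
          Category.comp_id]
    _ = (α_ M'' U V).inv ≫ dU ▷ V ≫ (α_ U M' V).hom ≫ (f ⊗ₘ ((e' ⊗ₘ g) ≫ dV₁)) ≫
        (α_ U₁ V₁ M₁).inv := by
        have : (dU ≫ (f ⊗ₘ e')) ⊗ₘ g = dU ▷ V ≫ ((f ⊗ₘ e') ⊗ₘ g) := by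
          rw [← tensorHom_id, tensorHom_comp_tensorHom, Category.id_comp]
        rw [hU, this, Category.assoc, associator_naturality_assoc, ← id_tensorHom U₁,
          tensorHom_comp_tensorHom_assoc, Category.comp_id]
    _ = _ := by
        have : f ⊗ₘ (dV ≫ (g ⊗ₘ e)) = U ◁ dV ≫ (f ⊗ₘ (g ⊗ₘ e)) := by
          rw [← id_tensorHom, tensorHom_comp_tensorHom, Category.id_comp]
        rw [hV, this]
        simp only [Category.assoc, associator_inv_naturality]

theorem movePair_whiskerRight {M'' M' M N'' N' N U : C} (e : M'' ⟶ M') (e' : N'' ⟶ N')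
    (dM : M' ⊗ U ⟶ U ⊗ M) (dN : N' ⊗ U ⟶ U ⊗ N) :
    movePair (e ▷ U ≫ dM) (e' ▷ U ≫ dN) = (e ⊗ₘ e') ▷ U ≫ movePair dM dN := by
  unfold movePair
  calc _ = (α_ M'' N'' U).hom ≫ M'' ◁ e' ▷ U ≫ (M'' ◁ dN ≫ (α_ M'' U N).inv ≫ e ▷ U ▷ N) ≫
        dM ▷ N ≫ (α_ U M N).hom := by simp
    _ = _ := by
      rw [← associator_inv_naturality_left, whisker_exchange_assoc, MonoidalCategory.tensorHom_def']
      simp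

theorem movePair_unit (M N : C) :
    movePair ((ρ_ M).hom ≫ (λ_ M).inv) ((ρ_ N).hom ≫ (λ_ N).inv) =
      (ρ_ (M ⊗ N)).hom ≫ (λ_ (M ⊗ N)).inv := by
  unfold movePair
  monoidal

theorem moveThrough_whiskerRight {M₁'' M'' M' M U V : C} (e : M₁'' ⟶ M'')
    (dU : M'' ⊗ U ⟶ U ⊗ M') (dV : M' ⊗ V ⟶ V ⊗ M) :
    moveThrough (e ▷ U ≫ dU) dV = e ▷ (U ⊗ V) ≫ moveThrough dU dV := by
  simp [moveThrough]

/-- Up to coherence the two orders of moving a pair past a pair differ only in `dM` and `dN'`, which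
act on disjoint factors and commute by interchange. -/
theorem moveThrough_movePair {M'' M' M N'' N' N U V : C} (dM : M'' ⊗ U ⟶ U ⊗ M')
    (dN : N'' ⊗ U ⟶ U ⊗ N') (dM' : M' ⊗ V ⟶ V ⊗ M) (dN' : N' ⊗ V ⟶ V ⊗ N) :
    moveThrough (movePair dM dN) (movePair dM' dN') =
      movePair (moveThrough dM dM') (moveThrough dN dN') := by
  unfold moveThrough movePair
  calc _ = 𝟙 _ ⊗≫ M'' ◁ dN ▷ V ⊗≫ (dM ▷ (N' ⊗ V) ≫ (U ⊗ M') ◁ dN') ⊗≫ U ◁ dM' ▷ N ⊗≫ 𝟙 _ := by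
        monoidal
    _ = _ := by rw [← whisker_exchange]; monoidal

theorem moveThrough_associator {M₃ M₂ M₁ M U V W : C} (dU : M₃ ⊗ U ⟶ U ⊗ M₂)
    (dV : M₂ ⊗ V ⟶ V ⊗ M₁) (dW : M₁ ⊗ W ⟶ W ⊗ M) :
    moveThrough (moveThrough dU dV) dW ≫ (α_ U V W).hom ▷ M =
      M₃ ◁ (α_ U V W).hom ≫ moveThrough dU (moveThrough dV dW) := by
  unfold moveThrough
  monoidal

theorem moveThrough_leftUnitor {M' M U : C} (dU : M' ⊗ U ⟶ U ⊗ M) :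
    moveThrough ((ρ_ M').hom ≫ (λ_ M').inv) dU ≫ (λ_ U).hom ▷ M = M' ◁ (λ_ U).hom ≫ dU := by
  unfold moveThrough
  monoidal

theorem moveThrough_rightUnitor {M' M U : C} (dU : M' ⊗ U ⟶ U ⊗ M) :
    moveThrough dU ((ρ_ M).hom ≫ (λ_ M).inv) ≫ (ρ_ U).hom ▷ M = M' ◁ (ρ_ U).hom ≫ dU := by
  unfold moveThrough
  monoidal

theorem moveThrough_unit (U V : C) :
    moveThrough ((λ_ U).hom ≫ (ρ_ U).inv) ((λ_ V).hom ≫ (ρ_ V).inv) =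
      (λ_ (U ⊗ V)).hom ≫ (ρ_ (U ⊗ V)).inv := by
  unfold moveThrough
  monoidal

/-- The hypothesis is a Yang-Baxter relation; regrouping it gives the compatibility of `dV` with the
moves past the tensor products on its two sides. -/
theorem moveThrough_braid {M₂ V₁ M₁ U V M M' : C} {x : M₂ ⊗ V₁ ⟶ V₁ ⊗ M₁}
    {dM : M₁ ⊗ U ⟶ U ⊗ M} {dV : V₁ ⊗ U ⟶ U ⊗ V} {dM' : M₂ ⊗ U ⟶ U ⊗ M'} {y : M' ⊗ V ⟶ V ⊗ M}
    (h : x ▷ U ≫ movePair dV dM = movePair dM' dV ≫ U ◁ y) :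
    moveThrough x dM ≫ dV ▷ M = M₂ ◁ dV ≫ moveThrough dM' y := by
  calc _ = (α_ M₂ V₁ U).inv ≫ (x ▷ U ≫ movePair dV dM) ≫ (α_ U V M).inv := by
        simp [moveThrough, movePair]
    _ = _ := by rw [h]; simp [moveThrough, movePair]

end MonoidalIdentities

/-! ### Tensor product, unit, conjugates and morphisms of families. -/

namespace HRep

variable {k : Type u} [Field k] {π : Type v} [Group π] {H : QuasiTuraevCoalgebra k π}

theorem conjObj_right_associator_hom_lin (η : π) (X Y Z : HRep H) :
    (α_ X Y (conjObj η Z)).hom.lin = (α_ X Y Z).hom.lin := by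
  have h := congrArg Hom.lin
    (associator_naturality (conjOneIso X).hom (conjOneIso Y).hom (𝟙 (conjObj η Z)))
  simp only [comp_lin, tensorHom_lin, id_lin, conjOneIso_hom_lin, TensorProduct.map_id] at h
  exact h.trans (conjObj_associator_hom_lin 1 1 η X Y Z)

theorem conjObj_right_associator_inv_lin (η : π) (X Y Z : HRep H) :
    (α_ X Y (conjObj η Z)).inv.lin = (α_ X Y Z).inv.lin := by
  have h := congrArg Hom.lin
    (associator_inv_naturality (conjOneIso X).hom (conjOneIso Y).hom (𝟙 (conjObj η Z)))
  simp only [comp_lin, tensorHom_lin, id_lin, conjOneIso_hom_lin, TensorProduct.map_id] at h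
  exact h.trans (conjObj_associator_inv_lin 1 1 η X Y Z)

/-- A family of morphisms `^U M ⊗ U → U ⊗ M`. -/
abbrev OpFamily (U : HRep H) := ∀ M : HRep H, conjObj U.deg M ⊗ U ⟶ U ⊗ M

/-- Used to identify the values of d on modules that agree up to a canonical isomorphism, such as
^{βγ}M and ^β(^γ M), without rewriting along equalities of objects. -/
theorem IsOpHalfBraiding.lin_eq_of_hom {U : HRep H} {d : OpFamily U} (hd : IsOpHalfBraiding U d)
    {W : Type u} [AddCommGroup W] [Module k W] {l l' : π} {a : H.A l →ₐ[k] Module.End k W}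
    {a' : H.A l' →ₐ[k] Module.End k W} (f : (⟨l, W, a⟩ : HRep H) ⟶ ⟨l', W, a'⟩)
    (hf : f.lin = LinearMap.id) : (d ⟨l', W, a'⟩).lin = (d ⟨l, W, a⟩).lin := by
  have h := congrArg Hom.lin (hd.natural f)
  simp only [comp_lin, whiskerRight_lin, whiskerLeft_lin, hf,
    TensorProduct.map_id] at h
  exact h

/-- The condition on a morphism to commute with two families. -/
def IsCentral {U U' : HRep H} (d : OpFamily U) (d' : OpFamily U') (f : U ⟶ U') : Prop :=
  ∀ M, ((conjCongrIso f.deg_eq M).hom ⊗ₘ f) ≫ d' M = d M ≫ f ▷ M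

theorem isCentral_iff {U U' : HRep H} {d : OpFamily U} {d' : OpFamily U'} {f : U ⟶ U'} :
    IsCentral d d' f ↔ ∀ M, (d' M).lin ∘ₗ TensorProduct.map LinearMap.id f.lin =
      TensorProduct.map f.lin LinearMap.id ∘ₗ (d M).lin :=
  forall_congr' fun _ => ⟨fun h => congrArg Hom.lin h, fun h => hom_ext h⟩

namespace IsCentral

theorem inv {U U' : HRep H} {d : OpFamily U} {d' : OpFamily U'} {e : U ≅ U'}
    (h : IsCentral d d' e.hom) : IsCentral d' d e.inv := by
  intro M
  have h1 : ((conjCongrIso e.inv.deg_eq M).hom ⊗ₘ e.inv) ≫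
      ((conjCongrIso e.hom.deg_eq M).hom ⊗ₘ e.hom) = 𝟙 _ := by
    rw [tensorHom_comp_tensorHom, e.inv_hom_id]
    exact hom_ext TensorProduct.map_id
  rw [← cancel_mono (e.hom ▷ M), Category.assoc, ← h M, reassoc_of% h1, Category.assoc,
    ← comp_whiskerRight, e.inv_hom_id, id_whiskerRight, Category.comp_id]

end IsCentral

/-- The tensor product of two families. -/
def tensorFamily {U V : HRep H} (dU : OpFamily U) (dV : OpFamily V) : OpFamily (U ⊗ V) :=
  fun M => (conjMulIso U.deg V.deg M).hom ▷ (U ⊗ V) ≫ moveThrough (dU (conjObj V.deg M)) (dV M)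

/-- The family on the unit object. -/
def unitFamily : OpFamily (𝟙_ (HRep H)) :=
  fun M => (conjOneIso M).hom ▷ (𝟙_ (HRep H)) ≫ (ρ_ M).hom ≫ (λ_ M).inv

/-- Conjugations do not affect the constraints on vectors, so the linear map can be written with
unconjugated ones. In this form it is comparable with the explicit coaction. -/
theorem tensorFamily_lin {U V : HRep H} (dU : OpFamily U) (dV : OpFamily V) (M : HRep H) :
    (tensorFamily dU dV M).lin = (α_ U V M).inv.lin ∘ₗ
      TensorProduct.map LinearMap.id (dV M).lin ∘ₗ (α_ U M V).hom.lin ∘ₗ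
      TensorProduct.map (dU (conjObj V.deg M)).lin LinearMap.id ∘ₗ (α_ M U V).inv.lin := by
  have h1 : (tensorFamily dU dV M).lin = (α_ U V M).inv.lin ∘ₗ
      TensorProduct.map LinearMap.id (dV M).lin ∘ₗ (α_ U (conjObj V.deg M) V).hom.lin ∘ₗ
      TensorProduct.map (dU (conjObj V.deg M)).lin LinearMap.id ∘ₗ
      (α_ (conjObj U.deg (conjObj V.deg M)) U V).inv.lin ∘ₗ
        TensorProduct.map LinearMap.id LinearMap.id := rfl
  have h2 := (conjObj_left_associator_inv_lin U.deg (conjObj V.deg M) U V).trans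
    (conjObj_left_associator_inv_lin V.deg M U V)
  rw [h1, conjObj_middle_associator_hom_lin, h2, TensorProduct.map_id, LinearMap.comp_id]

theorem unitFamily_lin (M : HRep H) : (unitFamily M).lin =
    (TensorProduct.lid k M.V).symm.toLinearMap ∘ₗ (TensorProduct.rid k M.V).toLinearMap := by
  change ((TensorProduct.lid k M.V).symm.toLinearMap ∘ₗ (TensorProduct.rid k M.V).toLinearMap) ∘ₗ
    TensorProduct.map LinearMap.id LinearMap.id = _
  rw [TensorProduct.map_id, LinearMap.comp_id]

theorem IsOpHalfBraiding.natural_tensorHom {U : HRep H} {d : OpFamily U}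
    (hd : IsOpHalfBraiding U d) {M N : HRep H} (f : M ⟶ N) :
    (conjMap U.deg f ⊗ₘ 𝟙 U) ≫ d N = d M ≫ (𝟙 U ⊗ₘ f) := by
  rw [tensorHom_id, id_tensorHom, hd.natural]

/-- The hexagons of both factors turn the move of M ⊗ N into `moveThrough` of two pairs, and
`moveThrough_movePair` reorders it. The identifications of iterated conjugates are absorbed by
naturality. -/
theorem isOpHalfBraiding_tensorFamily {U V : HRep H} {dU : OpFamily U} {dV : OpFamily V}
    (hU : IsOpHalfBraiding U dU) (hV : IsOpHalfBraiding V dV) :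
    IsOpHalfBraiding (U ⊗ V) (tensorFamily dU dV) where
  natural {M N} f := by
    have h := moveThrough_natural (hU.natural_tensorHom (conjMap V.deg f))
      (hV.natural_tensorHom f)
    rw [id_tensorHom_id, tensorHom_id, id_tensorHom] at h
    simp only [tensorFamily, Category.assoc]
    rw [← h, ← comp_whiskerRight_assoc, ← comp_whiskerRight_assoc]
    rfl
  hexagon M N := by
    have h1 : (((conjTensorIso U.deg (conjObj V.deg M) (conjObj V.deg N)).inv ≫
        conjMap U.deg (conjTensorIso V.deg M N).inv) ⊗ₘ 𝟙 U) ≫ dU (conjObj V.deg (M ⊗ N)) =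
        movePair (dU (conjObj V.deg M)) (dU (conjObj V.deg N)) ≫
          (𝟙 U ⊗ₘ (conjTensorIso V.deg M N).inv) := by
      rw [tensorHom_id, comp_whiskerRight, Category.assoc, hU.natural, id_tensorHom,
        ← Category.assoc, hU.hexagon]
      rfl
    have h2 : ((conjTensorIso V.deg M N).inv ⊗ₘ 𝟙 V) ≫ dV (M ⊗ N) =
        movePair (dV M) (dV N) ≫ (𝟙 V ⊗ₘ 𝟙 (M ⊗ N)) := by
      rw [tensorHom_id, hV.hexagon, id_tensorHom_id, Category.comp_id]
      rfl
    have h3 := moveThrough_natural h1 h2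
    rw [id_tensorHom_id, id_tensorHom_id, Category.comp_id, tensorHom_id,
      moveThrough_movePair] at h3
    change _ = movePair (tensorFamily dU dV M) (tensorFamily dU dV N)
    simp only [tensorFamily]
    rw [movePair_whiskerRight, ← h3, ← comp_whiskerRight_assoc, ← comp_whiskerRight_assoc]
    -- Both sides are now the same composite preceded by canonical isomorphisms between conjugates
    -- of M ⊗ N, all equal to the identity on vectors.
    refine congrArg (fun f => f ▷ (U ⊗ V) ≫
      moveThrough (dU (conjObj V.deg (M ⊗ N))) (dV (M ⊗ N))) (hom_ext ?_)
    simp only [comp_lin, conjTensorIso_inv_lin, conjMulIso_hom_lin, tensorHom_lin,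
      TensorProduct.map_id]
    rfl
  unit := by
    have h1 : ((conjMap U.deg (conjUnitIso V.deg).hom ≫ (conjUnitIso U.deg).hom) ⊗ₘ 𝟙 U) ≫
        (λ_ U).hom ≫ (ρ_ U).inv = dU (conjObj V.deg (𝟙_ (HRep H))) ≫
          (𝟙 U ⊗ₘ (conjUnitIso V.deg).hom) := by
      rw [tensorHom_id, comp_whiskerRight, Category.assoc, ← hU.unit, hU.natural, id_tensorHom]
    have h2 : ((conjUnitIso V.deg).hom ⊗ₘ 𝟙 V) ≫ (λ_ V).hom ≫ (ρ_ V).inv =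
        dV (𝟙_ (HRep H)) ≫ (𝟙 V ⊗ₘ 𝟙 _) := by
      rw [tensorHom_id, hV.unit, id_tensorHom_id, Category.comp_id]
    have h3 := moveThrough_natural h1 h2
    rw [id_tensorHom_id, id_tensorHom_id, Category.comp_id, tensorHom_id,
      moveThrough_unit] at h3
    simp only [tensorFamily]
    rw [← h3, ← comp_whiskerRight_assoc]
    rfl

theorem isOpHalfBraiding_unitFamily : IsOpHalfBraiding (𝟙_ (HRep H)) unitFamily where
  natural {M N} f := by
    refine hom_ext ?_
    rw [comp_lin, comp_lin, unitFamily_lin, unitFamily_lin]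
    refine TensorProduct.ext' fun m c => ?_
    change (1 : k) ⊗ₜ[k] (c • f.lin m) = (1 : k) ⊗ₜ[k] f.lin (c • m)
    rw [map_smul]
  hexagon M N := by
    have h : (ρ_ (M ⊗ N)).hom ≫ (λ_ (M ⊗ N)).inv = movePair ((ρ_ M).hom ≫ (λ_ M).inv)
        ((ρ_ N).hom ≫ (λ_ N).inv) := (movePair_unit M N).symm
    change _ = movePair (unitFamily M) (unitFamily N)
    simp only [unitFamily]
    rw [movePair_whiskerRight, ← h, ← comp_whiskerRight_assoc]
    refine congrArg (fun f => f ▷ (𝟙_ (HRep H)) ≫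
      (ρ_ (M ⊗ N)).hom ≫ (λ_ (M ⊗ N)).inv) (hom_ext ?_)
    simp only [comp_lin, conjTensorIso_inv_lin, conjOneIso_hom_lin, tensorHom_lin,
      TensorProduct.map_id]
    rfl
  unit := by
    refine hom_ext ?_
    rw [unitFamily_lin]
    refine TensorProduct.ext' fun m c => ?_
    change (1 : k) ⊗ₜ[k] (c * m) = (m * c) ⊗ₜ[k] (1 : k)
    rw [← mul_one (c * m), ← smul_eq_mul (c * m), ← TensorProduct.smul_tmul, smul_eq_mul, mul_one,
      mul_comm]

namespace IsCentral

/-- A central g shifts the index of the conjugate from V to V'; naturality of `dU'` is what carries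
this shift past U'. -/
theorem tensorHom {U U' V V' : HRep H} {dU : OpFamily U} {dU' : OpFamily U'} {dV : OpFamily V}
    {dV' : OpFamily V'} {f : U ⟶ U'} {g : V ⟶ V'} (hU' : IsOpHalfBraiding U' dU')
    (hf : IsCentral dU dU' f) (hg : IsCentral dV dV' g) :
    IsCentral (tensorFamily dU dV) (tensorFamily dU' dV') (f ⊗ₘ g) := by
  intro M
  have h1 : (((conjCongrIso f.deg_eq (conjObj V.deg M)).hom ≫
      conjMap U'.deg (conjCongrIso g.deg_eq M).hom) ⊗ₘ f) ≫ dU' (conjObj V'.deg M) =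
      dU (conjObj V.deg M) ≫ (f ⊗ₘ (conjCongrIso g.deg_eq M).hom) := by
    rw [MonoidalCategory.tensorHom_def f, ← reassoc_of% hf (conjObj V.deg M), ← hU'.natural,
      ← tensorHom_id, tensorHom_comp_tensorHom_assoc, Category.comp_id]
  have h2 : ((conjCongrIso g.deg_eq M).hom ⊗ₘ g) ≫ dV' M = dV M ≫ (g ⊗ₘ 𝟙 M) := by
    rw [hg M, tensorHom_id]
  have h3 := moveThrough_natural h1 h2
  simp only [tensorFamily]
  rw [tensorHom_id] at h3
  rw [Category.assoc, ← h3, ← tensorHom_id, ← tensorHom_id, tensorHom_comp_tensorHom_assoc,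
    tensorHom_comp_tensorHom_assoc, Category.comp_id, Category.id_comp]
  rfl

/-- Both families move M past U, V and W in turn. They agree up to coherence and two ways of
identifying the conjugate of M by the product of the three degrees. -/
theorem associator {U V W : HRep H} {dU : OpFamily U} (dV : OpFamily V) (dW : OpFamily W)
    (hU : IsOpHalfBraiding U dU) :
    IsCentral (tensorFamily (tensorFamily dU dV) dW) (tensorFamily dU (tensorFamily dV dW))
      (α_ U V W).hom := by
  intro M
  have h1 := moveThrough_associator (dU (conjObj V.deg (conjObj W.deg M)))
    (dV (conjObj W.deg M)) (dW M)
  have h2 : moveThrough (tensorFamily dU dV (conjObj W.deg M)) (dW M) =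
      (conjMulIso U.deg V.deg (conjObj W.deg M)).hom ▷ ((U ⊗ V) ⊗ W) ≫
      moveThrough (moveThrough (dU (conjObj V.deg (conjObj W.deg M)))
        (dV (conjObj W.deg M))) (dW M) :=
    moveThrough_whiskerRight (conjMulIso U.deg V.deg (conjObj W.deg M)).hom _ (dW M)
  have h3 : (conjMap U.deg (conjMulIso V.deg W.deg M).hom) ▷ (U ⊗ (V ⊗ W)) ≫
      moveThrough (dU (conjObj V.deg (conjObj W.deg M)))
        (moveThrough (dV (conjObj W.deg M)) (dW M)) =
      moveThrough (dU (conjObj (V.deg * W.deg) M)) (tensorFamily dV dW M) := by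
    have := moveThrough_natural (hU.natural_tensorHom (conjMulIso V.deg W.deg M).hom)
      (dV := tensorFamily dV dW M) (dV₁ := moveThrough (dV (conjObj W.deg M)) (dW M))
      (g := 𝟙 _) (e := 𝟙 M) (by
        rw [id_tensorHom_id, Category.comp_id, tensorHom_id]; rfl)
    rw [id_tensorHom_id, id_tensorHom_id, Category.comp_id, tensorHom_id] at this
    exact this
  have h4 : tensorFamily (tensorFamily dU dV) dW M =
      (conjMulIso (U.deg * V.deg) W.deg M).hom ▷ ((U ⊗ V) ⊗ W) ≫
        moveThrough (tensorFamily dU dV (conjObj W.deg M)) (dW M) := rfl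
  have h5 : tensorFamily dU (tensorFamily dV dW) M =
      (conjMulIso U.deg (V.deg * W.deg) M).hom ▷ (U ⊗ (V ⊗ W)) ≫
        moveThrough (dU (conjObj (V.deg * W.deg) M)) (tensorFamily dV dW M) := rfl
  rw [h4, h5, h2, ← h3, Category.assoc, Category.assoc, h1, ← tensorHom_id, ← tensorHom_id,
    ← tensorHom_id, ← tensorHom_id, ← id_tensorHom, tensorHom_comp_tensorHom_assoc,
    tensorHom_comp_tensorHom_assoc, tensorHom_comp_tensorHom_assoc,
    tensorHom_comp_tensorHom_assoc]
  refine congrArg (fun f => f ≫ moveThrough (dU (conjObj V.deg (conjObj W.deg M)))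
        (moveThrough (dV (conjObj W.deg M)) (dW M))) (hom_ext ?_)
  rfl

theorem leftUnitor {U : HRep H} (dU : OpFamily U) :
    IsCentral (tensorFamily unitFamily dU) dU (λ_ U).hom := by
  intro M
  have h1 := moveThrough_leftUnitor (dU M)
  have h2 : tensorFamily unitFamily dU M = ((conjMulIso 1 U.deg M).hom ≫
      (conjOneIso (conjObj U.deg M)).hom) ▷ (𝟙_ (HRep H) ⊗ U) ≫ moveThrough
        ((ρ_ (conjObj U.deg M)).hom ≫ (λ_ (conjObj U.deg M)).inv) (dU M) := by
    rw [comp_whiskerRight, Category.assoc, ← moveThrough_whiskerRight]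
    rfl
  rw [h2, Category.assoc, h1, ← tensorHom_id, ← id_tensorHom, tensorHom_comp_tensorHom_assoc]
  refine congrArg (fun f => f ≫ dU M) (hom_ext ?_)
  rfl

theorem rightUnitor {U : HRep H} {dU : OpFamily U} (hU : IsOpHalfBraiding U dU) :
    IsCentral (tensorFamily dU unitFamily) dU (ρ_ U).hom := by
  intro M
  have h1 := moveThrough_rightUnitor (dU M)
  have h2 : (conjMap U.deg (conjOneIso M).hom) ▷ (U ⊗ 𝟙_ (HRep H)) ≫
      moveThrough (dU M) ((ρ_ M).hom ≫ (λ_ M).inv) =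
      moveThrough (dU (conjObj 1 M)) (unitFamily M) := by
    have := moveThrough_natural (hU.natural_tensorHom (conjOneIso M).hom)
      (dV := unitFamily M) (dV₁ := (ρ_ M).hom ≫ (λ_ M).inv)
      (g := 𝟙 _) (e := 𝟙 M) (by
        rw [id_tensorHom_id, Category.comp_id, tensorHom_id]; rfl)
    rw [id_tensorHom_id, id_tensorHom_id, Category.comp_id, tensorHom_id] at this
    exact this
  have h3 : tensorFamily dU unitFamily M = (conjMulIso U.deg 1 M).hom ▷ (U ⊗ 𝟙_ (HRep H)) ≫
    moveThrough (dU (conjObj 1 M)) (unitFamily M) := rfl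
  rw [h3, ← h2, Category.assoc, Category.assoc, h1, ← tensorHom_id, ← tensorHom_id,
    ← id_tensorHom, tensorHom_comp_tensorHom_assoc, tensorHom_comp_tensorHom_assoc]
  refine congrArg (fun f => f ≫ dU M) (hom_ext ?_)
  rfl

end IsCentral

/-- The hexagon with all conjugations removed, which is legitimate on the level of linear maps;
`isOpHalfBraiding_of_lin` is the converse passage. -/
theorem IsOpHalfBraiding.hexagon_lin {U : HRep H} {d : OpFamily U} (hd : IsOpHalfBraiding U d)
    (M N : HRep H) : (d (M ⊗ N)).lin = (α_ U M N).hom.lin ∘ₗ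
      TensorProduct.map (d M).lin LinearMap.id ∘ₗ (α_ M U N).inv.lin ∘ₗ
      TensorProduct.map LinearMap.id (d N).lin ∘ₗ (α_ M N U).hom.lin := by
  have h : (d (M ⊗ N)).lin ∘ₗ TensorProduct.map LinearMap.id LinearMap.id =
      (α_ U M N).hom.lin ∘ₗ TensorProduct.map (d M).lin LinearMap.id ∘ₗ
      (α_ (conjObj U.deg M) U N).inv.lin ∘ₗ TensorProduct.map LinearMap.id (d N).lin ∘ₗ
      (α_ (conjObj U.deg M) (conjObj U.deg N) U).hom.lin := congrArg Hom.lin (hd.hexagon M N)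
  have h1 := (conjObj_left_associator_hom_lin U.deg M (conjObj U.deg N) U).trans
    (conjObj_middle_associator_hom_lin U.deg M N U)
  rwa [TensorProduct.map_id, LinearMap.comp_id, conjObj_left_associator_inv_lin, h1] at h

theorem isOpHalfBraiding_of_lin {U : HRep H} {d : OpFamily U}
    (natural : ∀ {M N : HRep H} (f : M ⟶ N), (d N).lin ∘ₗ TensorProduct.map f.lin LinearMap.id =
      TensorProduct.map LinearMap.id f.lin ∘ₗ (d M).lin)
    (hexagon : ∀ M N : HRep H, (d (M ⊗ N)).lin = (α_ U M N).hom.lin ∘ₗ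
      TensorProduct.map (d M).lin LinearMap.id ∘ₗ (α_ M U N).inv.lin ∘ₗ
      TensorProduct.map LinearMap.id (d N).lin ∘ₗ (α_ M N U).hom.lin)
    (unit : (d (𝟙_ (HRep H))).lin = (TensorProduct.rid k U.V).symm.toLinearMap ∘ₗ
      (TensorProduct.lid k U.V).toLinearMap) : IsOpHalfBraiding U d where
  natural f := hom_ext (natural f)
  hexagon M N := by
    refine hom_ext ?_
    change (d (M ⊗ N)).lin ∘ₗ TensorProduct.map LinearMap.id LinearMap.id =
      (α_ U M N).hom.lin ∘ₗ TensorProduct.map (d M).lin LinearMap.id ∘ₗ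
      (α_ (conjObj U.deg M) U N).inv.lin ∘ₗ TensorProduct.map LinearMap.id (d N).lin ∘ₗ
      (α_ (conjObj U.deg M) (conjObj U.deg N) U).hom.lin
    have h1 := (conjObj_left_associator_hom_lin U.deg M (conjObj U.deg N) U).trans
      (conjObj_middle_associator_hom_lin U.deg M N U)
    rw [TensorProduct.map_id, LinearMap.comp_id, conjObj_left_associator_inv_lin, h1, hexagon]
  unit := by
    refine hom_ext (unit.trans ?_)
    change _ = ((TensorProduct.rid k U.V).symm.toLinearMap ∘ₗ
      (TensorProduct.lid k U.V).toLinearMap) ∘ₗ TensorProduct.map LinearMap.id LinearMap.id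
    rw [TensorProduct.map_id, LinearMap.comp_id]

theorem IsOpHalfBraiding.unit_lin {U : HRep H} {d : OpFamily U} (hd : IsOpHalfBraiding U d) :
    (d (𝟙_ (HRep H))).lin = (TensorProduct.rid k U.V).symm.toLinearMap ∘ₗ
      (TensorProduct.lid k U.V).toLinearMap := by
  refine (congrArg Hom.lin hd.unit).trans ?_
  change ((TensorProduct.rid k U.V).symm.toLinearMap ∘ₗ
      (TensorProduct.lid k U.V).toLinearMap) ∘ₗ TensorProduct.map LinearMap.id LinearMap.id = _
  rw [TensorProduct.map_id, LinearMap.comp_id]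

/-- The conjugate of a family. -/
def conjFamily (β : π) {U : HRep H} (d : OpFamily U) : OpFamily (conjObj β U) := fun M =>
  { deg_eq := show β * U.deg * β⁻¹ * M.deg * (β * U.deg * β⁻¹)⁻¹ * (β * U.deg * β⁻¹) =
      β * U.deg * β⁻¹ * M.deg by group
    lin := (d (conjObj β⁻¹ M)).lin
    comm := by
      -- Linearity is not checked on elements: the conjugated morphism, composed with canonical
      -- isomorphisms that are the identity on vectors, is a morphism with the required underlying
      -- linear map.
      let e : conjObj β (conjObj β⁻¹ M) ⟶ M := (conjMulIso β β⁻¹ M).inv ≫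
        (conjCongrIso (mul_inv_cancel β) M).hom ≫ (conjOneIso M).hom
      let f : conjObj (conjObj β U).deg M ⊗ conjObj β U ⟶ conjObj β U ⊗ M :=
        ((conjMulIso (β * U.deg) β⁻¹ M).hom ≫ (conjMulIso β U.deg (conjObj β⁻¹ M)).hom) ▷
          conjObj β U ≫ (conjTensorIso β (conjObj U.deg (conjObj β⁻¹ M)) U).inv ≫
          conjMap β (d (conjObj β⁻¹ M)) ≫ (conjTensorIso β U (conjObj β⁻¹ M)).hom ≫
          conjObj β U ◁ e
      have h : f.lin = (d (conjObj β⁻¹ M)).lin := by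
        change TensorProduct.map LinearMap.id LinearMap.id ∘ₗ (d (conjObj β⁻¹ M)).lin ∘ₗ
          TensorProduct.map LinearMap.id LinearMap.id = _
        rw [TensorProduct.map_id, TensorProduct.map_id]; rfl
      rw [← h]
      exact f.comm }

theorem conjFamily_lin (β : π) {U : HRep H} (d : OpFamily U) (M : HRep H) :
    (conjFamily β d M).lin = (d (conjObj β⁻¹ M)).lin := rfl

theorem isOpHalfBraiding_conjFamily (β : π) {U : HRep H} {d : OpFamily U}
    (hd : IsOpHalfBraiding U d) : IsOpHalfBraiding (conjObj β U) (conjFamily β d) := by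
  refine isOpHalfBraiding_of_lin (fun f => congrArg Hom.lin (hd.natural (conjMap β⁻¹ f)))
    (fun M N => ?_) ?_
  · have h1 : (d (conjObj β⁻¹ (M ⊗ N))).lin = (d (conjObj β⁻¹ M ⊗ conjObj β⁻¹ N)).lin :=
      hd.lin_eq_of_hom (conjTensorIso β⁻¹ M N).inv rfl
    have h2 : (α_ (conjObj β U) M N).hom.lin = (α_ U (conjObj β⁻¹ M) (conjObj β⁻¹ N)).hom.lin := by
      refine (conjObj_left_associator_hom_lin β U M N).trans ?_
      exact ((conjObj_middle_associator_hom_lin β⁻¹ U M (conjObj β⁻¹ N)).trans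
        (conjObj_right_associator_hom_lin β⁻¹ U M N)).symm
    have h3 : (α_ M (conjObj β U) N).inv.lin = (α_ (conjObj β⁻¹ M) U (conjObj β⁻¹ N)).inv.lin := by
      refine (conjObj_middle_associator_inv_lin β M U N).trans ?_
      exact ((conjObj_left_associator_inv_lin β⁻¹ M U (conjObj β⁻¹ N)).trans
        (conjObj_right_associator_inv_lin β⁻¹ M U N)).symm
    have h4 : (α_ M N (conjObj β U)).hom.lin = (α_ (conjObj β⁻¹ M) (conjObj β⁻¹ N) U).hom.lin := by
      refine (conjObj_right_associator_hom_lin β M N U).trans ?_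
      exact ((conjObj_left_associator_hom_lin β⁻¹ M (conjObj β⁻¹ N) U).trans
        (conjObj_middle_associator_hom_lin β⁻¹ M N U)).symm
    rw [h2, h3, h4]
    exact h1.trans (hd.hexagon_lin (conjObj β⁻¹ M) (conjObj β⁻¹ N))
  · have h1 : (d (conjObj β⁻¹ (𝟙_ (HRep H)))).lin = (d (𝟙_ (HRep H))).lin :=
      hd.lin_eq_of_hom (conjUnitIso β⁻¹).inv rfl
    exact h1.trans hd.unit_lin

theorem IsCentral.conj (β : π) {U U' : HRep H} {d : OpFamily U} {d' : OpFamily U'} {f : U ⟶ U'}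
    (h : IsCentral d d' f) : IsCentral (conjFamily β d) (conjFamily β d') (conjMap β f) :=
  isCentral_iff.2 fun M => isCentral_iff.1 h (conjObj β⁻¹ M)

theorem conjFamily_one_lin {U : HRep H} {d : OpFamily U} (hd : IsOpHalfBraiding U d)
    (M : HRep H) : (conjFamily 1 d M).lin = (d M).lin :=
  hd.lin_eq_of_hom ((conjOneIso M).inv ≫ (conjCongrIso inv_one.symm M).hom) rfl

theorem conjFamily_mul_lin (β γ : π) {U : HRep H} {d : OpFamily U} (hd : IsOpHalfBraiding U d)
    (M : HRep H) : (conjFamily (β * γ) d M).lin = (conjFamily β (conjFamily γ d) M).lin :=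
  hd.lin_eq_of_hom ((conjMulIso γ⁻¹ β⁻¹ M).inv ≫ (conjCongrIso (mul_inv_rev β γ).symm M).hom) rfl

theorem conjFamily_unit_lin (β : π) (M : HRep H) :
    (conjFamily β unitFamily M).lin = (unitFamily M).lin := by
  rw [conjFamily_lin, unitFamily_lin, unitFamily_lin]

theorem conjFamily_tensor_lin (β : π) {U V : HRep H} {dU : OpFamily U} (dV : OpFamily V)
    (hU : IsOpHalfBraiding U dU) (M : HRep H) :
    (conjFamily β (tensorFamily dU dV) M).lin =
      (tensorFamily (conjFamily β dU) (conjFamily β dV) M).lin := by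
  -- The two iterated conjugates agree because β⁻¹ (β γ β⁻¹) = γ β⁻¹, with γ the degree of V.
  have h1 : (dU (conjObj V.deg (conjObj β⁻¹ M))).lin =
      (dU (conjObj β⁻¹ (conjObj (β * V.deg * β⁻¹) M))).lin :=
    hU.lin_eq_of_hom ((conjMulIso β⁻¹ (β * V.deg * β⁻¹) M).inv ≫ (conjCongrIso
      (show β⁻¹ * (β * V.deg * β⁻¹) = V.deg * β⁻¹ by group) M).hom ≫
        (conjMulIso V.deg β⁻¹ M).hom) rfl
  have h2 : (α_ (conjObj β U) (conjObj β V) M).inv.lin = (α_ U V (conjObj β⁻¹ M)).inv.lin := by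
    refine (conjObj_left_associator_inv_lin β U (conjObj β V) M).trans ?_
    exact (conjObj_middle_associator_inv_lin β U V M).trans
      (conjObj_right_associator_inv_lin β⁻¹ U V M).symm
  have h3 : (α_ (conjObj β U) M (conjObj β V)).hom.lin = (α_ U (conjObj β⁻¹ M) V).hom.lin := by
    refine (conjObj_left_associator_hom_lin β U M (conjObj β V)).trans ?_
    exact (conjObj_right_associator_hom_lin β U M V).trans
      (conjObj_middle_associator_hom_lin β⁻¹ U M V).symm
  have h4 : (α_ M (conjObj β U) (conjObj β V)).inv.lin = (α_ (conjObj β⁻¹ M) U V).inv.lin := by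
    refine (conjObj_middle_associator_inv_lin β M U (conjObj β V)).trans ?_
    exact (conjObj_right_associator_inv_lin β M U V).trans
      (conjObj_left_associator_inv_lin β⁻¹ M U V).symm
  rw [conjFamily_lin, tensorFamily_lin, tensorFamily_lin, h2, h3, h4, h1]
  rfl

/-- The members of a family are compatible with the families on their source and target. -/
theorem isCentral_braid {U V : HRep H} {dU : OpFamily U} {dV : OpFamily V}
    (hU : IsOpHalfBraiding U dU) (hV : IsOpHalfBraiding V dV) :
    IsCentral (tensorFamily (conjFamily U.deg dV) dU) (tensorFamily dU dV) (dU V) := by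
  intro M
  let x : conjObj U.deg (conjObj V.deg M) ⊗ conjObj U.deg V ⟶ conjObj U.deg V ⊗ conjObj U.deg M :=
    (conjTensorIso U.deg (conjObj V.deg M) V).inv ≫ conjMap U.deg (dV M) ≫
      (conjTensorIso U.deg V M).hom
  -- The Yang-Baxter relation: the hexagon of `dU` for both orders of the pair, linked by naturality
  -- of `dU` along the morphism `dV M`.
  have h1 : x ▷ U ≫ movePair (dU V) (dU M) =
      movePair (dU (conjObj V.deg M)) (dU V) ≫ U ◁ dV M := by
    have h2 : movePair (dU V) (dU M) = (conjTensorIso U.deg V M).inv ▷ U ≫ dU (V ⊗ M) :=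
      (hU.hexagon V M).symm
    have h3 : movePair (dU (conjObj V.deg M)) (dU V) =
        (conjTensorIso U.deg (conjObj V.deg M) V).inv ▷ U ≫ dU (conjObj V.deg M ⊗ V) :=
      (hU.hexagon (conjObj V.deg M) V).symm
    rw [h2, h3, Category.assoc, ← hU.natural, ← comp_whiskerRight_assoc, ← comp_whiskerRight_assoc]
    simp only [x, Category.assoc, Iso.hom_inv_id, Category.comp_id]
  have h2 := moveThrough_braid h1
  let w : conjObj (U.deg * V.deg * U.deg⁻¹) (conjObj U.deg M) ⟶ conjObj U.deg (conjObj V.deg M) :=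
    (conjMulIso (U.deg * V.deg * U.deg⁻¹) U.deg M).inv ≫ (conjCongrIso
      (show U.deg * V.deg * U.deg⁻¹ * U.deg = U.deg * V.deg by group) M).hom ≫
      (conjMulIso U.deg V.deg M).hom
  -- The conjugation by the inverse degree inside `conjFamily` cancels the one on M, leaving the
  -- linear map of `dV M`.
  have h3 : conjFamily U.deg dV (conjObj U.deg M) = w ▷ conjObj U.deg V ≫ x := by
    refine hom_ext ?_
    have h4 : (dV (conjObj U.deg⁻¹ (conjObj U.deg M))).lin = (dV M).lin :=
      hV.lin_eq_of_hom ((conjOneIso M).inv ≫ (conjCongrIso (inv_mul_cancel U.deg).symm M).hom ≫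
        (conjMulIso U.deg⁻¹ U.deg M).hom) rfl
    change _ = (dV M).lin ∘ₗ TensorProduct.map LinearMap.id LinearMap.id
    rw [TensorProduct.map_id, LinearMap.comp_id]
    exact h4
  have h4 : tensorFamily (conjFamily U.deg dV) dU M =
      (conjMulIso (U.deg * V.deg * U.deg⁻¹) U.deg M).hom ▷ (conjObj U.deg V ⊗ U) ≫
        w ▷ (conjObj U.deg V ⊗ U) ≫ moveThrough x (dU M) := by
    rw [← moveThrough_whiskerRight, ← h3]; rfl
  rw [h4, Category.assoc, Category.assoc, h2, tensorFamily, ← tensorHom_id, ← tensorHom_id,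
    ← tensorHom_id, ← id_tensorHom, tensorHom_comp_tensorHom_assoc,
    tensorHom_comp_tensorHom_assoc, tensorHom_comp_tensorHom_assoc]
  refine congrArg (fun f => f ≫ moveThrough (dU (conjObj V.deg M)) (dV M)) (hom_ext ?_)
  rfl

/-! ### Half-braidings and their inverses. -/

theorem hexagon_iso_iff {U : HRep H} (c : ∀ M : HRep H, U ⊗ M ≅ conjObj U.deg M ⊗ U)
    (M N : HRep H) :
    (conjTensorIso U.deg M N).inv ▷ U ≫ (c (M ⊗ N)).inv =
      (α_ (conjObj U.deg M) (conjObj U.deg N) U).hom ≫ conjObj U.deg M ◁ (c N).inv ≫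
        (α_ (conjObj U.deg M) U N).inv ≫ (c M).inv ▷ N ≫ (α_ U M N).hom ↔
    (c (M ⊗ N)).hom ≫ (conjTensorIso U.deg M N).hom ▷ U =
      (α_ U M N).inv ≫ (c M).hom ▷ N ≫ (α_ (conjObj U.deg M) U N).hom ≫
        conjObj U.deg M ◁ (c N).hom ≫ (α_ (conjObj U.deg M) (conjObj U.deg N) U).inv := by
  let e₁ := c (M ⊗ N) ≪≫ whiskerRightIso (conjTensorIso U.deg M N) U
  let e₂ := (α_ U M N).symm ≪≫ whiskerRightIso (c M) N ≪≫ α_ (conjObj U.deg M) U N ≪≫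
    whiskerLeftIso (conjObj U.deg M) (c N) ≪≫ (α_ (conjObj U.deg M) (conjObj U.deg N) U).symm
  have h1 : e₁.inv = e₂.inv ↔ e₁.hom = e₂.hom :=
    ⟨fun h => congrArg Iso.hom (Iso.ext_inv h), fun h => congrArg Iso.inv (Iso.ext h)⟩
  have h2 : e₂.inv = (α_ (conjObj U.deg M) (conjObj U.deg N) U).hom ≫
      conjObj U.deg M ◁ (c N).inv ≫ (α_ (conjObj U.deg M) U N).inv ≫ (c M).inv ▷ N ≫
        (α_ U M N).hom := by
    simp [e₂]
  rw [← h2]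
  exact h1

theorem isHalfBraiding_of_inv {U : HRep H} {c : ∀ M : HRep H, U ⊗ M ≅ conjObj U.deg M ⊗ U}
    (h : IsOpHalfBraiding U (fun M => (c M).inv)) : IsHalfBraiding (crossed H) U c where
  natural {M N} f := by
    change (c M).hom ≫ conjMap U.deg f ▷ U = U ◁ f ≫ (c N).hom
    rw [← cancel_mono (c N).inv, Category.assoc, h.natural f]
    simp
  hexagon M N := by
    have h1 := congrArg Hom.lin ((hexagon_iso_iff c M N).1 (h.hexagon M N))
    -- The equality of objects and the isomorphism `conjTensorIso` are both the identity on vectors,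
    -- so the heterogeneous hexagon is the ordinary one on linear maps.
    refine hom_heq rfl (congrArg (tensor · U) (conjObj_tensor U.deg M N)) (heq_of_eq ?_)
    refine Eq.trans ?_ h1
    change _ = TensorProduct.map LinearMap.id LinearMap.id ∘ₗ (c (M ⊗ N)).hom.lin
    rw [TensorProduct.map_id]
    rfl

theorem hexagon_of_isHalfBraiding {U : HRep H} {c : ∀ M : HRep H, U ⊗ M ≅ conjObj U.deg M ⊗ U}
    (h : IsHalfBraiding (crossed H) U c) (M N : HRep H) :
    (conjTensorIso U.deg M N).inv ▷ U ≫ (c (M ⊗ N)).inv =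
      (α_ (conjObj U.deg M) (conjObj U.deg N) U).hom ≫ conjObj U.deg M ◁ (c N).inv ≫
        (α_ (conjObj U.deg M) U N).inv ≫ (c M).inv ▷ N ≫ (α_ U M N).hom := by
  refine (hexagon_iso_iff c M N).2 (hom_ext ?_)
  have h1 := eq_of_heq (lin_heq_of_heq rfl (congrArg (tensor · U) (conjObj_tensor U.deg M N))
    (h.hexagon M N))
  refine Eq.trans ?_ h1
  change TensorProduct.map LinearMap.id LinearMap.id ∘ₗ (c (M ⊗ N)).hom.lin = _
  rw [TensorProduct.map_id]
  rfl

theorem natural_of_isHalfBraiding {U : HRep H} {c : ∀ M : HRep H, U ⊗ M ≅ conjObj U.deg M ⊗ U}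
    (h : IsHalfBraiding (crossed H) U c) {M N : HRep H} (f : M ⟶ N) :
    conjMap U.deg f ▷ U ≫ (c N).inv = (c M).inv ≫ U ◁ f := by
  rw [← cancel_epi (c M).hom, ← Category.assoc]
  have h1 : (c M).hom ≫ conjMap U.deg f ▷ U = U ◁ f ≫ (c N).hom := h.natural f
  rw [h1]
  simp

theorem isInvariant_unit : IsInvariant (𝟙_ (HRep H)) (1 : k) := ⟨𝟙 _, rfl⟩

/-- For a half-braiding the value at the unit object is the canonical one. -/
theorem unit_of_isHalfBraiding {U : HRep H} {c : ∀ M : HRep H, U ⊗ M ≅ conjObj U.deg M ⊗ U}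
    (h : IsHalfBraiding (crossed H) U c) (v : U.V) :
    (c (𝟙_ (HRep H))).inv.lin ((1 : k) ⊗ₜ[k] v) = v ⊗ₜ[k] (1 : k) := by
  let I := 𝟙_ (HRep H)
  -- Since I is one-dimensional, the inverse half-braiding at I is encoded by an endomorphism g,
  -- injective because c_I is invertible.
  let g : U.V →ₗ[k] U.V := (TensorProduct.rid k U.V).toLinearMap ∘ₗ (c I).inv.lin ∘ₗ
    (TensorProduct.lid k U.V).symm.toLinearMap
  have hg : ∀ w : U.V, (c I).inv.lin ((1 : k) ⊗ₜ[k] w) = g w ⊗ₜ[k] (1 : k) := fun w =>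
    ((TensorProduct.rid k U.V).symm_apply_apply ((c I).inv.lin ((1 : k) ⊗ₜ[k] w))).symm
  have hinj : Function.Injective g := by
    refine fun x y hxy => ?_
    have h1 := congrArg (fun z => (c I).hom.lin (z ⊗ₜ[k] (1 : k))) hxy
    have h2 : ∀ w, (c I).hom.lin (g w ⊗ₜ[k] (1 : k)) = (1 : k) ⊗ₜ[k] w := fun w => by
      rw [← hg]; exact inv_hom_lin_apply (c I) _
    have h3 : (1 : k) ⊗ₜ[k] x = (1 : k) ⊗ₜ[k] y := (h2 x).symm.trans (h1.trans (h2 y))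
    have h4 := congrArg (TensorProduct.lid k U.V) h3
    simpa using h4
  have hI := isInvariant_unit (H := H)
  -- The hexagon at I ⊗ I moves v past I twice, and hence applies g twice; the constraints are
  -- trivial on invariant vectors.
  have h1 : (c (I ⊗ I)).inv.lin (((1 : k) ⊗ₜ[k] (1 : k)) ⊗ₜ[k] v) =
      g (g v) ⊗ₜ[k] ((1 : k) ⊗ₜ[k] (1 : k)) := by
    have h2 := LinearMap.congr_fun (congrArg Hom.lin (hexagon_of_isHalfBraiding h I I))
      (((1 : k) ⊗ₜ[k] (1 : k)) ⊗ₜ[k] v)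
    refine Eq.trans ?_ (h2.trans ?_)
    · change _ = (c (I ⊗ I)).inv.lin (TensorProduct.map LinearMap.id LinearMap.id
        (((1 : k) ⊗ₜ[k] (1 : k)) ⊗ₜ[k] v))
      rfl
    · have h3 : (α_ (conjObj U.deg I) (conjObj U.deg I) U).hom.lin
          (((1 : k) ⊗ₜ[k] (1 : k)) ⊗ₜ[k] v) = (1 : k) ⊗ₜ[k] ((1 : k) ⊗ₜ[k] v) :=
        (hI.conj U.deg).associator_middle (conjObj U.deg I) U (1 : k) v
      have h4 : (α_ (conjObj U.deg I) U I).inv.lin ((1 : k) ⊗ₜ[k] (g v ⊗ₜ[k] (1 : k))) =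
          ((1 : k) ⊗ₜ[k] g v) ⊗ₜ[k] (1 : k) :=
        hI.associator_right (conjObj U.deg I) U (1 : k) (g v)
      have h5 : (α_ U I I).hom.lin ((g (g v) ⊗ₜ[k] (1 : k)) ⊗ₜ[k] (1 : k)) =
          g (g v) ⊗ₜ[k] ((1 : k) ⊗ₜ[k] (1 : k)) :=
        hI.associator_middle U I (g (g v)) (1 : k)
      change (α_ U I I).hom.lin (TensorProduct.map (c I).inv.lin LinearMap.id
        ((α_ (conjObj U.deg I) U I).inv.lin (TensorProduct.map LinearMap.id (c I).inv.lin
          ((α_ (conjObj U.deg I) (conjObj U.deg I) U).hom.lin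
            (((1 : k) ⊗ₜ[k] (1 : k)) ⊗ₜ[k] v))))) = _
      refine Eq.trans ?_ h5
      refine congrArg (α_ U I I).hom.lin ?_
      refine (congrArg (fun z => TensorProduct.map (c I).inv.lin LinearMap.id
        ((α_ (conjObj U.deg I) U I).inv.lin (TensorProduct.map LinearMap.id (c I).inv.lin z)))
          h3).trans ?_
      refine (congrArg (fun z => TensorProduct.map (c I).inv.lin LinearMap.id
        ((α_ (conjObj U.deg I) U I).inv.lin ((1 : k) ⊗ₜ[k] z))) (hg v)).trans ?_
      refine (congrArg (TensorProduct.map (c I).inv.lin LinearMap.id) h4).trans ?_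
      exact congrArg (fun z => z ⊗ₜ[k] (1 : k)) (hg (g v))
  -- Naturality along I ⊗ I ≅ I gives g ∘ g = g, and an injective idempotent is the identity.
  have h2 := LinearMap.congr_fun (congrArg Hom.lin (natural_of_isHalfBraiding h (λ_ I).hom))
    (((1 : k) ⊗ₜ[k] (1 : k)) ⊗ₜ[k] v)
  have h3 : (c I).inv.lin ((1 : k) ⊗ₜ[k] v) = g (g v) ⊗ₜ[k] (1 : k) := by
    refine Eq.trans ?_ (h2.trans ((congrArg (U ◁ (λ_ I).hom).lin h1).trans ?_))
    · change _ = (c I).inv.lin ((TensorProduct.lid k k ((1 : k) ⊗ₜ[k] (1 : k))) ⊗ₜ[k] v)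
      rw [TensorProduct.lid_tmul, one_smul]
    · change g (g v) ⊗ₜ[k] (TensorProduct.lid k k ((1 : k) ⊗ₜ[k] (1 : k))) = _
      rw [TensorProduct.lid_tmul, one_smul]
  rw [hg] at h3
  have h4 : g v = v := by
    have := congrArg (TensorProduct.rid k U.V) h3
    rw [TensorProduct.rid_tmul, TensorProduct.rid_tmul, one_smul, one_smul] at this
    exact (hinj this).symm
  exact (hg v).trans (congrArg (fun w => w ⊗ₜ[k] (1 : k)) h4)

theorem isOpHalfBraiding_inv {U : HRep H} {c : ∀ M : HRep H, U ⊗ M ≅ conjObj U.deg M ⊗ U}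
    (h : IsHalfBraiding (crossed H) U c) : IsOpHalfBraiding U (fun M => (c M).inv) where
  natural := natural_of_isHalfBraiding h
  hexagon := hexagon_of_isHalfBraiding h
  unit := by
    refine hom_ext (TensorProduct.ext' fun a v => ?_)
    change (c (𝟙_ (HRep H))).inv.lin ((a : k) ⊗ₜ[k] v) = (a • v) ⊗ₜ[k] (1 : k)
    have h1 : (a : k) ⊗ₜ[k] v = (1 : k) ⊗ₜ[k] (a • v) := by
      rw [← TensorProduct.smul_tmul, smul_eq_mul, mul_one]
    exact (congrArg (c (𝟙_ (HRep H))).inv.lin h1).trans (unit_of_isHalfBraiding h (a • v))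

end HRep

theorem square_inv_iff {C : Type*} [Category C] {X Y X' Y' : C} (e : X ≅ Y) (e' : X' ≅ Y')
    (f : Y ⟶ Y') (g : X ⟶ X') : f ≫ e'.inv = e.inv ≫ g ↔ e.hom ≫ f = g ≫ e'.hom := by
  rw [← cancel_epi e.hom, ← cancel_mono e'.hom]
  simp

/-! ### The center of `Rep(H)` as a braided crossed T-category. -/

namespace CrossedCenter

open HRep

variable {k : Type u} [Field k] {π : Type v} [Group π] {H : QuasiTuraevCoalgebra k π}

/-- The inverses of the half-braiding of an object of the center. -/
def family (Z : CrossedCenter (crossed H)) : OpFamily Z.obj := fun M => (Z.c M).inv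

theorem isOpHalfBraiding (Z : CrossedCenter (crossed H)) : IsOpHalfBraiding Z.obj Z.family :=
  isOpHalfBraiding_inv Z.isHalfBraiding

theorem ext_of_lin {Z Z' : CrossedCenter (crossed H)} (h : Z.obj = Z'.obj)
    (hc : ∀ M, HEq (Z.family M).lin (Z'.family M).lin) : Z = Z' := by
  obtain ⟨U, c, hU⟩ := Z
  obtain ⟨U', c', hU'⟩ := Z'
  obtain rfl : U = U' := h
  obtain rfl : c = c' := funext fun M => Iso.ext_inv (hom_ext (eq_of_heq (hc M)))
  rfl

theorem isCentral_iff_comm {Z Z' : CrossedCenter (crossed H)} (f : Z.obj ⟶ Z'.obj) :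
    IsCentral Z.family Z'.family f ↔ ∀ X : HRep H,
      HEq ((Z.c X).hom ≫ (conjObj Z.obj.deg X) ◁ f) (f ▷ X ≫ (Z'.c X).hom) := by
  refine forall_congr' fun M => ?_
  have hY : conjObj Z.obj.deg M ⊗ Z'.obj = conjObj Z'.obj.deg M ⊗ Z'.obj := by rw [f.deg_eq]
  refine (square_inv_iff (Z.c M) (Z'.c M) ((conjCongrIso f.deg_eq M).hom ⊗ₘ f) (f ▷ M)).trans ?_
  constructor
  · intro h
    exact hom_heq rfl hY (heq_of_eq (congrArg Hom.lin h))
  · intro h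
    exact hom_ext (eq_of_heq (lin_heq_of_heq rfl hY h))

/-- A morphism of the center from a morphism that commutes with the inverse half-braidings. -/
def homMk {Z Z' : CrossedCenter (crossed H)} (f : Z.obj ⟶ Z'.obj)
    (h : IsCentral Z.family Z'.family f) : Z ⟶ Z' :=
  ⟨f, (isCentral_iff_comm f).1 h⟩

theorem isCentral_hom {Z Z' : CrossedCenter (crossed H)} (f : Z ⟶ Z') :
    IsCentral Z.family Z'.family f.hom := (isCentral_iff_comm f.hom).2 f.comm

theorem hom_heq_of_lin {X X' Y Y' : CrossedCenter (crossed H)} (hX : X = X') (hY : Y = Y')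
    {f : X ⟶ Y} {g : X' ⟶ Y'} (h : HEq f.hom.lin g.hom.lin) : HEq f g := by
  subst hX hY
  exact heq_of_eq (Hom.ext (HRep.hom_ext (eq_of_heq h)))

/-- The isomorphism of the center from an isomorphism that commutes with the inverse
half-braidings. -/
def isoMk {Z Z' : CrossedCenter (crossed H)} (e : Z.obj ≅ Z'.obj)
    (h : IsCentral Z.family Z'.family e.hom) : Z ≅ Z' where
  hom := homMk e.hom h
  inv := homMk e.inv h.inv
  hom_inv_id := Hom.ext e.hom_inv_id
  inv_hom_id := Hom.ext e.inv_hom_id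

end CrossedCenter

namespace HRep

variable {k : Type u} [Field k] {π : Type v} [Group π] {H : QuasiTuraevCoalgebra k π}

/-- Half-braidings are compared through their inverses, which are the maps with a simple
description. -/
theorem hom_heq_of_inv_lin {X X' Y Y' : HRep H} (hX : X = X') (hY : Y = Y') (e : X ≅ Y)
    (e' : X' ≅ Y') (h : HEq e.inv.lin e'.inv.lin) : HEq e.hom e'.hom := by
  subst hX hY
  obtain rfl : e = e' := Iso.ext_inv (hom_ext (eq_of_heq h))
  rfl

end HRep

namespace CrossedCenter

open HRep

variable {k : Type u} [Field k] {π : Type v} [Group π] {H : QuasiTuraevCoalgebra k π}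

/-- The object of the center with given inverse half-braiding. -/
def ofFamily (U : HRep H) (d : OpFamily U) (hd : IsOpHalfBraiding U d) :
    CrossedCenter (crossed H) :=
  ⟨U, hd.iso, isHalfBraiding_of_inv (c := hd.iso) hd⟩

/-- The tensor product of objects of the center. -/
abbrev tensor (Z Z' : CrossedCenter (crossed H)) : CrossedCenter (crossed H) :=
  ofFamily (Z.obj ⊗ Z'.obj) (tensorFamily Z.family Z'.family)
    (isOpHalfBraiding_tensorFamily Z.isOpHalfBraiding Z'.isOpHalfBraiding)

/-- The tensor product of morphisms of the center. -/
abbrev tensorMap {Z₁ Z₁' Z₂ Z₂' : CrossedCenter (crossed H)} (f : Z₁ ⟶ Z₁') (g : Z₂ ⟶ Z₂') :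
    tensor Z₁ Z₂ ⟶ tensor Z₁' Z₂' :=
  homMk (f.hom ⊗ₘ g.hom) ((isCentral_hom f).tensorHom Z₁'.isOpHalfBraiding (isCentral_hom g))

instance : MonoidalCategoryStruct (CrossedCenter (crossed H)) where
  tensorObj := tensor
  tensorUnit := ofFamily (𝟙_ (HRep H)) unitFamily isOpHalfBraiding_unitFamily
  tensorHom := tensorMap
  whiskerLeft Z _ _ f := tensorMap (𝟙 Z) f
  whiskerRight f Z := tensorMap f (𝟙 Z)
  associator Z₁ Z₂ Z₃ := isoMk (α_ Z₁.obj Z₂.obj Z₃.obj)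
    (IsCentral.associator Z₂.family Z₃.family Z₁.isOpHalfBraiding)
  leftUnitor Z := isoMk (λ_ Z.obj) (IsCentral.leftUnitor Z.family)
  rightUnitor Z := isoMk (ρ_ Z.obj) (IsCentral.rightUnitor Z.isOpHalfBraiding)

/-- A morphism of the center is determined by its underlying morphism, so each axiom is inherited
from `Rep(H)`. -/
instance : MonoidalCategory (CrossedCenter (crossed H)) :=
  MonoidalCategory.ofTensorHom
    (id_tensorHom_id := fun Z Z' => Hom.ext (id_tensorHom_id Z.obj Z'.obj))
    (id_tensorHom := fun _ _ _ _ => rfl)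
    (tensorHom_id := fun _ _ => rfl)
    (tensorHom_comp_tensorHom := fun f₁ f₂ g₁ g₂ =>
      Hom.ext (tensorHom_comp_tensorHom f₁.hom f₂.hom g₁.hom g₂.hom))
    (associator_naturality := fun f₁ f₂ f₃ =>
      Hom.ext (associator_naturality f₁.hom f₂.hom f₃.hom))
    (leftUnitor_naturality := fun f => Hom.ext (leftUnitor_naturality f.hom))
    (rightUnitor_naturality := fun f => Hom.ext (rightUnitor_naturality f.hom))
    (pentagon := fun Z₁ Z₂ Z₃ Z₄ => Hom.ext (pentagon Z₁.obj Z₂.obj Z₃.obj Z₄.obj))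
    (triangle := fun Z₁ Z₂ => Hom.ext (triangle Z₁.obj Z₂.obj))

/-- The conjugation functors of the center. -/
abbrev conjFunctor (β : π) : CrossedCenter (crossed H) ⥤ CrossedCenter (crossed H) where
  obj Z := ofFamily (conjObj β Z.obj) (conjFamily β Z.family)
    (isOpHalfBraiding_conjFamily β Z.isOpHalfBraiding)
  map f := homMk (conjMap β f.hom) ((isCentral_hom f).conj β)
  map_id Z := Hom.ext ((HRep.conjFunctor β).map_id Z.obj)
  map_comp f g := Hom.ext ((HRep.conjFunctor β).map_comp f.hom g.hom)

theorem conjFunctor_unit (β : π) : (conjFunctor β).obj (𝟙_ (CrossedCenter (crossed H))) =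
    𝟙_ (CrossedCenter (crossed H)) :=
  ext_of_lin (conjObj_unit β) fun M => heq_of_eq (conjFamily_unit_lin β M)

theorem conjFunctor_tensor (β : π) (Z Z' : CrossedCenter (crossed H)) :
    (conjFunctor β).obj (Z ⊗ Z') = (conjFunctor β).obj Z ⊗ (conjFunctor β).obj Z' :=
  ext_of_lin (conjObj_tensor β Z.obj Z'.obj) fun M =>
    heq_of_eq (conjFamily_tensor_lin β Z'.family Z.isOpHalfBraiding M)

theorem conjFunctor_one (Z : CrossedCenter (crossed H)) : (conjFunctor 1).obj Z = Z :=
  ext_of_lin (conjObj_one Z.obj) fun M => heq_of_eq (conjFamily_one_lin Z.isOpHalfBraiding M)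

theorem conjFunctor_mul (β γ : π) (Z : CrossedCenter (crossed H)) :
    (conjFunctor (β * γ)).obj Z = (conjFunctor β).obj ((conjFunctor γ).obj Z) :=
  ext_of_lin (conjObj_mul β γ Z.obj) fun M =>
    heq_of_eq (conjFamily_mul_lin β γ Z.isOpHalfBraiding M)

theorem conjFunctor_strict (β : π) :
    IsStrictMonoidal (conjFunctor (H := H) β) where
  obj_unit := conjFunctor_unit β
  obj_tensor := conjFunctor_tensor β
  map_tensor {X X' Y Y'} _ _ :=
    hom_heq_of_lin (conjFunctor_tensor β X Y) (conjFunctor_tensor β X' Y') HEq.rfl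
  map_associator X Y Z :=
    hom_heq_of_lin ((conjFunctor_tensor β (X ⊗ Y) Z).trans
        (congrArg (· ⊗ (conjFunctor β).obj Z) (conjFunctor_tensor β X Y)))
      ((conjFunctor_tensor β X (Y ⊗ Z)).trans
        (congrArg ((conjFunctor β).obj X ⊗ ·) (conjFunctor_tensor β Y Z)))
      (heq_of_eq (conj_assoc_lin β X.obj Y.obj Z.obj))
  map_leftUnitor X :=
    hom_heq_of_lin ((conjFunctor_tensor β (𝟙_ _) X).trans
      (congrArg (· ⊗ (conjFunctor β).obj X) (conjFunctor_unit β))) rfl HEq.rfl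
  map_rightUnitor X :=
    hom_heq_of_lin ((conjFunctor_tensor β X (𝟙_ _)).trans
      (congrArg ((conjFunctor β).obj X ⊗ ·) (conjFunctor_unit β))) rfl HEq.rfl

/-- The center of `Rep(H)` as a crossed T-category. -/
def crossedCategory (H : QuasiTuraevCoalgebra k π) :
    CrossedCategory π (CrossedCenter (crossed H)) where
  deg Z := Z.obj.deg
  deg_eq_of_hom f := f.hom.deg_eq
  deg_tensor _ _ := rfl
  conj := conjFunctor
  conj_strict := conjFunctor_strict
  conj_one := CategoryTheory.Functor.hext conjFunctor_one
    fun X Y _ => hom_heq_of_lin (conjFunctor_one X) (conjFunctor_one Y) HEq.rfl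
  conj_mul β γ := CategoryTheory.Functor.hext (conjFunctor_mul β γ)
    fun X Y _ => hom_heq_of_lin (conjFunctor_mul β γ X) (conjFunctor_mul β γ Y) HEq.rfl
  deg_conj _ _ := rfl

/-- The right side is the forward direction of an isomorphism `e` whose inverse is `moveThrough`; it
differs from `tensorFamily` only by the identification of the two forms of the iterated conjugate.
-/
theorem tensor_c_heq (Z Z' : CrossedCenter (crossed H)) (W : HRep H) :
    HEq ((Z ⊗ Z').c W).hom
      ((α_ Z.obj Z'.obj W).hom ≫ Z.obj ◁ (Z'.c W).hom ≫
        (α_ Z.obj (conjObj Z'.obj.deg W) Z'.obj).inv ≫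
        (Z.c (conjObj Z'.obj.deg W)).hom ▷ Z'.obj ≫
        (α_ (conjObj Z.obj.deg (conjObj Z'.obj.deg W)) Z.obj Z'.obj).hom) := by
  let U := Z.obj
  let V := Z'.obj
  let cU : ∀ M, U ⊗ M ≅ conjObj U.deg M ⊗ U := Z.c
  let cV : ∀ M, V ⊗ M ≅ conjObj V.deg M ⊗ V := Z'.c
  let e : (U ⊗ V) ⊗ W ≅ conjObj U.deg (conjObj V.deg W) ⊗ (U ⊗ V) := α_ U V W ≪≫
    whiskerLeftIso U (cV W) ≪≫ (α_ U (conjObj V.deg W) V).symm ≪≫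
    whiskerRightIso (cU (conjObj V.deg W)) V ≪≫ α_ (conjObj U.deg (conjObj V.deg W)) U V
  have he : e.inv = moveThrough (Z.family (conjObj V.deg W)) (Z'.family W) := by
    simp [e, moveThrough]; rfl
  refine hom_heq_of_inv_lin rfl (congrArg (HRep.tensor · (U ⊗ V)) (conjObj_mul U.deg V.deg W))
    ((Z ⊗ Z').c W) e (heq_of_eq ?_)
  rw [he]
  change (moveThrough (Z.family (conjObj V.deg W)) (Z'.family W)).lin ∘ₗ
    TensorProduct.map LinearMap.id LinearMap.id = _
  rw [TensorProduct.map_id]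
  rfl

/-- The braiding of the center. -/
def braidIso (Z Z' : CrossedCenter (crossed H)) : Z ⊗ Z' ≅ (conjFunctor Z.obj.deg).obj Z' ⊗ Z :=
  (isoMk (Z := (conjFunctor Z.obj.deg).obj Z' ⊗ Z) (Z' := Z ⊗ Z') (Z.c Z'.obj).symm
    (isCentral_braid Z.isOpHalfBraiding Z'.isOpHalfBraiding)).symm

/-- Naturality in the first variable is centrality of f, in the second it is naturality of the
family. -/
theorem braidIso_natural {X X' Y Y' : CrossedCenter (crossed H)} (f : X ⟶ X') (g : Y ⟶ Y') :
    TensorProduct.map g.hom.lin f.hom.lin ∘ₗ (X.c Y.obj).hom.lin =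
      (X'.c Y'.obj).hom.lin ∘ₗ TensorProduct.map f.hom.lin g.hom.lin := by
  have h1 : (((conjCongrIso f.hom.deg_eq Y.obj).hom ≫ conjMap X'.obj.deg g.hom) ⊗ₘ f.hom) ≫
      X'.family Y'.obj = X.family Y.obj ≫ (f.hom ⊗ₘ g.hom) := by
    have h2 := isCentral_hom f Y.obj
    rw [MonoidalCategory.tensorHom_def f.hom, ← Category.assoc, ← h2, Category.assoc,
      ← X'.isOpHalfBraiding.natural, ← tensorHom_id, tensorHom_comp_tensorHom_assoc,
      Category.comp_id]
  exact congrArg HRep.Hom.lin ((square_inv_iff (X.c Y.obj) (X'.c Y'.obj) _ _).1 h1)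

/-- The braided crossed T-category structure of the center of `Rep(H)`. -/
def braiding (H : QuasiTuraevCoalgebra k π) : CrossedBraiding (crossedCategory H) where
  c := braidIso
  natural {X X' Y Y'} f g := by
    have hY : (conjFunctor X.obj.deg).obj Y' ⊗ X' = (conjFunctor X'.obj.deg).obj Y' ⊗ X' := by
      rw [f.hom.deg_eq]
    exact hom_heq_of_lin rfl hY (heq_of_eq (braidIso_natural f g))
  hexagon_right X Y Z :=
    hom_heq_of_lin rfl (congrArg (· ⊗ X) (conjFunctor_tensor X.obj.deg Y Z))
      (lin_heq_of_heq rfl (congrArg (HRep.tensor · X.obj) (conjObj_tensor X.obj.deg Y.obj Z.obj))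
        (X.isHalfBraiding.hexagon Y.obj Z.obj))
  hexagon_left X Y Z :=
    hom_heq_of_lin rfl (congrArg (· ⊗ (X ⊗ Y)) (conjFunctor_mul X.obj.deg Y.obj.deg Z))
      (lin_heq_of_heq rfl (congrArg (HRep.tensor · (X.obj ⊗ Y.obj))
        (conjObj_mul X.obj.deg Y.obj.deg Z.obj)) (tensor_c_heq X Y Z.obj))
  conj_c β X Y := by
    -- With α the degree of X, both sides are the conjugate by β α = (β α β⁻¹) β.
    have h1 : (conjFunctor β).obj ((conjFunctor X.obj.deg).obj Y) =
        (conjFunctor (β * X.obj.deg * β⁻¹)).obj ((conjFunctor β).obj Y) := by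
      rw [← conjFunctor_mul, ← conjFunctor_mul, inv_mul_cancel_right]
    have h2 : conjObj β (conjObj X.obj.deg Y.obj) =
        conjObj (β * X.obj.deg * β⁻¹) (conjObj β Y.obj) := congrArg CrossedCenter.obj h1
    refine hom_heq_of_lin (conjFunctor_tensor β X Y) ((conjFunctor_tensor β _ X).trans
      (congrArg (· ⊗ (conjFunctor β).obj X) h1)) ?_
    refine lin_heq_of_heq (conjObj_tensor β X.obj Y.obj)
      ((conjObj_tensor β (conjObj X.obj.deg Y.obj) X.obj).trans
      (congrArg (HRep.tensor · (conjObj β X.obj)) h2)) (hom_heq_of_inv_lin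
      (conjObj_tensor β X.obj Y.obj) ((conjObj_tensor β (conjObj X.obj.deg Y.obj) X.obj).trans
      (congrArg (HRep.tensor · (conjObj β X.obj)) h2))
      ((HRep.conjFunctor β).mapIso (X.c Y.obj))
      (((conjFunctor β).obj X).c (conjObj β Y.obj)) (heq_of_eq ?_))
    exact (X.isOpHalfBraiding.lin_eq_of_hom ((conjOneIso Y.obj).inv ≫
      (conjCongrIso (inv_mul_cancel β).symm Y.obj).hom ≫ (conjMulIso β⁻¹ β Y.obj).hom) rfl).symm

theorem isCenterStructure : IsCenterStructure (crossedCategory H) (braiding H) where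
  tensor_obj Z Z' := ⟨_, _, rfl, tensor_c_heq Z Z'⟩
  unit_obj := by
    refine ⟨_, _, rfl, fun X => hom_heq_of_inv_lin rfl
      (congrArg (HRep.tensor · HRep.unit) (conjObj_one X)) _ (λ_ X ≪≫ (ρ_ X).symm)
      (heq_of_eq (unitFamily_lin X))⟩
  forget_strict :=
    { obj_unit := rfl
      obj_tensor := fun _ _ => rfl
      map_tensor := fun _ _ => HEq.rfl
      map_associator := fun _ _ _ => HEq.rfl
      map_leftUnitor := fun _ => HEq.rfl
      map_rightUnitor := fun _ => HEq.rfl }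
  deg_obj _ := rfl
  conj_obj β Z := by
    refine ⟨_, _, rfl, fun X => hom_heq_of_inv_lin ?_ ?_ _
      ((HRep.conjFunctor β).mapIso (Z.c (conjObj β⁻¹ X))) HEq.rfl⟩
    · have h : conjObj β (conjObj β⁻¹ X) = X := by
        rw [← conjObj_mul, mul_inv_cancel, conjObj_one]
      exact ((conjObj_tensor β Z.obj (conjObj β⁻¹ X)).trans
        (congrArg (HRep.tensor (conjObj β Z.obj)) h)).symm
    · have h : conjObj β (conjObj Z.obj.deg (conjObj β⁻¹ X)) =
          conjObj (β * Z.obj.deg * β⁻¹) X := by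
        rw [← conjObj_mul, ← conjObj_mul, mul_assoc]
      exact ((conjObj_tensor β (conjObj Z.obj.deg (conjObj β⁻¹ X)) Z.obj).trans
        (congrArg (HRep.tensor · (conjObj β Z.obj)) h)).symm
  conj_forget _ := rfl
  braiding _ _ := HEq.rfl

end CrossedCenter

/-! ### `YD(H)` as a crossed T-category. -/

namespace YD

open HRep

variable {k : Type u} [Field k] {π : Type v} [Group π] {H : QuasiTuraevCoalgebra k π}

/-- The morphisms `m ⊗ v ↦ v₀ ⊗ v₁ m` for a Yetter-Drinfeld module. -/
def family (X : YD H) : OpFamily X.rep := coactHom X.isYD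

theorem isOpHalfBraiding (X : YD H) : IsOpHalfBraiding X.rep X.family :=
  isOpHalfBraiding_coactHom X.isYD

/-- The coaction given by a family of morphisms `^U M ⊗ U → U ⊗ M`. -/
def familyCoact {U : HRep H} (d : OpFamily U) (l : π) : U.V →ₗ[k] U.V ⊗[k] H.A l :=
  (d (regular H l)).lin ∘ₗ TensorProduct.mk k (H.A l) U.V 1

theorem familyCoact_family (X : YD H) : familyCoact X.family = X.ρ :=
  funext fun l => LinearMap.ext fun v => coactOn_regular_one X.ρ l v

/-- With `family_mk_of_eq`, this avoids verifying the Yetter-Drinfeld axioms for explicit coactions: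
it is enough to recognize them as coming from a family already known to be an inverse half-braiding.
-/
theorem isYD_of_eq {U : HRep H} {d : OpFamily U} (hd : IsOpHalfBraiding U d)
    {ρ : ∀ l : π, U.V →ₗ[k] U.V ⊗[k] H.A l} (h : ∀ l, ρ l = familyCoact d l) : IsYD U ρ := by
  obtain rfl : ρ = familyCoact d := funext h
  exact hd.isYD

theorem family_mk_of_eq {U : HRep H} {d : OpFamily U} (hd : IsOpHalfBraiding U d)
    {ρ : ∀ l : π, U.V →ₗ[k] U.V ⊗[k] H.A l} (h : ∀ l, ρ l = familyCoact d l) (hρ : IsYD U ρ) :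
    family ⟨U, ρ, hρ⟩ = d := by
  obtain rfl : ρ = familyCoact d := funext h
  exact funext fun M => HRep.hom_ext (hd.lin_eq_coactOn M).symm

theorem ext_of_lin {X Y : YD H} (h : X.rep = Y.rep)
    (hc : ∀ M, HEq (X.family M).lin (Y.family M).lin) : X = Y := by
  have h1 := familyCoact_family X
  have h2 := familyCoact_family Y
  obtain ⟨U, ρ, hU⟩ := X
  obtain ⟨U', ρ', hU'⟩ := Y
  obtain rfl : U = U' := h
  have h3 : family ⟨U, ρ, hU⟩ = family ⟨U, ρ', hU'⟩ :=
    funext fun M => HRep.hom_ext (eq_of_heq (hc M))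
  obtain rfl : ρ = ρ' := h1.symm.trans ((congrArg familyCoact h3).trans h2)
  rfl

theorem hom_heq_of_lin {X X' Y Y' : YD H} (hX : X = X') (hY : Y = Y')
    {f : X ⟶ Y} {g : X' ⟶ Y'} (h : HEq f.hom.lin g.hom.lin) : HEq f g := by
  subst hX hY
  exact heq_of_eq (Hom.ext (HRep.hom_ext (eq_of_heq h)))

theorem isCentral_iff_comm {X Y : YD H} (f : X.rep ⟶ Y.rep) :
    IsCentral X.family Y.family f ↔
      ∀ (l : π) (v : X.rep.V), Y.ρ l (f.lin v) = TensorProduct.map f.lin LinearMap.id (X.ρ l v) := by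
  rw [isCentral_iff]
  constructor
  · intro h l v
    refine (coactOn_regular_one Y.ρ l (f.lin v)).symm.trans ?_
    refine (LinearMap.congr_fun (h (regular H l)) ((1 : H.A l) ⊗ₜ[k] v)).trans ?_
    exact congrArg (TensorProduct.map f.lin LinearMap.id) (coactOn_regular_one X.ρ l v)
  · intro h M
    refine TensorProduct.ext' fun m v => ?_
    change coactOn Y.ρ M (m ⊗ₜ[k] f.lin v) =
      TensorProduct.map f.lin LinearMap.id (coactOn X.ρ M (m ⊗ₜ[k] v))
    rw [coactOn_tmul, coactOn_tmul, h]
    generalize X.ρ M.deg v = y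
    induction y using TensorProduct.induction_on with
    | zero => simp only [map_zero]
    | add s t hs ht => simp only [map_add, hs, ht]
    | tmul w b => rfl

/-- A morphism of Yetter-Drinfeld modules from a morphism that commutes with the families. -/
def homMk {X Y : YD H} (f : X.rep ⟶ Y.rep) (h : IsCentral X.family Y.family f) : X ⟶ Y :=
  ⟨f, (isCentral_iff_comm f).1 h⟩

theorem isCentral_hom {X Y : YD H} (f : X ⟶ Y) : IsCentral X.family Y.family f.hom :=
  (isCentral_iff_comm f.hom).2 f.comm

/-- An isomorphism of Yetter-Drinfeld modules from one that commutes with the families. -/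
def isoMk {X Y : YD H} (e : X.rep ≅ Y.rep) (h : IsCentral X.family Y.family e.hom) : X ≅ Y where
  hom := homMk e.hom h
  inv := homMk e.inv h.inv
  hom_inv_id := Hom.ext e.hom_inv_id
  inv_hom_id := Hom.ext e.inv_hom_id

/-- The conjugated regular module is acted on through the inverse crossing, which is the source of
φ_{β⁻¹} in the tensor product coaction. -/
theorem coactOn_conj_regular (β : π) {U : HRep H} (ρ : ∀ l : π, U.V →ₗ[k] U.V ⊗[k] H.A l) (l : π) :
    coactOn ρ (conjObj β (regular H l)) = coactMul (TensorProduct.map LinearMap.id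
      (H.φ β l).symm.toLinearMap ∘ₗ ρ (β * l * β⁻¹)) := by
  refine TensorProduct.ext' fun m v => ?_
  change H.A l at m
  refine (coactOn_tmul ρ (conjObj β (regular H l)) m v).trans ?_
  refine Eq.trans ?_ (coactMul_tmul (TensorProduct.map LinearMap.id
      (H.φ β l).symm.toLinearMap ∘ₗ ρ (β * l * β⁻¹)) m v).symm
  change TensorProduct.map LinearMap.id _ (ρ (β * l * β⁻¹) v) = TensorProduct.map LinearMap.id
    (LinearMap.mulRight k m) (TensorProduct.map LinearMap.id _ (ρ (β * l * β⁻¹) v))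
  generalize ρ (β * l * β⁻¹) v = y
  induction y using TensorProduct.induction_on with
  | zero => simp only [map_zero]
  | add s t hs ht => simp only [map_add, hs, ht]
  | tmul w b => rfl

/-- The three actions of Φ⁻¹, Φ, Φ⁻¹ in the formula are the three associators in `tensorFamily_lin`
at the regular module. -/
theorem tensorCoact_eq (X Y : YD H) (l : π) :
    tensorCoact X Y l = familyCoact (tensorFamily X.family Y.family) l := by
  have h1 : (X.family (conjObj Y.rep.deg (regular H l))).lin =
      coactMul (TensorProduct.map LinearMap.id (H.φ Y.rep.deg l).symm.toLinearMap ∘ₗ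
        X.ρ (Y.rep.deg * l * Y.rep.deg⁻¹)) := coactOn_conj_regular Y.rep.deg X.ρ l
  have h2 := tensorFamily_lin X.family Y.family (regular H l)
  rw [h1] at h2
  exact (congrArg (· ∘ₗ TensorProduct.mk k (H.A l) (X.rep.V ⊗[k] Y.rep.V) 1) h2).symm

theorem unitCoact_eq (l : π) : unitCoact H l = familyCoact unitFamily l := by
  refine LinearMap.ext fun c => ?_
  refine Eq.trans ?_ (LinearMap.congr_fun (unitFamily_lin (regular H l))
    ((1 : H.A l) ⊗ₜ[k] (c : k))).symm
  change c ⊗ₜ[k] (algebraMap k (H.A l) 1) = (1 : k) ⊗ₜ[k] (c • (1 : H.A l))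
  rw [map_one, ← TensorProduct.smul_tmul, smul_eq_mul, mul_one]

theorem conjCoact_eq (β : π) (X : YD H) (l : π) :
    conjCoact β X l = familyCoact (conjFamily β X.family) l := by
  refine LinearMap.ext fun v => ?_
  refine Eq.trans ?_ (coactOn_tmul X.ρ (conjObj β⁻¹ (regular H l)) (1 : H.A l) v).symm
  -- The family uses the conjugate by β⁻¹, whose degree contains β⁻¹⁻¹ where the coaction has β;
  -- generalizing this occurrence allows the substitution.
  have h : ∀ (γ : π) (hγ : β = γ) (e : γ * (β⁻¹ * l * γ) * γ⁻¹ = l),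
      TensorProduct.map LinearMap.id
        ((H.cast (show β * (β⁻¹ * l * β) * β⁻¹ = l by group)).toLinearMap ∘ₗ
          (H.φ β (β⁻¹ * l * β)).toLinearMap) (X.ρ (β⁻¹ * l * β) v) =
      TensorProduct.map LinearMap.id ((H.cast e).toLinearMap ∘ₗ
          (H.φ γ (β⁻¹ * l * γ)).toLinearMap) (X.ρ (β⁻¹ * l * γ) v) := by
    intro γ hγ e; subst hγ; rfl
  refine (h β⁻¹⁻¹ (inv_inv β).symm (by group)).trans ?_
  change TensorProduct.map LinearMap.id _ (X.ρ (β⁻¹ * l * β⁻¹⁻¹) v) =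
    TensorProduct.map LinearMap.id _ (X.ρ (β⁻¹ * l * β⁻¹⁻¹) v)
  refine congrArg (fun f => TensorProduct.map LinearMap.id f (X.ρ (β⁻¹ * l * β⁻¹⁻¹) v)) ?_
  refine LinearMap.ext fun b => ?_
  change H.cast _ (H.φ β⁻¹⁻¹ (β⁻¹ * l * β⁻¹⁻¹) b) = (H.φ β⁻¹ l).symm b * 1
  exact ((mul_one _).trans (QuasiTuraevCoalgebra.φ_symm_eq β⁻¹ l b)).symm

/-- The tensor product of Yetter-Drinfeld modules. -/
abbrev tensor (X Y : YD H) : YD H :=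
  ⟨X.rep ⊗ Y.rep, tensorCoact X Y, isYD_of_eq
    (isOpHalfBraiding_tensorFamily X.isOpHalfBraiding Y.isOpHalfBraiding) (tensorCoact_eq X Y)⟩

/-- The unit Yetter-Drinfeld module. -/
abbrev unit (H : QuasiTuraevCoalgebra k π) : YD H :=
  ⟨𝟙_ (HRep H), unitCoact H, isYD_of_eq isOpHalfBraiding_unitFamily unitCoact_eq⟩

/-- The conjugate of a Yetter-Drinfeld module. -/
abbrev conjYD (β : π) (X : YD H) : YD H :=
  ⟨conjObj β X.rep, conjCoact β X, isYD_of_eq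
    (isOpHalfBraiding_conjFamily β X.isOpHalfBraiding) (conjCoact_eq β X)⟩

theorem family_tensor (X Y : YD H) :
    family (tensor X Y) = tensorFamily X.family Y.family :=
  family_mk_of_eq (isOpHalfBraiding_tensorFamily X.isOpHalfBraiding Y.isOpHalfBraiding)
    (tensorCoact_eq X Y) _

theorem family_unit : family (unit H) = unitFamily :=
  family_mk_of_eq isOpHalfBraiding_unitFamily unitCoact_eq _

theorem family_conj (β : π) (X : YD H) : family (conjYD β X) = conjFamily β X.family :=
  family_mk_of_eq (isOpHalfBraiding_conjFamily β X.isOpHalfBraiding) (conjCoact_eq β X) _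

/-- The tensor product of morphisms of Yetter-Drinfeld modules. -/
abbrev tensorMap {X X' Y Y' : YD H} (f : X ⟶ X') (g : Y ⟶ Y') : tensor X Y ⟶ tensor X' Y' :=
  homMk (f.hom ⊗ₘ g.hom) (by
    rw [family_tensor, family_tensor]
    exact (isCentral_hom f).tensorHom X'.isOpHalfBraiding (isCentral_hom g))

instance : MonoidalCategoryStruct (YD H) where
  tensorObj := tensor
  tensorUnit := unit H
  tensorHom := tensorMap
  whiskerLeft Z _ _ f := tensorMap (𝟙 Z) f
  whiskerRight f Z := tensorMap f (𝟙 Z)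
  associator X Y Z := isoMk (α_ X.rep Y.rep Z.rep) (by
    rw [family_tensor, family_tensor, family_tensor, family_tensor]
    exact IsCentral.associator Y.family Z.family X.isOpHalfBraiding)
  leftUnitor X := isoMk (λ_ X.rep) (by
    rw [family_tensor, family_unit]
    exact IsCentral.leftUnitor X.family)
  rightUnitor X := isoMk (ρ_ X.rep) (by
    rw [family_tensor, family_unit]
    exact IsCentral.rightUnitor X.isOpHalfBraiding)

instance : MonoidalCategory (YD H) :=
  MonoidalCategory.ofTensorHom
    (id_tensorHom_id := fun X Y => Hom.ext (id_tensorHom_id X.rep Y.rep))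
    (id_tensorHom := fun _ _ _ _ => rfl)
    (tensorHom_id := fun _ _ => rfl)
    (tensorHom_comp_tensorHom := fun f₁ f₂ g₁ g₂ =>
      Hom.ext (tensorHom_comp_tensorHom f₁.hom f₂.hom g₁.hom g₂.hom))
    (associator_naturality := fun f₁ f₂ f₃ =>
      Hom.ext (associator_naturality f₁.hom f₂.hom f₃.hom))
    (leftUnitor_naturality := fun f => Hom.ext (leftUnitor_naturality f.hom))
    (rightUnitor_naturality := fun f => Hom.ext (rightUnitor_naturality f.hom))
    (pentagon := fun X₁ X₂ X₃ X₄ => Hom.ext (pentagon X₁.rep X₂.rep X₃.rep X₄.rep))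
    (triangle := fun X₁ X₂ => Hom.ext (triangle X₁.rep X₂.rep))

/-- The conjugation functors of `YD(H)`. -/
abbrev conjFunctor (β : π) : YD H ⥤ YD H where
  obj := conjYD β
  map f := homMk (conjMap β f.hom) (by
    rw [family_conj, family_conj]
    exact (isCentral_hom f).conj β)
  map_id X := Hom.ext ((HRep.conjFunctor β).map_id X.rep)
  map_comp f g := Hom.ext ((HRep.conjFunctor β).map_comp f.hom g.hom)

theorem conjYD_unit (β : π) : conjYD β (𝟙_ (YD H)) = 𝟙_ (YD H) :=
  ext_of_lin (conjObj_unit β) fun M => heq_of_eq (by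
    rw [family_conj]
    change (conjFamily β (unit H).family M).lin = ((unit H).family M).lin
    rw [family_unit]
    exact conjFamily_unit_lin β M)

theorem conjYD_tensor (β : π) (X Y : YD H) :
    conjYD β (X ⊗ Y) = conjYD β X ⊗ conjYD β Y :=
  ext_of_lin (conjObj_tensor β X.rep Y.rep) fun M => heq_of_eq (by
    rw [family_conj]
    change (conjFamily β (tensor X Y).family M).lin =
      ((tensor (conjYD β X) (conjYD β Y)).family M).lin
    rw [family_tensor, family_tensor, family_conj, family_conj]
    exact conjFamily_tensor_lin β Y.family X.isOpHalfBraiding M)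

theorem conjYD_one (X : YD H) : conjYD 1 X = X :=
  ext_of_lin (conjObj_one X.rep) fun M => heq_of_eq (by
    rw [family_conj]
    exact conjFamily_one_lin X.isOpHalfBraiding M)

theorem conjYD_mul (β γ : π) (X : YD H) : conjYD (β * γ) X = conjYD β (conjYD γ X) :=
  ext_of_lin (conjObj_mul β γ X.rep) fun M => heq_of_eq (by
    rw [family_conj, family_conj, family_conj]
    exact conjFamily_mul_lin β γ X.isOpHalfBraiding M)

theorem conjFunctor_strict (β : π) : IsStrictMonoidal (conjFunctor (H := H) β) where
  obj_unit := conjYD_unit β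
  obj_tensor := conjYD_tensor β
  map_tensor {X X' Y Y'} _ _ :=
    hom_heq_of_lin (conjYD_tensor β X Y) (conjYD_tensor β X' Y') HEq.rfl
  map_associator X Y Z :=
    hom_heq_of_lin ((conjYD_tensor β (X ⊗ Y) Z).trans
        (congrArg (· ⊗ conjYD β Z) (conjYD_tensor β X Y)))
      ((conjYD_tensor β X (Y ⊗ Z)).trans (congrArg (conjYD β X ⊗ ·) (conjYD_tensor β Y Z)))
      (heq_of_eq (conj_assoc_lin β X.rep Y.rep Z.rep))
  map_leftUnitor X :=
    hom_heq_of_lin ((conjYD_tensor β (𝟙_ _) X).trans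
      (congrArg (· ⊗ conjYD β X) (conjYD_unit β))) rfl HEq.rfl
  map_rightUnitor X :=
    hom_heq_of_lin ((conjYD_tensor β X (𝟙_ _)).trans
      (congrArg (conjYD β X ⊗ ·) (conjYD_unit β))) rfl HEq.rfl

/-- `YD(H)` as a crossed T-category. -/
def crossedCategory (H : QuasiTuraevCoalgebra k π) : CrossedCategory π (YD H) where
  deg X := X.rep.deg
  deg_eq_of_hom f := f.hom.deg_eq
  deg_tensor _ _ := rfl
  conj := conjFunctor
  conj_strict := conjFunctor_strict
  conj_one := CategoryTheory.Functor.hext conjYD_one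
    fun X Y _ => hom_heq_of_lin (conjYD_one X) (conjYD_one Y) HEq.rfl
  conj_mul β γ := CategoryTheory.Functor.hext (conjYD_mul β γ)
    fun X Y _ => hom_heq_of_lin (conjYD_mul β γ X) (conjYD_mul β γ Y) HEq.rfl
  deg_conj _ _ := rfl

end YD

/-! ### The two functors and the braiding of `YD(H)`. -/

open HRep

variable {k : Type u} [Field k] {π : Type v} [Group π] {H : QuasiTuraevCoalgebra k π}

theorem CrossedCenter.isYD_centerCoact (Z : CrossedCenter (crossed H)) :
    IsYD Z.obj (centerCoact Z) :=
  YD.isYD_of_eq Z.isOpHalfBraiding fun _ => rfl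

theorem CrossedCenter.family_centerCoact (Z : CrossedCenter (crossed H)) :
    YD.family ⟨Z.obj, centerCoact Z, Z.isYD_centerCoact⟩ = Z.family :=
  YD.family_mk_of_eq Z.isOpHalfBraiding (fun _ => rfl) Z.isYD_centerCoact

/-- The functor from the center of `Rep(H)` to `YD(H)`. -/
def CrossedCenter.toYD (H : QuasiTuraevCoalgebra k π) : CrossedCenter (crossed H) ⥤ YD H where
  obj Z := ⟨Z.obj, centerCoact Z, Z.isYD_centerCoact⟩
  map {Z Z'} f := YD.homMk f.hom (by
    rw [family_centerCoact, family_centerCoact]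
    exact CrossedCenter.isCentral_hom f)
  map_id _ := rfl
  map_comp _ _ := rfl

theorem CrossedCenter.family_toYD (Z : CrossedCenter (crossed H)) :
    ((toYD H).obj Z).family = Z.family :=
  Z.family_centerCoact

namespace YD

/-- The functor from `YD(H)` to the center of `Rep(H)`. -/
def toCenter (H : QuasiTuraevCoalgebra k π) : YD H ⥤ CrossedCenter (crossed H) where
  obj X := CrossedCenter.ofFamily X.rep X.family X.isOpHalfBraiding
  map f := CrossedCenter.homMk f.hom (isCentral_hom f)
  map_id _ := rfl
  map_comp _ _ := rfl

theorem family_toCenter (X : YD H) : ((toCenter H).obj X).family = X.family := rfl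

/-- The braiding of `YD(H)`. -/
def braidIso (X Y : YD H) : X ⊗ Y ≅ conjYD X.rep.deg Y ⊗ X :=
  (isoMk (X := conjYD X.rep.deg Y ⊗ X) (Y := X ⊗ Y) (X.isOpHalfBraiding.iso Y.rep).symm (by
    change IsCentral (tensor (conjYD X.rep.deg Y) X).family (tensor X Y).family _
    rw [family_tensor, family_tensor, family_conj]
    exact isCentral_braid X.isOpHalfBraiding Y.isOpHalfBraiding)).symm

/-- The braided crossed T-category structure of `YD(H)`. -/
def braiding (H : QuasiTuraevCoalgebra k π) : CrossedBraiding (crossedCategory H) where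
  c := braidIso
  natural {X X' Y Y'} f g := by
    have hY : conjYD X.rep.deg Y' ⊗ X' = conjYD X'.rep.deg Y' ⊗ X' := by rw [f.hom.deg_eq]
    exact hom_heq_of_lin rfl hY (heq_of_eq
      (CrossedCenter.braidIso_natural ((toCenter H).map f) ((toCenter H).map g)))
  hexagon_right X Y Z :=
    hom_heq_of_lin rfl (congrArg (· ⊗ X) (conjYD_tensor X.rep.deg Y Z))
      (lin_heq_of_heq rfl (congrArg (HRep.tensor · X.rep) (conjObj_tensor X.rep.deg Y.rep Z.rep))
        (((toCenter H).obj X).isHalfBraiding.hexagon Y.rep Z.rep))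
  hexagon_left X Y Z := by
    refine hom_heq_of_lin rfl (congrArg (· ⊗ (X ⊗ Y)) (conjYD_mul X.rep.deg Y.rep.deg Z))
      (lin_heq_of_heq rfl (congrArg (HRep.tensor · (X.rep ⊗ Y.rep))
        (conjObj_mul X.rep.deg Y.rep.deg Z.rep)) (HEq.trans (hom_heq_of_inv_lin rfl rfl
          ((tensor X Y).isOpHalfBraiding.iso Z.rep)
          (((toCenter H).obj X ⊗ (toCenter H).obj Y).c Z.rep) (heq_of_eq ?_))
        (CrossedCenter.tensor_c_heq ((toCenter H).obj X) ((toCenter H).obj Y) Z.rep)))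
    change ((tensor X Y).family Z.rep).lin = (tensorFamily X.family Y.family Z.rep).lin
    rw [family_tensor]
  conj_c β X Y := by
    have h1 : conjYD β (conjYD X.rep.deg Y) =
        conjYD (β * X.rep.deg * β⁻¹) (conjYD β Y) := by
      rw [← conjYD_mul, ← conjYD_mul, inv_mul_cancel_right]
    have h2 : conjObj β (conjObj X.rep.deg Y.rep) =
        conjObj (β * X.rep.deg * β⁻¹) (conjObj β Y.rep) := congrArg YD.rep h1
    have hX := conjObj_tensor β X.rep Y.rep
    have hY := (conjObj_tensor β (conjObj X.rep.deg Y.rep) X.rep).trans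
      (congrArg (HRep.tensor · (conjObj β X.rep)) h2)
    refine hom_heq_of_lin (conjYD_tensor β X Y) ((conjYD_tensor β _ X).trans
      (congrArg (· ⊗ conjYD β X) h1)) (lin_heq_of_heq hX hY (hom_heq_of_inv_lin hX hY
      ((HRep.conjFunctor β).mapIso (X.isOpHalfBraiding.iso Y.rep))
      ((conjYD β X).isOpHalfBraiding.iso (conjObj β Y.rep)) (heq_of_eq ?_)))
    change (X.family Y.rep).lin = ((conjYD β X).family (conjObj β Y.rep)).lin
    rw [family_conj]
    exact (X.isOpHalfBraiding.lin_eq_of_hom ((conjOneIso Y.rep).inv ≫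
      (conjCongrIso (inv_mul_cancel β).symm Y.rep).hom ≫ (conjMulIso β⁻¹ β Y.rep).hom) rfl).symm

theorem isYDStructure : IsYDStructure (crossedCategory H) (braiding H) where
  tensor_obj _ _ := ⟨_, rfl⟩
  unit_obj := ⟨_, rfl⟩
  forget_strict :=
    { obj_unit := rfl
      obj_tensor := fun _ _ => rfl
      map_tensor := fun _ _ => HEq.rfl
      map_associator := fun _ _ _ => HEq.rfl
      map_leftUnitor := fun _ => HEq.rfl
      map_rightUnitor := fun _ => HEq.rfl }
  deg_obj _ := rfl
  conj_obj _ _ := ⟨_, rfl⟩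
  conj_forget _ := rfl
  braiding X Y := ⟨(X.isOpHalfBraiding.iso Y.rep).hom,
    fun v w => (braidFormula_eq X Y.rep v w).symm, HEq.rfl⟩

/-- An object of either category is determined by its module and its family, and both functors
preserve the family. -/
theorem toCenter_toYD_obj (X : YD H) : (CrossedCenter.toYD H).obj ((toCenter H).obj X) = X :=
  ext_of_lin rfl fun M => heq_of_eq (by rw [CrossedCenter.family_toYD, family_toCenter])

theorem toYD_toCenter_obj (Z : CrossedCenter (crossed H)) :
    (toCenter H).obj ((CrossedCenter.toYD H).obj Z) = Z :=
  CrossedCenter.ext_of_lin rfl fun M =>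
    heq_of_eq (by rw [family_toCenter, CrossedCenter.family_toYD])

theorem toCenter_comp_toYD : toCenter H ⋙ CrossedCenter.toYD H = 𝟭 (YD H) :=
  CategoryTheory.Functor.hext toCenter_toYD_obj fun X Y _ =>
    hom_heq_of_lin (toCenter_toYD_obj X) (toCenter_toYD_obj Y) HEq.rfl

theorem toYD_comp_toCenter : CrossedCenter.toYD H ⋙ toCenter H = 𝟭 (CrossedCenter (crossed H)) :=
  CategoryTheory.Functor.hext toYD_toCenter_obj fun Z Z' _ =>
    CrossedCenter.hom_heq_of_lin (toYD_toCenter_obj Z) (toYD_toCenter_obj Z') HEq.rfl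

end YD

/-- Comparing both morphisms with a common morphism `u` of `Rep(H)` allows each half to be checked
definitionally. -/
theorem CrossedCenter.hom_heq_of_hom {Z₁ Z₁' Z₂ Z₂' : CrossedCenter (crossed H)} (h : Z₁ = Z₂)
    (h' : Z₁' = Z₂') {f : Z₁ ⟶ Z₁'} {g : Z₂ ⟶ Z₂'} {U U' : HRep H} (u : U ⟶ U')
    (hf : HEq f.hom u) (hg : HEq g.hom u) : HEq f g := by
  subst h h'
  exact heq_of_eq (Hom.ext (eq_of_heq (hf.trans hg.symm)))

theorem YD.hom_heq_of_hom {X X' Y Y' : YD H} (h : X = Y) (h' : X' = Y') {f : X ⟶ X'} {g : Y ⟶ Y'}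
    {U U' : HRep H} (u : U ⟶ U') (hf : HEq f.hom u) (hg : HEq g.hom u) : HEq f g := by
  subst h h'
  exact heq_of_eq (Hom.ext (eq_of_heq (hf.trans hg.symm)))

/-! ### Strict compatibility of the functors with the braided crossed structures. -/

namespace YD

/-- Recognizing the family behind an explicit coaction identifies the image in the center; the cases
of unit, tensor product and conjugate follow. -/
theorem toCenter_mk {U : HRep H} {d : OpFamily U} (hd : IsOpHalfBraiding U d)
    {ρ : ∀ l : π, U.V →ₗ[k] U.V ⊗[k] H.A l} (h : ∀ l, ρ l = familyCoact d l) (hρ : IsYD U ρ) :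
    (toCenter H).obj ⟨U, ρ, hρ⟩ = CrossedCenter.ofFamily U d hd := by
  have h1 : (⟨U, ρ, hρ⟩ : YD H).family = d := family_mk_of_eq hd h hρ
  subst h1
  rfl

theorem toCenter_unit : (toCenter H).obj (𝟙_ (YD H)) = 𝟙_ (CrossedCenter (crossed H)) :=
  toCenter_mk isOpHalfBraiding_unitFamily unitCoact_eq _

theorem toCenter_tensor (X Y : YD H) :
    (toCenter H).obj (X ⊗ Y) = (toCenter H).obj X ⊗ (toCenter H).obj Y :=
  toCenter_mk (isOpHalfBraiding_tensorFamily X.isOpHalfBraiding Y.isOpHalfBraiding)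
    (tensorCoact_eq X Y) _

theorem toCenter_conj (β : π) (X : YD H) :
    (toCenter H).obj (conjYD β X) = (CrossedCenter.conjFunctor β).obj ((toCenter H).obj X) :=
  toCenter_mk (isOpHalfBraiding_conjFamily β X.isOpHalfBraiding) (conjCoact_eq β X) _

theorem toCenter_isStrictMonoidal : IsStrictMonoidal (toCenter H) where
  obj_unit := toCenter_unit
  obj_tensor := toCenter_tensor
  map_tensor {X X' Y Y'} f g := CrossedCenter.hom_heq_of_hom (toCenter_tensor X Y)
    (toCenter_tensor X' Y') (f.hom ⊗ₘ g.hom) HEq.rfl HEq.rfl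
  map_associator X Y Z := CrossedCenter.hom_heq_of_hom
    ((toCenter_tensor (X ⊗ Y) Z).trans
      (congrArg (· ⊗ (toCenter H).obj Z) (toCenter_tensor X Y)))
    ((toCenter_tensor X (Y ⊗ Z)).trans
      (congrArg ((toCenter H).obj X ⊗ ·) (toCenter_tensor Y Z)))
    (α_ X.rep Y.rep Z.rep).hom HEq.rfl HEq.rfl
  map_leftUnitor X := CrossedCenter.hom_heq_of_hom
    ((toCenter_tensor (𝟙_ _) X).trans
      (congrArg (· ⊗ (toCenter H).obj X) toCenter_unit)) rfl (λ_ X.rep).hom HEq.rfl HEq.rfl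
  map_rightUnitor X := CrossedCenter.hom_heq_of_hom
    ((toCenter_tensor X (𝟙_ _)).trans
      (congrArg ((toCenter H).obj X ⊗ ·) toCenter_unit)) rfl (ρ_ X.rep).hom HEq.rfl HEq.rfl

theorem toCenter_conj_comm (β : π) : (crossedCategory H).conj β ⋙ toCenter H =
    toCenter H ⋙ (CrossedCenter.crossedCategory H).conj β :=
  CategoryTheory.Functor.hext (toCenter_conj β) fun X Y f =>
    CrossedCenter.hom_heq_of_hom (toCenter_conj β X) (toCenter_conj β Y) (conjMap β f.hom)
      HEq.rfl HEq.rfl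

theorem toCenter_braid (X Y : YD H) : HEq ((toCenter H).map (braidIso X Y).hom)
    (CrossedCenter.braidIso ((toCenter H).obj X) ((toCenter H).obj Y)).hom :=
  CrossedCenter.hom_heq_of_hom (toCenter_tensor X Y)
    ((toCenter_tensor (conjYD X.rep.deg Y) X).trans
      (congrArg (· ⊗ (toCenter H).obj X) (toCenter_conj X.rep.deg Y)))
    (X.isOpHalfBraiding.iso Y.rep).hom HEq.rfl HEq.rfl

theorem toCenter_strict :
    IsStrictBraidedCrossed (braiding H) (CrossedCenter.braiding H) (toCenter H) where
  strict := toCenter_isStrictMonoidal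
  deg_obj _ := rfl
  conj_comm := toCenter_conj_comm
  map_c := toCenter_braid

theorem toYD_unit : (CrossedCenter.toYD H).obj (𝟙_ (CrossedCenter (crossed H))) = 𝟙_ (YD H) :=
  (congrArg (CrossedCenter.toYD H).obj toCenter_unit.symm).trans (toCenter_toYD_obj _)

/-- Formal from the strictness of the inverse functor `toCenter`; the same holds for the unit and
the conjugates. -/
theorem toYD_tensor (Z Z' : CrossedCenter (crossed H)) : (CrossedCenter.toYD H).obj (Z ⊗ Z') =
    (CrossedCenter.toYD H).obj Z ⊗ (CrossedCenter.toYD H).obj Z' := by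
  refine Eq.trans (congrArg (CrossedCenter.toYD H).obj ?_) (toCenter_toYD_obj _)
  rw [toCenter_tensor, toYD_toCenter_obj, toYD_toCenter_obj]

theorem toYD_conj (β : π) (Z : CrossedCenter (crossed H)) :
    (CrossedCenter.toYD H).obj ((CrossedCenter.conjFunctor β).obj Z) =
      conjYD β ((CrossedCenter.toYD H).obj Z) := by
  refine Eq.trans (congrArg (CrossedCenter.toYD H).obj ?_) (toCenter_toYD_obj _)
  rw [toCenter_conj, toYD_toCenter_obj]

theorem toYD_isStrictMonoidal : IsStrictMonoidal (CrossedCenter.toYD H) where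
  obj_unit := toYD_unit
  obj_tensor := toYD_tensor
  map_tensor {X X' Y Y'} f g := hom_heq_of_hom (toYD_tensor X Y)
    (toYD_tensor X' Y') (f.hom ⊗ₘ g.hom) HEq.rfl HEq.rfl
  map_associator X Y Z := hom_heq_of_hom
    ((toYD_tensor (X ⊗ Y) Z).trans
      (congrArg (· ⊗ (CrossedCenter.toYD H).obj Z) (toYD_tensor X Y)))
    ((toYD_tensor X (Y ⊗ Z)).trans
      (congrArg ((CrossedCenter.toYD H).obj X ⊗ ·) (toYD_tensor Y Z)))
    (α_ X.obj Y.obj Z.obj).hom HEq.rfl HEq.rfl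
  map_leftUnitor X := hom_heq_of_hom
    ((toYD_tensor (𝟙_ _) X).trans
      (congrArg (· ⊗ (CrossedCenter.toYD H).obj X) toYD_unit)) rfl (λ_ X.obj).hom HEq.rfl HEq.rfl
  map_rightUnitor X := hom_heq_of_hom
    ((toYD_tensor X (𝟙_ _)).trans
      (congrArg ((CrossedCenter.toYD H).obj X ⊗ ·) toYD_unit)) rfl (ρ_ X.obj).hom HEq.rfl HEq.rfl

theorem toYD_conj_comm (β : π) : (CrossedCenter.crossedCategory H).conj β ⋙ CrossedCenter.toYD H =
    CrossedCenter.toYD H ⋙ (crossedCategory H).conj β :=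
  CategoryTheory.Functor.hext (toYD_conj β) fun X Y f =>
    hom_heq_of_hom (toYD_conj β X) (toYD_conj β Y) (conjMap β f.hom) HEq.rfl HEq.rfl

/-- The isomorphism rebuilt with the antipode has the same inverse as the original half-braiding,
hence coincides with it. -/
theorem braid_toYD (Z : CrossedCenter (crossed H)) (M : HRep H) :
    (((CrossedCenter.toYD H).obj Z).isOpHalfBraiding.iso M).hom = (Z.c M).hom := by
  have h : (((CrossedCenter.toYD H).obj Z).family M) = (Z.c M).inv := by
    rw [CrossedCenter.family_toYD]
    rfl
  exact congrArg Iso.hom (Iso.ext_inv h)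

theorem toYD_braid (X Y : CrossedCenter (crossed H)) :
    HEq ((CrossedCenter.toYD H).map (CrossedCenter.braidIso X Y).hom)
      (braidIso ((CrossedCenter.toYD H).obj X) ((CrossedCenter.toYD H).obj Y)).hom :=
  hom_heq_of_hom (toYD_tensor X Y)
    ((toYD_tensor ((CrossedCenter.conjFunctor X.obj.deg).obj Y) X).trans
      (congrArg (· ⊗ (CrossedCenter.toYD H).obj X) (toYD_conj X.obj.deg Y)))
    (X.c Y.obj).hom HEq.rfl (heq_of_eq (braid_toYD X Y.obj))

theorem toYD_strict :
    IsStrictBraidedCrossed (CrossedCenter.braiding H) (braiding H) (CrossedCenter.toYD H) where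
  strict := toYD_isStrictMonoidal
  deg_obj _ := rfl
  conj_comm := toYD_conj_comm
  map_c := toYD_braid

end YD

end

open CategoryTheory MonoidalCategory in
theorem mainTheorem1 {k : Type u} [Field k] {π : Type v} [Group π]
    (H : QuasiTuraevCoalgebra k π) :
    ∃ (F₁ : CrossedCenter (HRep.crossed H) ⥤ YD H) (F₂ : YD H ⥤ CrossedCenter (HRep.crossed H)),
      -- `F₁` and `F₂` are given by the stated formulas, and by `f ↦ f` on morphisms
      (∀ Z, ∃ h, F₁.obj Z = ⟨Z.obj, centerCoact Z, h⟩) ∧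
      F₁ ⋙ YD.forget H = CrossedCenter.forget (HRep.crossed H) ∧
      (∀ X, ∃ c h, F₂.obj X = ⟨X.rep, c, h⟩ ∧
        ∀ (M : HRep H) (v : X.rep.V) (m : M.V),
          (c M).hom.lin (TensorProduct.tmul k v m) = X.braidFormula M v m) ∧
      F₂ ⋙ CrossedCenter.forget (HRep.crossed H) = YD.forget H ∧
      -- they are mutually inverse
      F₁ ⋙ F₂ = 𝟭 (CrossedCenter (HRep.crossed H)) ∧ F₂ ⋙ F₁ = 𝟭 (YD H) ∧
      -- they are isomorphisms of braided crossed T-categories for the structure of the center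
      -- and for the stated structure on `YD(H)`
      ∃ (_ : MonoidalCategory (CrossedCenter (HRep.crossed H)))
        (TZ : CrossedCategory π (CrossedCenter (HRep.crossed H))) (bZ : CrossedBraiding TZ)
        (_ : MonoidalCategory (YD H)) (TY : CrossedCategory π (YD H)) (bY : CrossedBraiding TY),
        CrossedCenter.IsCenterStructure TZ bZ ∧ YD.IsYDStructure TY bY ∧
        IsStrictBraidedCrossed bZ bY F₁ ∧ IsStrictBraidedCrossed bY bZ F₂ :=
  ⟨CrossedCenter.toYD H, YD.toCenter H, fun _ => ⟨_, rfl⟩, rfl,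
    fun X => ⟨_, _, rfl, fun M v m => (HRep.braidFormula_eq X M v m).symm⟩, rfl,
    YD.toYD_comp_toCenter, YD.toCenter_comp_toYD, inferInstance, CrossedCenter.crossedCategory H,
    CrossedCenter.braiding H, inferInstance, YD.crossedCategory H, YD.braiding H,
    CrossedCenter.isCenterStructure, YD.isYDStructure, YD.toYD_strict, YD.toCenter_strict⟩
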